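/- Let $K$ be a field. A $\mathbb Z_2$-graded vector space is $V=V_0\oplus V_1$; the degree of a homogeneous $x$ is written $|x|$. A Lie superalgebra is a $\mathbb Z_2$-graded vector space with a bilinear bracket of degree $0$ such that $[x,y]=-(-1)^{|x||y|}[y,x]$ and $[x,[y,z]]=[[x,y],z]+(-1)^{|x||y|}[y,[x,z]]$ for homogeneous elements. For $X=(X_1,\dots,X_n)$ homogeneous and $\sigma\in S_n$ put $\epsilon(\sigma,X)=\operatorname{sgn}(\sigma)(-1)^{k}$, where $k$ is the number of pairs $i<j$ with $X_{\sigma(i)},X_{\sigma(j)}$ odd and $\sigma(j)<\sigma(i)$. On $n$-linear maps $F:V^n\to W$ put $(\sigma.F)(X)=\epsilon(\sigma,X)F(X_{\sigma(1)},\dots,X_{\sigma(n)})$, and let $\mathrm{Hom}(\wedge^nV,W)=\{F:\sigma.F=F\ \forall\sigma\in S_n\}$ with its parts $\mathrm{Hom}_\alpha(\wedge^nV,W)$ of degree $\alpha\in\mathbb Z_2$. For multilinear maps $F,F'$ from $V$ to $V$ of arities $p+1,q+1$ with $p,q\ge 0$, homogeneous of degrees $f,f'\in\mathbb Z_2$,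 put $$F\circ F'=\sum_\sigma\sigma.(F*F'),\qquad (F*F')(X)=(-1)^{f'(|X_1|+\dots+|X_p|)}F(X_1,\dots,X_p,F'(X_{p+1},\dots,X_{p+q+1})),$$ the sum being over all $\sigma\in S_{p+q+1}$ with $\sigma(1)<\dots<\sigma(p)$ and $\sigma(p+1)<\dots<\sigma(p+q+1)$, and $[F,F']=F\circ F'-(-1)^{pq+ff'}F'\circ F$; both are extended bilinearly. Let $(\mathfrak g,\pi)$ and $(\mathfrak h,\mu)$ be Lie superalgebras over $K$ and let $\rho:\mathfrak g\to\mathrm{Der}(\mathfrak h)$ be an action, i.e. a morphism of Lie superalgebras of degree $0$ into the superderivations of $\mathfrak h$. Regard $\pi$, $\mu$, $\rho$ as bilinear maps on $V=\mathfrak g\oplus\mathfrak h$ with values in $V$: for $x,y\in\mathfrak g$ and $u,v\in\mathfrak h$ they send $(x+u,y+v)$ to $[x,y]$, to $[u,v]$, and to $\rho(x)v-(-1)^{|u||y|}\rho(y)u$ ($u,y$ homogeneous) respectively. Regard $f\in\mathrm{Hom}(\wedge^n\mathfrak g,\mathfrak h)$ as the map $V^n\to V$, $(x_1+u_1,\dots,x_n+u_n)\mapsto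 f(x_1,\dots,x_n)$. Let $C^n(\mathfrak g,\mathfrak h)=\mathrm{Hom}(\wedge^n\mathfrak g,\mathfrak h)$ for $n\ge1$, $C^0=0$, $C^*(\mathfrak g,\mathfrak h)=\bigoplus_{n\ge1}C^n(\mathfrak g,\mathfrak h)$, where $\mathrm{Hom}_\alpha(\wedge^n\mathfrak g,\mathfrak h)$ has degree $(n,\alpha)\in\mathbb N\times\mathbb Z_2$. Put $$[\![f_1,f_2]\!]=(-1)^{m-1}[[\mu,f_1],f_2]\ \ (f_1\in C^m(\mathfrak g,\mathfrak h),\ f_2\in C^*(\mathfrak g,\mathfrak h)),\qquad \partial_{\pi+\rho}f=[\pi+\rho,f].$$ Let $D:\mathfrak g\to\mathfrak h$ be a crossed homomorphism, i.e. a linear map of degree $0$ with $D([x,y])=\rho(x)D(y)-(-1)^{|x||y|}\rho(y)D(x)+[D(x),D(y)]$ for homogeneous $x,y\in\mathfrak g$, and put $d_Df=\partial_{\pi+\rho}f+[\![D,f]\!]$. **Theorem.** $(C^*(\mathfrak g,\mathfrak h),[\![\cdot,\cdot]\!],d_D)$ is a differential $\mathbb N\times\mathbb Z_2$-graded Lie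 algebra. That is, $C^*(\mathfrak g,\mathfrak h)=\bigoplus_{n\ge 1,\,\alpha\in\mathbb Z_2}\mathrm{Hom}_\alpha(\wedge^n\mathfrak g,\mathfrak h)$ is closed under $[\![\cdot,\cdot]\!]$ and $d_D$; the bracket has degree $(0,0)$; for $f_1,f_2$ of degrees $(l,r),(m,s)$ and any $f_3$, $$[\![f_1,f_2]\!]=-(-1)^{lm+rs}[\![f_2,f_1]\!],\qquad [\![f_1,[\![f_2,f_3]\!]]\!]=[\![[\![f_1,f_2]\!],f_3]\!]+(-1)^{lm+rs}[\![f_2,[\![f_1,f_3]\!]]\!];$$ and $d_D$ has degree $(1,0)$, $d_D[\![f_1,f_2]\!]=[\![d_Df_1,f_2]\!]+(-1)^{l}[\![f_1,d_Df_2]\!]$ and $d_D^2=0$. Consequently $d_D(C^{n-1})\subseteq\ker(d_D|_{C^n})$ for all $n\ge 1$, and the cohomology $H^*(D)=\bigoplus_n H^n(D)$ with $H^n(D)=\ker(d_D|_{C^n})/d_D(C^{n-1})$ is defined. -/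

import Mathlib

open scoped DirectSum

noncomputable section

namespace SuperLie

/-! ### `ℤ/2`-graded vector spaces -/

section Super

variable {K : Type*} [Field K] {V : Type*} [AddCommGroup V] [Module K V]
  {W : Type*} [AddCommGroup W] [Module K W]

/-- The projection of a `ℤ/2`-graded vector space `V = V₀ ⊕ V₁` onto its part of degree `a`. -/
def proj (𝒱 : ZMod 2 → Submodule K V) [DirectSum.Decomposition 𝒱] (a : ZMod 2) : V →ₗ[K] V :=
  (𝒱 a).subtype ∘ₗ DirectSum.component K (ZMod 2) (fun b => 𝒱 b) a ∘ₗ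
    (DirectSum.decomposeLinearEquiv 𝒱).toLinearMap

theorem proj_mem (𝒱 : ZMod 2 → Submodule K V) [DirectSum.Decomposition 𝒱] (a : ZMod 2) (x : V) :
    proj 𝒱 a x ∈ 𝒱 a :=
  Submodule.coe_mem _

theorem sum_proj (𝒱 : ZMod 2 → Submodule K V) [DirectSum.Decomposition 𝒱] (x : V) :
    ∑ a, proj 𝒱 a x = x := by
  classical
  conv_rhs => rw [← DirectSum.sum_support_decompose 𝒱 x]
  symm
  apply Finset.sum_subset (Finset.subset_univ _)
  intro a _ ha
  simpa using ha

theorem proj_of_mem (𝒱 : ZMod 2 → Submodule K V) [DirectSum.Decomposition 𝒱] {a : ZMod 2}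
    {x : V} (hx : x ∈ 𝒱 a) (b : ZMod 2) : proj 𝒱 b x = if a = b then x else 0 := by
  change ((DirectSum.decompose 𝒱 x b : 𝒱 b) : V) = _
  split_ifs with h
  · subst h
    exact DirectSum.decompose_of_mem_same 𝒱 hx
  · exact DirectSum.decompose_of_mem_ne 𝒱 hx h

/-- The grading `(V ⊕ W)_a = V_a ⊕ W_a` of the direct sum of two graded vector spaces. -/
def prodGrading (𝒱 : ZMod 2 → Submodule K V) (𝒲 : ZMod 2 → Submodule K W) :
    ZMod 2 → Submodule K (V × W) :=
  fun a => (𝒱 a).prod (𝒲 a)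

instance prodDecomposition (𝒱 : ZMod 2 → Submodule K V) (𝒲 : ZMod 2 → Submodule K W)
    [DirectSum.Decomposition 𝒱] [DirectSum.Decomposition 𝒲] :
    DirectSum.Decomposition (prodGrading 𝒱 𝒲) :=
  DirectSum.Decomposition.ofLinearMap (prodGrading 𝒱 𝒲)
    (∑ a : ZMod 2, DirectSum.lof K (ZMod 2) (fun b => prodGrading 𝒱 𝒲 b) a ∘ₗ
      LinearMap.codRestrict (prodGrading 𝒱 𝒲 a) ((proj 𝒱 a).prodMap (proj 𝒲 a))
        (fun x => ⟨proj_mem 𝒱 a x.1, proj_mem 𝒲 a x.2⟩))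
    (by
      refine LinearMap.ext fun x => ?_
      simp only [LinearMap.comp_apply, LinearMap.sum_apply, map_sum, DirectSum.coeLinearMap_lof,
        LinearMap.id_apply]
      change ∑ a, (proj 𝒱 a x.1, proj 𝒲 a x.2) = x
      ext <;> simp [Prod.fst_sum, Prod.snd_sum, sum_proj])
    (by
      refine DirectSum.linearMap_ext _ fun a => LinearMap.ext fun x => ?_
      obtain ⟨⟨x, y⟩, hx, hy⟩ := x
      simp only [LinearMap.comp_apply, DirectSum.coeLinearMap_lof, LinearMap.sum_apply,
        LinearMap.id_apply]
      rw [Finset.sum_eq_single a]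
      · congr 1
        apply Subtype.ext
        change (proj 𝒱 a x, proj 𝒲 a y) = (x, y)
        simp [proj_of_mem 𝒱 hx, proj_of_mem 𝒲 hy]
      · intro b _ hb
        rw [← map_zero (DirectSum.lof K (ZMod 2) (fun b => prodGrading 𝒱 𝒲 b) b)]
        congr 1
        apply Subtype.ext
        change (proj 𝒱 b x, proj 𝒲 b y) = (0, 0)
        simp [proj_of_mem 𝒱 hx, proj_of_mem 𝒲 hy, hb.symm]
      · simp)

/-- The sign `(-1)^a` for `a ∈ ℤ/2`. -/
def ssign (a : ZMod 2) : ℤ := (-1) ^ a.val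

/-! ### Super-alternating multilinear maps -/

/-- The `n`-linear maps `V × ⋯ × V → W`. -/
abbrev Multi (K : Type*) [Field K] (n : ℕ) (V : Type*) [AddCommGroup V] [Module K V]
    (W : Type*) [AddCommGroup W] [Module K W] :=
  MultilinearMap K (fun _ : Fin n => V) W

/-- The sign `ε(σ, X) = ε(σ) (-1)^{K(σ, X)}`, for `X = (X_1, …, X_n)` with `X_i` homogeneous of
degree `a i`, where `K(σ, X)` counts the pairs `i < j` such that `X_{σ i}`, `X_{σ j}` are odd and
`σ j < σ i`. -/
def koszulSign {n : ℕ} (σ : Equiv.Perm (Fin n)) (a : Fin n → ZMod 2) : ℤ :=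
  (Equiv.Perm.sign σ : ℤ) * (-1) ^ (Finset.univ.filter fun ij : Fin n × Fin n =>
    ij.1 < ij.2 ∧ a (σ ij.1) = 1 ∧ a (σ ij.2) = 1 ∧ σ ij.2 < σ ij.1).card

/-- `(σ.F)(X) = ε(σ, X) F(X_{σ 1}, …, X_{σ n})` on homogeneous `X`, extended multilinearly (the
summand with index `a` sees the components of degree `a i` of the `X_i`). -/
def permAct (𝒱 : ZMod 2 → Submodule K V) [DirectSum.Decomposition 𝒱] {n : ℕ}
    (σ : Equiv.Perm (Fin n)) : Multi K n V W →ₗ[K] Multi K n V W where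
  toFun F := ∑ a : Fin n → ZMod 2, koszulSign σ a •
    (F.compLinearMap fun i => proj 𝒱 (a (σ i))).domDomCongr σ
  map_add' F G := by
    ext X
    simp [Finset.sum_add_distrib]
  map_smul' c F := by
    ext X
    simp [Finset.smul_sum, smul_comm c]

/-- `Hom(∧ⁿ V, W)`: the `n`-linear maps `F` with `σ.F = F` for all permutations `σ`. -/
def superAlternating (𝒱 : ZMod 2 → Submodule K V) [DirectSum.Decomposition 𝒱] (n : ℕ) (W : Type*)
    [AddCommGroup W] [Module K W] : Submodule K (Multi K n V W) :=
  ⨅ σ : Equiv.Perm (Fin n), LinearMap.ker (permAct 𝒱 σ - LinearMap.id)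

/-- The homogeneous multilinear maps of degree `b`. -/
def homogeneous (𝒱 : ZMod 2 → Submodule K V) (𝒲 : ZMod 2 → Submodule K W) (n : ℕ) (b : ZMod 2) :
    Submodule K (Multi K n V W) where
  carrier := {F | ∀ (a : Fin n → ZMod 2) (X : Fin n → V), (∀ i, X i ∈ 𝒱 (a i)) →
    F X ∈ 𝒲 (b + ∑ i, a i)}
  add_mem' hF hG _ _ hX := Submodule.add_mem _ (hF _ _ hX) (hG _ _ hX)
  zero_mem' _ _ _ := Submodule.zero_mem _
  smul_mem' c _ hF _ _ hX := Submodule.smul_mem _ c (hF _ _ hX)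

/-- The homogeneous component of degree `b` of a multilinear map. -/
def degPart (𝒱 : ZMod 2 → Submodule K V) (𝒲 : ZMod 2 → Submodule K W)
    [DirectSum.Decomposition 𝒱] [DirectSum.Decomposition 𝒲] {n : ℕ} (b : ZMod 2) :
    Multi K n V W →ₗ[K] Multi K n V W where
  toFun F := ∑ a : Fin n → ZMod 2, (proj 𝒲 (b + ∑ i, a i)).compMultilinearMap
    (F.compLinearMap fun i => proj 𝒱 (a i))
  map_add' F G := by
    ext X
    simp [Finset.sum_add_distrib]
  map_smul' c F := by
    ext X
    simp [Finset.smul_sum]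

/-! ### The graded Lie algebra of super-alternating maps -/

/-- `F(X_1, …, X_p, F'(X_{p+1}, …, X_{p+q+1}))`. -/
def insertLast {p q : ℕ} (F : Multi K (p + 1) V V) (F' : Multi K (q + 1) V V) :
    Multi K (p + q + 1) V V :=
  MultilinearMap.domDomCongr (finSumFinEquiv (m := p) (n := q + 1))
    { toFun := fun X => F (Fin.snoc (α := fun _ => V) (fun i => X (Sum.inl i))
        (F' fun j => X (Sum.inr j)))
      map_update_add' := by
        intro _ X i x y
        rcases i with i | j
        · have h : ∀ z, (fun k : Fin p => Function.update X (Sum.inl i) z (Sum.inl k)) =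
              Function.update (fun k => X (Sum.inl k)) i z := fun z => by
            ext k
            simp [Function.update_apply]
          simp only [h, Function.update_of_ne, ne_eq, reduceCtorEq, not_false_eq_true,
            Fin.snoc_update, MultilinearMap.map_update_add]
        · have h : ∀ z, (fun k : Fin (q + 1) => Function.update X (Sum.inr j) z (Sum.inr k)) =
              Function.update (fun k => X (Sum.inr k)) j z := fun z => by
            ext k
            simp [Function.update_apply]
          simp only [h, Function.update_of_ne, ne_eq, reduceCtorEq, not_false_eq_true,
            MultilinearMap.map_update_add]
          exact F.snoc_add _ _ _
      map_update_smul' := by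
        intro _ X i c x
        rcases i with i | j
        · have h : ∀ z, (fun k : Fin p => Function.update X (Sum.inl i) z (Sum.inl k)) =
              Function.update (fun k => X (Sum.inl k)) i z := fun z => by
            ext k
            simp [Function.update_apply]
          simp only [h, Function.update_of_ne, ne_eq, reduceCtorEq, not_false_eq_true,
            Fin.snoc_update, MultilinearMap.map_update_smul]
        · have h : ∀ z, (fun k : Fin (q + 1) => Function.update X (Sum.inr j) z (Sum.inr k)) =
              Function.update (fun k => X (Sum.inr k)) j z := fun z => by
            ext k
            simp [Function.update_apply]
          simp only [h, Function.update_of_ne, ne_eq, reduceCtorEq, not_false_eq_true,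
            MultilinearMap.map_update_smul]
          exact F.snoc_smul _ _ _ }

theorem insertLast_apply {p q : ℕ} (F : Multi K (p + 1) V V) (F' : Multi K (q + 1) V V)
    (X : Fin (p + (q + 1)) → V) : insertLast F F' X =
      F (Fin.snoc (α := fun _ => V) (fun i => X (Fin.castAdd (q + 1) i))
        (F' fun j => X (Fin.natAdd p j))) := by
  simp [insertLast]

/-- `(F * F')(X) = (-1)^{b (x_1 + ⋯ + x_p)} F(X_1, …, X_p, F'(X_{p+1}, …, X_{p+q+1}))` for `X_i`
homogeneous of degree `x_i`, extended multilinearly; it is used for `F'` homogeneous of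
degree `b`. -/
def star (𝒱 : ZMod 2 → Submodule K V) [DirectSum.Decomposition 𝒱] {p q : ℕ} (b : ZMod 2)
    (F : Multi K (p + 1) V V) (F' : Multi K (q + 1) V V) : Multi K (p + q + 1) V V :=
  ∑ a : Fin (p + q + 1) → ZMod 2, ssign (b * ∑ i : Fin p, a (Fin.castAdd (q + 1) i)) •
    (insertLast F F').compLinearMap fun i => proj 𝒱 (a i)

theorem star_add_left (𝒱 : ZMod 2 → Submodule K V) [DirectSum.Decomposition 𝒱] {p q : ℕ}
    (b : ZMod 2) (F₁ F₂ : Multi K (p + 1) V V) (F' : Multi K (q + 1) V V) :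
    star 𝒱 b (F₁ + F₂) F' = star 𝒱 b F₁ F' + star 𝒱 b F₂ F' := by
  ext X
  simp [star, insertLast_apply, Finset.sum_add_distrib]

theorem star_smul_left (𝒱 : ZMod 2 → Submodule K V) [DirectSum.Decomposition 𝒱] {p q : ℕ}
    (b : ZMod 2) (c : K) (F : Multi K (p + 1) V V) (F' : Multi K (q + 1) V V) :
    star 𝒱 b (c • F) F' = c • star 𝒱 b F F' := by
  ext X
  simp [star, insertLast_apply, Finset.smul_sum, smul_comm c]

theorem star_add_right (𝒱 : ZMod 2 → Submodule K V) [DirectSum.Decomposition 𝒱] {p q : ℕ}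
    (b : ZMod 2) (F : Multi K (p + 1) V V) (F₁ F₂ : Multi K (q + 1) V V) :
    star 𝒱 b F (F₁ + F₂) = star 𝒱 b F F₁ + star 𝒱 b F F₂ := by
  ext X
  simp [star, insertLast_apply, Finset.sum_add_distrib,
    MultilinearMap.snoc_add]

theorem star_smul_right (𝒱 : ZMod 2 → Submodule K V) [DirectSum.Decomposition 𝒱] {p q : ℕ}
    (b : ZMod 2) (c : K) (F : Multi K (p + 1) V V) (F' : Multi K (q + 1) V V) :
    star 𝒱 b F (c • F') = c • star 𝒱 b F F' := by
  ext X
  simp [star, insertLast_apply, Finset.smul_sum, smul_comm c,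
    MultilinearMap.snoc_smul]

open Classical in
/-- The permutations `σ` of `p + q` letters with `σ 1 < ⋯ < σ p` and
`σ (p + 1) < ⋯ < σ (p + q)`. -/
def shuffles (p q : ℕ) : Finset (Equiv.Perm (Fin (p + q))) :=
  Finset.univ.filter fun σ =>
    StrictMono (fun i : Fin p => σ (Fin.castAdd q i)) ∧
      StrictMono (fun j : Fin q => σ (Fin.natAdd p j))

/-- `F ∘ F' = ∑_σ σ.(F * F')` over the `(p, q + 1)`-shuffles `σ`, for `F` of arity `p + 1` and `F'`
of arity `q + 1`; a general `F'` is the sum of its homogeneous components. -/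
def circ (𝒱 : ZMod 2 → Submodule K V) [DirectSum.Decomposition 𝒱] (p q : ℕ) :
    Multi K (p + 1) V V →ₗ[K] Multi K (q + 1) V V →ₗ[K] Multi K (p + q + 1) V V :=
  LinearMap.mk₂ K
    (fun F F' => ∑ b : ZMod 2, ∑ σ ∈ shuffles p (q + 1),
      permAct 𝒱 σ (star 𝒱 b F (degPart 𝒱 𝒱 b F')))
    (fun F₁ F₂ F' => by simp only [star_add_left, map_add, Finset.sum_add_distrib])
    (fun c F F' => by simp only [star_smul_left, map_smul, Finset.smul_sum])
    (fun F F₁ F₂ => by simp only [star_add_right, map_add, Finset.sum_add_distrib])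
    (fun c F F' => by simp only [star_smul_right, map_smul, Finset.smul_sum])

/-- The sum over `p ≥ 0` of the spaces of `(p + 1)`-linear maps `V × ⋯ × V → V`; the summand with
index `p` has degree `p`. -/
abbrev NR (K : Type*) [Field K] (V : Type*) [AddCommGroup V] [Module K V] :=
  ⨁ p : ℕ, Multi K (p + 1) V V

/-- A multilinear map of arity `p + 1` as an element of degree `p`. -/
abbrev ofMulti (p : ℕ) : Multi K (p + 1) V V →ₗ[K] NR K V :=
  DirectSum.lof K ℕ (fun p => Multi K (p + 1) V V) p

/-- The bracket `[F, F'] = F ∘ F' - (-1)^{p q + f f'} F' ∘ F` for `F` of degree `(p, f)` and `F'` of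
degree `(q, f')`, extended bilinearly. -/
def nrBracket (𝒱 : ZMod 2 → Submodule K V) [DirectSum.Decomposition 𝒱] :
    NR K V →ₗ[K] NR K V →ₗ[K] NR K V :=
  DirectSum.toModule K ℕ _ fun p => LinearMap.flip <| DirectSum.toModule K ℕ _ fun q =>
    LinearMap.flip <| LinearMap.mk₂ K
      (fun F F' => ∑ f : ZMod 2, ∑ f' : ZMod 2,
        (ofMulti (p + q) (circ 𝒱 p q (degPart 𝒱 𝒱 f F) (degPart 𝒱 𝒱 f' F')) -
          ((-1) ^ (p * q) * ssign (f * f')) •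
            ofMulti (q + p) (circ 𝒱 q p (degPart 𝒱 𝒱 f' F') (degPart 𝒱 𝒱 f F))))
      (fun F₁ F₂ F' => by
        simp only [map_add, LinearMap.add_apply, ← Finset.sum_add_distrib, smul_add]
        exact Finset.sum_congr rfl fun _ _ => Finset.sum_congr rfl fun _ _ => by abel)
      (fun c F F' => by
        simp only [map_smul, LinearMap.smul_apply, Finset.smul_sum, smul_sub, smul_comm c])
      (fun F F₁ F₂ => by
        simp only [map_add, LinearMap.add_apply, ← Finset.sum_add_distrib, smul_add]
        exact Finset.sum_congr rfl fun _ _ => Finset.sum_congr rfl fun _ _ => by abel)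
      (fun c F F' => by
        simp only [map_smul, LinearMap.smul_apply, Finset.smul_sum, smul_sub, smul_comm c])

/-! ### Differential graded Lie algebras -/

/-- The commutation sign `(-1)^{m n + α β}` of the degrees `(m, α)` and `(n, β)`. -/
def commSign (i j : ℕ × ZMod 2) : ℤ := (-1) ^ (i.1 * j.1) * ssign (i.2 * j.2)

/-- Inside a vector space `A` with a bilinear operation `br` and a linear map `d`, the subspace `C`,
with the grading `C = ⨁ L i` over `i ∈ ℕ × ℤ/2`, is closed under both and is a differential graded
Lie algebra: `br` is a graded Lie bracket of degree `(0, 0)` and `d` is a graded derivation of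
degree `(1, 0)` with square zero. -/
structure IsDifferentialGradedLieAlgebra {A : Type*} [AddCommGroup A] [Module K A]
    (C : Submodule K A) (L : ℕ × ZMod 2 → Submodule K A) (br : A →ₗ[K] A →ₗ[K] A)
    (d : A →ₗ[K] A) : Prop where
  iSup_eq : ⨆ i, L i = C
  independent : iSupIndep L
  bracket_mem : ∀ i j, ∀ x ∈ L i, ∀ y ∈ L j, br x y ∈ L (i + j)
  bracket_skew : ∀ i j, ∀ x ∈ L i, ∀ y ∈ L j, br x y = -(commSign i j • br y x)
  jacobi : ∀ i j, ∀ x ∈ L i, ∀ y ∈ L j, ∀ z ∈ C,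
    br x (br y z) = br (br x y) z + commSign i j • br y (br x z)
  d_mem : ∀ i, ∀ x ∈ L i, d x ∈ L (i + (1, 0))
  d_bracket : ∀ i, ∀ x ∈ L i, ∀ y ∈ C,
    d (br x y) = br (d x) y + commSign (1, 0) i • br x (d y)
  d_d : ∀ x ∈ C, d (d x) = 0

/-- The quotient of a subspace `Z` by its subspace `B` (by `Z ∩ B` if `B` is not inside `Z`). -/
abbrev Subquotient {A : Type*} [AddCommGroup A] [Module K A] (Z B : Submodule K A) :=
  Z ⧸ B.submoduleOf Z

instance Subquotient.addCommGroup {A : Type*} [AddCommGroup A] [Module K A]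
    (Z B : Submodule K A) : AddCommGroup (Subquotient Z B) :=
  inferInstance

instance Subquotient.module {A : Type*} [AddCommGroup A] [Module K A]
    (Z B : Submodule K A) : Module K (Subquotient Z B) :=
  inferInstance

/-- The quotient map `Z → Z / B`. -/
def Subquotient.mk {A : Type*} [AddCommGroup A] [Module K A] (Z B : Submodule K A) :
    Z →ₗ[K] Subquotient Z B :=
  (B.submoduleOf Z).mkQ

/-! ### Lie superalgebras, actions and crossed homomorphisms -/

/-- A Lie superalgebra structure on the `ℤ/2`-graded vector space `V = V₀ ⊕ V₁`. -/
structure LieSuperalgebra (𝒱 : ZMod 2 → Submodule K V) where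
  bracket : V →ₗ[K] V →ₗ[K] V
  bracket_mem : ∀ a b, ∀ x ∈ 𝒱 a, ∀ y ∈ 𝒱 b, bracket x y ∈ 𝒱 (a + b)
  skew : ∀ a b, ∀ x ∈ 𝒱 a, ∀ y ∈ 𝒱 b, bracket x y = -(ssign (a * b) • bracket y x)
  jacobi : ∀ a b, ∀ x ∈ 𝒱 a, ∀ y ∈ 𝒱 b, ∀ z,
    bracket x (bracket y z) = bracket (bracket x y) z + ssign (a * b) • bracket y (bracket x z)

/-- `T` is a derivation of degree `s` of the Lie superalgebra `(V, μ)`. -/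
structure IsDerivation {𝒱 : ZMod 2 → Submodule K V} (μ : LieSuperalgebra 𝒱) (s : ZMod 2)
    (T : V →ₗ[K] V) : Prop where
  map_mem : ∀ a, ∀ x ∈ 𝒱 a, T x ∈ 𝒱 (s + a)
  leibniz : ∀ a, ∀ x ∈ 𝒱 a, ∀ y,
    T (μ.bracket x y) = μ.bracket (T x) y + ssign (s * a) • μ.bracket x (T y)

/-- An action of `(V, π)` on `(W, μ)`: a morphism of Lie superalgebras `V → Der(W)` of degree `0`,
where `Der(W)` carries the supercommutator bracket. -/
structure Action {𝒱 : ZMod 2 → Submodule K V} {𝒲 : ZMod 2 → Submodule K W}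
    (π : LieSuperalgebra 𝒱) (μ : LieSuperalgebra 𝒲) where
  toLin : V →ₗ[K] W →ₗ[K] W
  isDerivation : ∀ a, ∀ x ∈ 𝒱 a, IsDerivation μ a (toLin x)
  map_bracket : ∀ a b, ∀ x ∈ 𝒱 a, ∀ y ∈ 𝒱 b,
    toLin (π.bracket x y) = toLin x ∘ₗ toLin y - ssign (a * b) • (toLin y ∘ₗ toLin x)

/-- `D : V → W` is a crossed homomorphism with respect to the action `ρ`. -/
structure IsCrossedHom {𝒱 : ZMod 2 → Submodule K V} {𝒲 : ZMod 2 → Submodule K W}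
    {π : LieSuperalgebra 𝒱} {μ : LieSuperalgebra 𝒲} (ρ : Action π μ) (D : V →ₗ[K] W) :
    Prop where
  map_mem : ∀ a, ∀ x ∈ 𝒱 a, D x ∈ 𝒲 a
  map_bracket : ∀ a b, ∀ x ∈ 𝒱 a, ∀ y ∈ 𝒱 b,
    D (π.bracket x y) =
      ρ.toLin x (D y) - ssign (a * b) • ρ.toLin y (D x) + μ.bracket (D x) (D y)

end Super

/-! ### The complex of a crossed homomorphism -/

section Complex

variable {K : Type*} [Field K] {G : Type*} [AddCommGroup G] [Module K G]
  {H : Type*} [AddCommGroup H] [Module K H]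
  {𝒢 : ZMod 2 → Submodule K G} {ℋ : ZMod 2 → Submodule K H}
  [DirectSum.Decomposition 𝒢] [DirectSum.Decomposition ℋ]

/-- A bilinear map `(x, y) ↦ B (S x) (T y)` as a multilinear map in two variables. -/
def bilin {V A B W : Type*} [AddCommGroup V] [Module K V] [AddCommGroup A] [Module K A]
    [AddCommGroup B] [Module K B] [AddCommGroup W] [Module K W] (S : V →ₗ[K] A) (T : V →ₗ[K] B)
    (β : A →ₗ[K] B →ₗ[K] W) : Multi K 2 V W where
  toFun X := β (S (X 0)) (T (X 1))
  map_update_add' := by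
    intro _ X i x y
    fin_cases i <;> simp
  map_update_smul' := by
    intro _ X i c x
    fin_cases i <;> simp

/-- The element of degree `1` given by the bracket `π` of `G`:
`(x + u, y + v) ↦ [x, y]`. -/
def piHat (H : Type*) [AddCommGroup H] [Module K H] (π : LieSuperalgebra 𝒢) : NR K (G × H) :=
  ofMulti 1 ((LinearMap.inl K G H).compMultilinearMap
    (bilin (LinearMap.fst K G H) (LinearMap.fst K G H) π.bracket))

/-- The element of degree `1` given by the bracket `μ` of `H`:
`(x + u, y + v) ↦ [u, v]`. -/
def muHat (G : Type*) [AddCommGroup G] [Module K G] (μ : LieSuperalgebra ℋ) : NR K (G × H) :=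
  ofMulti 1 ((LinearMap.inr K G H).compMultilinearMap
    (bilin (LinearMap.snd K G H) (LinearMap.snd K G H) μ.bracket))

/-- The element of degree `1` given by the action `ρ`, the super-alternating extension
`∑_σ σ.ρ` of `(x + u, y + v) ↦ ρ(x) v`; so it sends `(x + u, y + v)` to
`ρ(x) v - (-1)^{a b} ρ(y) u` for `u` and `y` of degrees `a` and `b`. -/
def rhoHat {π : LieSuperalgebra 𝒢} {μ : LieSuperalgebra ℋ} (ρ : Action π μ) : NR K (G × H) :=
  ofMulti 1 (∑ σ ∈ shuffles 1 1, permAct (prodGrading 𝒢 ℋ) σ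
    ((LinearMap.inr K G H).compMultilinearMap
      (bilin (LinearMap.fst K G H) (LinearMap.snd K G H) ρ.toLin)))

/-- The extension of `f : G × ⋯ × G → H` to `G ⊕ H`:
`(x_1 + u_1, …, x_n + u_n) ↦ f(x_1, …, x_n)`. -/
def hat {n : ℕ} : Multi K n G H →ₗ[K] Multi K n (G × H) (G × H) where
  toFun f := (LinearMap.inr K G H).compMultilinearMap
    (f.compLinearMap fun _ => LinearMap.fst K G H)
  map_add' f g := by
    ext X <;> simp
  map_smul' c f := by
    ext X <;> simp

theorem hat_injective {n : ℕ} : Function.Injective (hat (K := K) (G := G) (H := H) (n := n)) := by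
  intro f g h
  ext X
  simpa [hat] using congrArg Prod.snd (congrFun (congrArg DFunLike.coe h) fun i => (X i, 0))

variable (𝒢 ℋ) in
/-- `C^n(𝔤, 𝔥) = Hom(∧ⁿ 𝔤, 𝔥)` for `n ≥ 1`, seen inside the multilinear maps on `𝔤 ⊕ 𝔥`, and
`C^0 = 0`. -/
def cochains : ℕ → Submodule K (NR K (G × H))
  | 0 => ⊥
  | p + 1 => (superAlternating 𝒢 (p + 1) H).map (ofMulti p ∘ₗ hat)

variable (𝒢 ℋ) in
/-- The part `Hom_α(∧ⁿ 𝔤, 𝔥)` of degree `(n, α)` of `C^*(𝔤, 𝔥)`, for `n ≥ 1`. -/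
def gradedCochains : ℕ × ZMod 2 → Submodule K (NR K (G × H))
  | (0, _) => ⊥
  | (p + 1, α) => (superAlternating 𝒢 (p + 1) H ⊓ homogeneous 𝒢 ℋ (p + 1) α).map
      (ofMulti p ∘ₗ hat)

variable (𝒢 ℋ) in
/-- `C^*(𝔤, 𝔥) = ⨁_{n ≥ 1} Hom(∧ⁿ 𝔤, 𝔥)`. -/
def totalCochains : Submodule K (NR K (G × H)) := ⨆ n, cochains 𝒢 (H := H) n

/-- Multiplication by `(-1)^{m - 1}` on the maps of arity `m`. -/
def aritySign (V : Type*) [AddCommGroup V] [Module K V] : NR K V →ₗ[K] NR K V :=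
  DirectSum.toModule K ℕ _ fun p => ((-1 : ℤ) ^ p) • ofMulti p

/-- The derived bracket `⟦f₁, f₂⟧ = (-1)^{m - 1} [[μ, f₁], f₂]` for `f₁` of arity `m`. -/
def derivedBracket (𝒢 : ZMod 2 → Submodule K G) [DirectSum.Decomposition 𝒢]
    (μ : LieSuperalgebra ℋ) : NR K (G × H) →ₗ[K] NR K (G × H) →ₗ[K] NR K (G × H) :=
  nrBracket (prodGrading 𝒢 ℋ) ∘ₗ nrBracket (prodGrading 𝒢 ℋ) (muHat G μ) ∘ₗ aritySign (G × H)

/-- `∂_{π+ρ} f = [π + ρ, f]`. -/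
def partialPiRho {π : LieSuperalgebra 𝒢} {μ : LieSuperalgebra ℋ} (ρ : Action π μ) :
    NR K (G × H) →ₗ[K] NR K (G × H) :=
  nrBracket (prodGrading 𝒢 ℋ) (piHat H π + rhoHat ρ)

/-- A linear map `D : 𝔤 → 𝔥` as an element of `Hom(∧¹ 𝔤, 𝔥)`. -/
def ofLinear (D : G →ₗ[K] H) : NR K (G × H) :=
  ofMulti 0 (hat (MultilinearMap.ofSubsingleton K G H (0 : Fin 1) D))

/-- `d_D f = ∂_{π+ρ} f + ⟦D, f⟧`. -/
def dCrossed {π : LieSuperalgebra 𝒢} {μ : LieSuperalgebra ℋ} (ρ : Action π μ) (D : G →ₗ[K] H) :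
    NR K (G × H) →ₗ[K] NR K (G × H) :=
  partialPiRho ρ + derivedBracket 𝒢 μ (ofLinear D)

/-- The `n`-cocycles of `(C^*(𝔤, 𝔥), d_D)`. -/
def cocycles {π : LieSuperalgebra 𝒢} {μ : LieSuperalgebra ℋ} (ρ : Action π μ) (D : G →ₗ[K] H)
    (n : ℕ) : Submodule K (NR K (G × H)) :=
  cochains 𝒢 n ⊓ LinearMap.ker (dCrossed ρ D)

/-- The `n`-coboundaries of `(C^*(𝔤, 𝔥), d_D)`. -/
def coboundaries {π : LieSuperalgebra 𝒢} {μ : LieSuperalgebra ℋ} (ρ : Action π μ)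
    (D : G →ₗ[K] H) : ℕ → Submodule K (NR K (G × H))
  | 0 => ⊥
  | n + 1 => (cochains 𝒢 n).map (dCrossed ρ D)

/-- The `n`-th cohomology `H^n(D)` of the crossed homomorphism `D`. -/
def cohomology {π : LieSuperalgebra 𝒢} {μ : LieSuperalgebra ℋ} (ρ : Action π μ)
    (D : G →ₗ[K] H) (n : ℕ) :=
  Subquotient (cocycles ρ D n) (coboundaries ρ D n)

instance {π : LieSuperalgebra 𝒢} {μ : LieSuperalgebra ℋ} (ρ : Action π μ)
    (D : G →ₗ[K] H) (n : ℕ) : AddCommGroup (cohomology ρ D n) :=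
  Subquotient.addCommGroup (cocycles ρ D n) (coboundaries ρ D n)

instance {π : LieSuperalgebra 𝒢} {μ : LieSuperalgebra ℋ} (ρ : Action π μ)
    (D : G →ₗ[K] H) (n : ℕ) : Module K (cohomology ρ D n) :=
  Subquotient.module (cocycles ρ D n) (coboundaries ρ D n)

/-- The class of a cocycle in `H^n(D)`. -/
def cohomologyClass {π : LieSuperalgebra 𝒢} {μ : LieSuperalgebra ℋ} (ρ : Action π μ)
    (D : G →ₗ[K] H) (n : ℕ) : cocycles ρ D n →ₗ[K] cohomology ρ D n :=
  Subquotient.mk (cocycles ρ D n) (coboundaries ρ D n)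

/-- The total cohomology `H^*(D) = ⨁ H^n(D)`. -/
abbrev totalCohomology {π : LieSuperalgebra 𝒢} {μ : LieSuperalgebra ℋ} (ρ : Action π μ)
    (D : G →ₗ[K] H) :=
  ⨁ n : ℕ, cohomology ρ D n

end Complex

end SuperLie

end

open scoped DirectSum

noncomputable section

namespace SuperLie

/-! ### Signs -/

/-! The cochains are an abelian subalgebra of the Nijenhuis–Richardson algebra of `V = 𝔤 ⊕ 𝔥`, and
`⟦·,·⟧` is the derived bracket on it of the square-zero element `μ`.

The crossed homomorphism is absorbed into the action: `x ↦ ρ(x) + [D(x), ·]` is again an action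
`ρ_D` (`Action.twistBy`), and `ρ_D = ρ + [μ, D]` as elements of degree one (`rhoHat_twistBy`). Since
`⟦D, f⟧ = [[μ, D], f]`, this gives `d_D = ∂_{π+ρ_D}` (`dCrossed_eq_partialPiRho`), so it is enough
to treat `∂_{π+ρ}` for an arbitrary action.

A Lie superalgebra bracket `β` satisfies `β ∘ β = 0`, hence `[β, [β, ·]] = 0`
(`LieSuperalgebra.nrBracket_nrBracket`). The elements `π + ρ + μ`, `π + ρ` and `μ` are all brackets
of semidirect products, the last two after trivializing some of the data. So `∂_{π+ρ}` and `[μ, ·]`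
have square zero and anticommute. Together with the graded Jacobi identity `nrBracket_jacobi` this
yields the rest: skew-symmetry of `⟦·,·⟧` from `[f₁, f₂] = 0`, its Jacobi identity from `[μ, [μ, ·]]
= 0`, the Leibniz rule from the anticommutation. Closure holds because cochains are the
super-alternating maps that take values in `𝔥` and vanish on arguments from `𝔥`
(`mem_gradedCochains`), and any two such maps commute.

The graded Lie algebra itself is handled without shuffles. A map is recorded by its values on lists
of homogeneous vectors (`listEval`), and composition is defined by recursion: contraction with the
first argument is a derivation (`comp`). Then the pre-Lie identity `comp_preLie` is an induction on
the list, and the Jacobi identity follows from three instances of it. The link with the definition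
by shuffles is `shuffleSum_splitTerm`: the first argument of a shuffle opens one of the two blocks,
which is the same recursion. All arguments avoid division by two, so that characteristic two is
covered. -/

theorem ssign_zero : ssign 0 = 1 := rfl

theorem ssign_add (a b : ZMod 2) : ssign (a + b) = ssign a * ssign b := by
  revert a b; decide

theorem ssign_add_one (a : ZMod 2) : ssign (a + 1) = -ssign a := by
  revert a; decide

theorem ssign_mul_self (a : ZMod 2) : ssign a * ssign a = 1 := by
  revert a; decide

theorem ssign_eq_one_or (a : ZMod 2) : ssign a = 1 ∨ ssign a = -1 := by
  revert a; decide

theorem neg_one_pow_eq_ssign (n : ℕ) : (-1 : ℤ) ^ n = ssign (n : ZMod 2) := by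
  induction n with
  | zero => rfl
  | succ n ih => rw [pow_succ, ih, Nat.cast_succ, ssign_add_one]; ring

/-- Both the sign of `σ` and the Koszul exponent are read off from inversions; merged, each
inversion contributes `-(-1)^{ab}`, the cost of one exchange of arguments. In this form a single
letter can be split off. -/
theorem koszulSign_eq_prod {n : ℕ} (σ : Equiv.Perm (Fin n)) (a : Fin n → ZMod 2) :
    koszulSign σ a = ∏ i, ∏ j, if i < j ∧ σ j < σ i then -ssign (a (σ i) * a (σ j)) else 1 := by
  have h1 : ((Equiv.Perm.sign σ : ℤˣ) : ℤ) = ∏ ij : Fin n × Fin n,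
      if ij.1 < ij.2 ∧ σ ij.2 < σ ij.1 then (-1 : ℤ) else 1 := by
    rw [Equiv.Perm.sign_eq_prod_prod_Ioi, Fintype.prod_prod_type, Units.coe_prod]
    refine Finset.prod_congr rfl fun i _ => ?_
    rw [Units.coe_prod, ← Finset.filter_lt_eq_Ioi, Finset.prod_filter]
    refine Finset.prod_congr rfl fun j _ => ?_
    by_cases hij : i < j
    · rcases lt_trichotomy (σ i) (σ j) with h | h | h
      · simp [hij, h, h.not_gt]
      · exact absurd (σ.injective h) hij.ne
      · simp [hij, h, h.not_gt]
    · simp [hij]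
  have h2 (a b : ZMod 2) : (-1 : ℤ) * (if a = 1 ∧ b = 1 then -1 else 1) = -ssign (a * b) := by
    revert a b; decide
  rw [koszulSign, h1, ← Finset.prod_const, Finset.prod_filter, ← Finset.prod_mul_distrib,
    Fintype.prod_prod_type]
  refine Finset.prod_congr rfl fun i _ => Finset.prod_congr rfl fun j _ => ?_
  by_cases hij : i < j ∧ σ j < σ i
  · rw [if_pos hij, if_pos hij, ← h2]
    simp [hij.1, hij.2]
  · rw [if_neg hij, if_neg hij, if_neg (fun h => hij ⟨h.1, h.2.2.2⟩), one_mul]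

/-! ### Insertion of the smallest letter into a permutation -/

/-- The permutation of `n + 1` letters with `k ↦ 0` that agrees with `σ` on the other letters. -/
def insertPerm {n : ℕ} (k : Fin (n + 1)) (σ : Equiv.Perm (Fin n)) : Equiv.Perm (Fin (n + 1)) :=
  (finSuccEquiv' k).trans ((Equiv.optionCongr σ).trans (finSuccEquiv' 0).symm)

theorem insertPerm_self {n : ℕ} (k : Fin (n + 1)) (σ : Equiv.Perm (Fin n)) :
    insertPerm k σ k = 0 := by
  simp [insertPerm]

theorem insertPerm_succAbove {n : ℕ} (k : Fin (n + 1)) (σ : Equiv.Perm (Fin n)) (i : Fin n) :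
    insertPerm k σ (k.succAbove i) = (σ i).succ := by
  simp [insertPerm]

/-- The position of the letter `0` recovers `k` and the other letters recover `σ`; surjectivity is
the count `(n + 1) · n! = (n + 1)!`. -/
theorem insertPerm_bijective (n : ℕ) : Function.Bijective
    fun x : Fin (n + 1) × Equiv.Perm (Fin n) => insertPerm x.1 x.2 := by
  rw [Fintype.bijective_iff_injective_and_card]
  constructor
  · rintro ⟨k, σ⟩ ⟨l, τ⟩ h
    have h' : insertPerm k σ = insertPerm l τ := h
    have hk : k = l := (insertPerm l τ).injective (by
      rw [← h', insertPerm_self, h', insertPerm_self])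
    subst hk
    refine Prod.ext rfl (Equiv.ext fun i => Fin.succ_injective _ ?_)
    rw [← insertPerm_succAbove k, ← insertPerm_succAbove k, h']
  · simp [Fintype.card_perm, Nat.factorial_succ]

theorem sum_insertPerm {M : Type*} [AddCommMonoid M] {n : ℕ}
    (φ : Equiv.Perm (Fin (n + 1)) → M) :
    ∑ σ, φ σ = ∑ k, ∑ σ, φ (insertPerm k σ) := by
  rw [← Fintype.sum_prod_type' fun k σ => φ (insertPerm k σ)]
  exact ((insertPerm_bijective n).sum_comp φ).symm

/-- Since `0` is the smallest letter, its inversions are with the positions before `k`; all others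
are inversions of `σ`. -/
theorem koszulSign_insertPerm {n : ℕ} (k : Fin (n + 1)) (σ : Equiv.Perm (Fin n))
    (a : Fin (n + 1) → ZMod 2) :
    koszulSign (insertPerm k σ) a =
      (∏ i : Fin n, if i.castSucc < k then -ssign (a 0 * a (σ i).succ) else 1) *
        koszulSign σ fun i => a i.succ := by
  rw [koszulSign_eq_prod, koszulSign_eq_prod, Fin.prod_univ_succAbove _ k]
  have h0 : ∀ j, ¬ (k < j ∧ insertPerm k σ j < insertPerm k σ k) := fun j h => by
    rw [insertPerm_self] at h
    exact absurd h.2 (Fin.not_lt_zero _)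
  simp only [h0, if_false, Finset.prod_const_one, one_mul]
  rw [← Finset.prod_mul_distrib]
  refine Finset.prod_congr rfl fun i _ => ?_
  rw [Fin.prod_univ_succAbove _ k]
  congr 1
  · simp [insertPerm_self, insertPerm_succAbove, Fin.succAbove_lt_iff_castSucc_lt, mul_comm (a 0)]
  · simp [insertPerm_succAbove]

section ListModel

/-! ### Composition of functions of lists of homogeneous vectors -/

variable {K : Type*} [Field K] {V : Type*} [AddCommGroup V] [Module K V]
  (𝒱 : ZMod 2 → Submodule K V)

/-- The homogeneous vectors, together with their degrees. -/
abbrev HomVec := Σ a : ZMod 2, 𝒱 a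

variable {𝒱} in
/-- The degree `(-1, a)` of a vector of degree `a`, as a `0`-ary map, modulo `2`. -/
def vecDeg (x : HomVec 𝒱) : ZMod 2 × ZMod 2 := (1, x.1)

/-- The commutation sign of two degrees modulo `2`. -/
def dsign (d e : ZMod 2 × ZMod 2) : ℤ := ssign (d.1 * e.1 + d.2 * e.2)

theorem dsign_comm (d e : ZMod 2 × ZMod 2) : dsign d e = dsign e d := by
  simp only [dsign, mul_comm]

theorem dsign_add_left (d d' e : ZMod 2 × ZMod 2) :
    dsign (d + d') e = dsign d e * dsign d' e := by
  simp only [dsign, ← ssign_add, Prod.fst_add, Prod.snd_add]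
  congr 1; ring

theorem dsign_add_right (d e e' : ZMod 2 × ZMod 2) :
    dsign d (e + e') = dsign d e * dsign d e' := by
  rw [dsign_comm, dsign_add_left, dsign_comm e, dsign_comm e']

theorem dsign_mul_self (d e : ZMod 2 × ZMod 2) : dsign d e * dsign d e = 1 :=
  ssign_mul_self _

theorem dsign_eq_one_or (d e : ZMod 2 × ZMod 2) : dsign d e = 1 ∨ dsign d e = -1 :=
  ssign_eq_one_or _

variable [DirectSum.Decomposition 𝒱]

/-- The component of degree `c`, as an element of the homogeneous part. -/
def homPart (c : ZMod 2) : V →ₗ[K] 𝒱 c :=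
  DirectSum.component K (ZMod 2) (fun b => 𝒱 b) c ∘ₗ
    (DirectSum.decomposeLinearEquiv 𝒱).toLinearMap

theorem coe_homPart (c : ZMod 2) (x : V) : (homPart 𝒱 c x : V) = proj 𝒱 c x := rfl

variable {𝒱}

/-- The component of degree `c`, as a homogeneous vector. -/
def homVec (c : ZMod 2) (v : V) : HomVec 𝒱 := ⟨c, homPart 𝒱 c v⟩

/-- The insertion of `x` as the first argument. -/
def contract (x : HomVec 𝒱) (Φ : List (HomVec 𝒱) → V) : List (HomVec 𝒱) → V :=
  fun L => Φ (x :: L)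

/-- The composition `Φ ∘ Ψ`, up to the sign `(-1)^{p q}`, where `d` is the degree of `Ψ`. -/
def comp : ZMod 2 × ZMod 2 → (List (HomVec 𝒱) → V) → (List (HomVec 𝒱) → V) →
    List (HomVec 𝒱) → V
  | d, Φ, Ψ, [] => Φ [homVec d.2 (Ψ [])]
  | d, Φ, Ψ, x :: L => comp (d + vecDeg x) Φ (contract x Ψ) L +
      dsign d (vecDeg x) • comp d (contract x Φ) Ψ L

theorem contract_comp (x : HomVec 𝒱) (d : ZMod 2 × ZMod 2) (Φ Ψ : List (HomVec 𝒱) → V) :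
    contract x (comp d Φ Ψ) = comp (d + vecDeg x) Φ (contract x Ψ) +
      dsign d (vecDeg x) • comp d (contract x Φ) Ψ := rfl

omit [DirectSum.Decomposition 𝒱] in
theorem contract_add (x : HomVec 𝒱) (Φ Ψ : List (HomVec 𝒱) → V) :
    contract x (Φ + Ψ) = contract x Φ + contract x Ψ := rfl

/-- `Φ` is linear in every argument. -/
structure IsListLinear (Φ : List (HomVec 𝒱) → V) : Prop where
  map_add : ∀ A a (v w : 𝒱 a) B, Φ (A ++ ⟨a, v + w⟩ :: B) = Φ (A ++ ⟨a, v⟩ :: B) + Φ (A ++ ⟨a, w⟩ :: B)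
  map_smul : ∀ A a (c : K) (v : 𝒱 a) B, Φ (A ++ ⟨a, c • v⟩ :: B) = c • Φ (A ++ ⟨a, v⟩ :: B)

/-- `Φ` is skew-symmetric in the super sense. -/
def IsListSkew (Φ : List (HomVec 𝒱) → V) : Prop :=
  ∀ A (x y : HomVec 𝒱) B,
    Φ (A ++ x :: y :: B) = dsign (vecDeg x) (vecDeg y) • Φ (A ++ y :: x :: B)

/-- `Φ` vanishes on the lists whose length does not have the parity given by `d`. -/
def HasParity (d : ZMod 2 × ZMod 2) (Φ : List (HomVec 𝒱) → V) : Prop :=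
  ∀ L, Φ L ≠ 0 → d.1 + L.length = 1

omit [DirectSum.Decomposition 𝒱] in
theorem IsListLinear.contract {Φ : List (HomVec 𝒱) → V} (h : IsListLinear Φ) (x : HomVec 𝒱) :
    IsListLinear (contract x Φ) :=
  ⟨fun A => h.map_add (x :: A), fun A => h.map_smul (x :: A)⟩

omit [DirectSum.Decomposition 𝒱] in
theorem IsListSkew.contract {Φ : List (HomVec 𝒱) → V} (h : IsListSkew Φ) (x : HomVec 𝒱) :
    IsListSkew (contract x Φ) :=
  fun A => h (x :: A)

omit [DirectSum.Decomposition 𝒱] in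
theorem HasParity.contract {d : ZMod 2 × ZMod 2} {Φ : List (HomVec 𝒱) → V} (h : HasParity d Φ)
    (x : HomVec 𝒱) : HasParity (d + vecDeg x) (contract x Φ) := fun L hL => by
  have := h (x :: L) hL
  rw [← this]
  simp [vecDeg]
  ring

theorem IsListLinear.homVec_zero₀ {Φ : List (HomVec 𝒱) → V} (h : IsListLinear Φ)
    (c : ZMod 2) (B : List (HomVec 𝒱)) : Φ (homVec c 0 :: B) = 0 := by
  simpa [homVec] using h.map_smul [] c 0 0 B

theorem IsListLinear.homVec_zero₁ {Φ : List (HomVec 𝒱) → V} (h : IsListLinear Φ)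
    (x : HomVec 𝒱) (c : ZMod 2) (B : List (HomVec 𝒱)) : Φ (x :: homVec c 0 :: B) = 0 :=
  (h.contract x).homVec_zero₀ c B

theorem comp_add_left (d : ZMod 2 × ZMod 2) (Φ Φ' Ψ : List (HomVec 𝒱) → V) :
    comp d (Φ + Φ') Ψ = comp d Φ Ψ + comp d Φ' Ψ := by
  funext L
  induction L generalizing d Φ Φ' Ψ with
  | nil => rfl
  | cons x L ih =>
    have h1 := ih (d + vecDeg x) Φ Φ' (contract x Ψ)
    have h2 := ih d (contract x Φ) (contract x Φ') Ψ
    simp only [comp, contract_add, Pi.add_apply] at h1 h2 ⊢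
    rw [h1, h2, smul_add]; abel

theorem comp_smul_left (d : ZMod 2 × ZMod 2) (c : K) (Φ Ψ : List (HomVec 𝒱) → V) :
    comp d (c • Φ) Ψ = c • comp d Φ Ψ := by
  funext L
  induction L generalizing d Φ Ψ with
  | nil => rfl
  | cons x L ih =>
    have h1 := ih (d + vecDeg x) Φ (contract x Ψ)
    have h2 := ih d (contract x Φ) Ψ
    have h3 : contract x (c • Φ) = c • contract x Φ := rfl
    simp only [comp, h3, Pi.smul_apply] at h1 h2 ⊢
    rw [h1, h2, smul_add, smul_comm c]

theorem comp_zsmul_left (d : ZMod 2 × ZMod 2) (c : ℤ) (Φ Ψ : List (HomVec 𝒱) → V) :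
    comp d (c • Φ) Ψ = c • comp d Φ Ψ := by
  rw [← Int.cast_smul_eq_zsmul K c, comp_smul_left, Int.cast_smul_eq_zsmul]

theorem comp_add_right {Φ : List (HomVec 𝒱) → V} (h : IsListLinear Φ) (d : ZMod 2 × ZMod 2)
    (Ψ Ψ' : List (HomVec 𝒱) → V) : comp d Φ (Ψ + Ψ') = comp d Φ Ψ + comp d Φ Ψ' := by
  funext L
  induction L generalizing d Φ Ψ Ψ' with
  | nil => simpa [comp, homVec] using h.map_add [] d.2 _ _ []
  | cons x L ih =>
    have h1 := ih h (d + vecDeg x) (contract x Ψ) (contract x Ψ')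
    have h2 := ih (h.contract x) d Ψ Ψ'
    simp only [comp, contract_add, Pi.add_apply] at h1 h2 ⊢
    rw [h1, h2, smul_add]; abel

theorem comp_smul_right {Φ : List (HomVec 𝒱) → V} (h : IsListLinear Φ) (d : ZMod 2 × ZMod 2)
    (c : K) (Ψ : List (HomVec 𝒱) → V) : comp d Φ (c • Ψ) = c • comp d Φ Ψ := by
  funext L
  induction L generalizing d Φ Ψ with
  | nil => simpa [comp, homVec] using h.map_smul [] d.2 c _ []
  | cons x L ih =>
    have h1 := ih h (d + vecDeg x) (contract x Ψ)
    have h2 := ih (h.contract x) d Ψ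
    have h3 : contract x (c • Ψ) = c • contract x Ψ := rfl
    simp only [comp, h3, Pi.smul_apply] at h1 h2 ⊢
    rw [h1, h2, smul_add, smul_comm c]

theorem comp_zsmul_right {Φ : List (HomVec 𝒱) → V} (h : IsListLinear Φ) (d : ZMod 2 × ZMod 2)
    (c : ℤ) (Ψ : List (HomVec 𝒱) → V) : comp d Φ (c • Ψ) = c • comp d Φ Ψ := by
  rw [← Int.cast_smul_eq_zsmul K c, comp_smul_right h, Int.cast_smul_eq_zsmul]

/-- The associator of the composition is graded symmetric in its last two arguments. -/
theorem comp_preLie {Φ Ψ Θ : List (HomVec 𝒱) → V} {d e : ZMod 2 × ZMod 2}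
    (hΦ : IsListLinear Φ) (hs : IsListSkew Φ) (hΨ : IsListLinear Ψ) (hΘ : IsListLinear Θ)
    (hd : HasParity d Ψ) (he : HasParity e Θ) (L : List (HomVec 𝒱)) :
    comp e (comp d Φ Ψ) Θ L - comp (d + e) Φ (comp e Ψ Θ) L =
      dsign d e • (comp d (comp e Φ Θ) Ψ L - comp (d + e) Φ (comp d Θ Ψ) L) := by
  induction L generalizing Φ Ψ Θ d e with
  | nil =>
    have hv (c : ZMod 2) (v : V) : vecDeg (homVec (𝒱 := 𝒱) c v) = (1, c) := rfl
    simp only [comp, contract, Prod.snd_add, hv]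
    -- The nested terms cancel; on each side there remains `Φ` applied to the values of `Ψ` and `Θ`,
    -- in opposite orders.
    rw [add_comm e.2 d.2, add_sub_cancel_left, add_sub_cancel_left]
    by_cases h1 : Ψ [] = 0
    · rw [h1, hΦ.homVec_zero₁, hΦ.homVec_zero₀]
      simp
    by_cases h2 : Θ [] = 0
    · rw [h2, hΦ.homVec_zero₁, hΦ.homVec_zero₀]
      simp
    -- A nonzero value on the empty list forces first degree `1`, so the inserted vectors have the
    -- degrees `d` and `e` of the maps, and the skew-symmetry of `Φ` produces the required sign.
    have h1' := hd [] h1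
    have h2' := he [] h2
    simp only [List.length_nil, Nat.cast_zero, add_zero] at h1' h2'
    have h3 := hs [] (homVec e.2 (Θ [])) (homVec d.2 (Ψ [])) []
    simp only [List.nil_append, hv] at h3
    rw [h3, smul_smul, smul_smul]
    congr 1
    simp only [dsign, h1', h2']
  | cons x L ih =>
    -- Contraction with `x` is a derivation, so the identity on `x :: L` is a signed sum of three
    -- identities on `L`, with `x` contracted into `Θ`, `Ψ` or `Φ`.
    have h1 := ih hΦ hs hΨ (hΘ.contract x) hd (he.contract x)
    have h2 := ih hΦ hs (hΨ.contract x) hΘ (hd.contract x) he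
    have h3 := ih (hΦ.contract x) (hs.contract x) hΨ hΘ hd he
    have e1 : d + vecDeg x + e = d + e + vecDeg x := by abel
    have e2 : d + (e + vecDeg x) = d + e + vecDeg x := by abel
    simp only [comp, contract_comp, comp_add_left, comp_zsmul_left, comp_add_right hΦ,
      comp_zsmul_right hΦ, Pi.add_apply, Pi.smul_apply, dsign_add_left, dsign_add_right,
      e1, e2] at h1 h2 h3 ⊢
    rw [dsign_comm (vecDeg x) e] at h2
    rcases dsign_eq_one_or d (vecDeg x) with ha | ha <;>
    rcases dsign_eq_one_or e (vecDeg x) with hb | hb <;>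
    rcases dsign_eq_one_or d e with hc | hc <;>
    simp only [ha, hb, hc, one_smul, neg_smul, mul_one, mul_neg, neg_neg] at h1 h2 h3 ⊢
    · linear_combination (norm := module) h1 + h2 + h3
    · linear_combination (norm := module) h1 + h2 + h3
    · linear_combination (norm := module) h1 - h2 - h3
    · linear_combination (norm := module) h1 - h2 - h3
    · linear_combination (norm := module) h1 + h2 - h3
    · linear_combination (norm := module) h1 + h2 - h3
    · linear_combination (norm := module) h1 - h2 + h3
    · linear_combination (norm := module) h1 - h2 + h3

/-- If the bracket of a map `Ψ` of degree `(1, 0)` squares to zero then so does the right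
composition with `Ψ`: the corresponding associator vanishes, also in characteristic `2`. -/
theorem comp_comp_self {Φ Ψ : List (HomVec 𝒱) → V} (hΦ : IsListLinear Φ) (hs : IsListSkew Φ)
    (hΨ : IsListLinear Ψ) (hd : HasParity (1, 0) Ψ) (h0 : Ψ [] = 0) (L : List (HomVec 𝒱)) :
    comp (1, 0) (comp (1, 0) Φ Ψ) Ψ L = comp 0 Φ (comp (1, 0) Ψ Ψ) L := by
  have e0 : ((1, 0) : ZMod 2 × ZMod 2) + (1, 0) = 0 := by decide
  rw [← sub_eq_zero]
  induction L generalizing Φ with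
  | nil =>
    simp only [comp, contract, h0, hΦ.homVec_zero₀]
    have hv (c : ZMod 2) (v : V) : vecDeg (homVec (𝒱 := 𝒱) c v) = (1, c) := rfl
    simp [hv]
  | cons x L ih =>
    -- The two associators in which `x` is contracted into one of the copies of `Ψ` cancel by the
    -- pre-Lie identity; only the one with `x` in `Φ` is left to the induction.
    have h1 := comp_preLie hΦ hs hΨ (hΨ.contract x) hd (hd.contract x) L
    have h3 := ih (hΦ.contract x) (hs.contract x)
    have e1 : (1, 0) + ((1, 0) + vecDeg x) = 0 + vecDeg x := by rw [← add_assoc, e0]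
    have e2 : dsign (1, 0) (1, 0) = -1 := by decide
    have e3 : dsign (1, 0) (vecDeg x) = -1 := by simp [dsign, vecDeg]; decide
    have e4 : dsign 0 (vecDeg x) = 1 := by simp [dsign, ssign_zero]
    simp only [comp, contract_comp, comp_add_left, comp_zsmul_left, comp_add_right hΦ,
      comp_zsmul_right hΦ, Pi.add_apply, Pi.smul_apply, dsign_add_right, e1] at h1 h3 ⊢
    simp only [e2, e3, e4, one_smul, neg_smul, mul_neg, mul_one, neg_neg] at h1 h3 ⊢
    linear_combination (norm := module) h1 + h3

/-- The parts of the structure of the maps of degree `d` modulo `2`. -/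
structure IsListCochain (d : ZMod 2 × ZMod 2) (Φ : List (HomVec 𝒱) → V) : Prop where
  linear : IsListLinear Φ
  skew : IsListSkew Φ
  parity : HasParity d Φ
  hom : ∀ L, Φ L ∈ 𝒱 (d.2 + (L.map Sigma.fst).sum)

theorem IsListLinear.comp {Φ Ψ : List (HomVec 𝒱) → V} (hΦ : IsListLinear Φ)
    (hΨ : IsListLinear Ψ) (d : ZMod 2 × ZMod 2) : IsListLinear (comp d Φ Ψ) := by
  constructor
  · intro A
    induction A generalizing d Φ Ψ with
    | nil =>
      intro a v w B
      have h1 : SuperLie.contract ⟨a, v + w⟩ Ψ =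
        SuperLie.contract ⟨a, v⟩ Ψ + SuperLie.contract ⟨a, w⟩ Ψ := funext (hΨ.map_add [] a v w)
      have h2 : SuperLie.contract ⟨a, v + w⟩ Φ =
        SuperLie.contract ⟨a, v⟩ Φ + SuperLie.contract ⟨a, w⟩ Φ := funext (hΦ.map_add [] a v w)
      simp only [List.nil_append, SuperLie.comp, h1, h2, comp_add_right hΦ, comp_add_left,
        Pi.add_apply, smul_add, vecDeg]
      abel
    | cons x A ih =>
      intro a v w B
      have h1 := ih hΦ (hΨ.contract x) (d + vecDeg x) a v w B
      have h2 := ih (hΦ.contract x) hΨ d a v w B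
      simp only [List.cons_append, SuperLie.comp, h1, h2, smul_add]
      abel
  · intro A
    induction A generalizing d Φ Ψ with
    | nil =>
      intro a c v B
      have h1 : SuperLie.contract ⟨a, c • v⟩ Ψ = c • SuperLie.contract ⟨a, v⟩ Ψ :=
        funext (hΨ.map_smul [] a c v)
      have h2 : SuperLie.contract ⟨a, c • v⟩ Φ = c • SuperLie.contract ⟨a, v⟩ Φ :=
        funext (hΦ.map_smul [] a c v)
      simp only [List.nil_append, SuperLie.comp, h1, h2, comp_smul_right hΦ, comp_smul_left,
        Pi.smul_apply, smul_add, vecDeg, smul_comm c]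
    | cons x A ih =>
      intro a c v B
      have h1 := ih hΦ (hΨ.contract x) (d + vecDeg x) a c v B
      have h2 := ih (hΦ.contract x) hΨ d a c v B
      simp only [List.cons_append, SuperLie.comp, h1, h2, smul_add, smul_comm c]

/-- For two leading arguments the derivation rule gives four terms: when both go to the same map its
skew-symmetry applies, and the two mixed terms are exchanged. -/
theorem IsListSkew.comp {Φ Ψ : List (HomVec 𝒱) → V} (hΦ : IsListSkew Φ) (hΨ : IsListSkew Ψ)
    (hl : IsListLinear Φ) (d : ZMod 2 × ZMod 2) : IsListSkew (comp d Φ Ψ) := by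
  intro A
  induction A generalizing d Φ Ψ with
  | nil =>
    intro x y B
    have h1 : SuperLie.contract y (SuperLie.contract x Ψ) = dsign (vecDeg x) (vecDeg y) •
      SuperLie.contract x (SuperLie.contract y Ψ) := funext (hΨ [] x y)
    have h2 : SuperLie.contract y (SuperLie.contract x Φ) = dsign (vecDeg x) (vecDeg y) •
      SuperLie.contract x (SuperLie.contract y Φ) := funext (hΦ [] x y)
    simp only [List.nil_append, SuperLie.comp, h1, h2, comp_zsmul_right hl, comp_zsmul_left,
      Pi.smul_apply, dsign_add_left, add_right_comm d (vecDeg x) (vecDeg y),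
      dsign_comm (vecDeg y) (vecDeg x)]
    rcases dsign_eq_one_or (vecDeg x) (vecDeg y) with ha | ha <;>
    simp only [ha, one_smul, mul_one, neg_smul, mul_neg] <;> module
  | cons z A ih =>
    intro x y B
    have h1 := ih hΦ (hΨ.contract z) hl (d + vecDeg z) x y B
    have h2 := ih (hΦ.contract z) hΨ (hl.contract z) d x y B
    simp only [List.cons_append, SuperLie.comp, h1, h2, smul_add,
      smul_comm (dsign (vecDeg x) (vecDeg y))]

theorem HasParity.comp {Φ Ψ : List (HomVec 𝒱) → V} {d e : ZMod 2 × ZMod 2}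
    (hΦ : HasParity d Φ) (hΨ : HasParity e Ψ) (hl : IsListLinear Φ) :
    HasParity (d + e) (comp e Φ Ψ) := by
  intro L
  induction L generalizing d e Φ Ψ with
  | nil =>
    intro h
    have h1 : Ψ [] ≠ 0 := fun h0 => h (by rw [SuperLie.comp, h0, hl.homVec_zero₀])
    have h2 := hΨ [] h1
    have h3 := hΦ _ h
    simp only [List.length_nil, List.length_cons, Nat.cast_zero, add_zero, Nat.cast_one, zero_add,
      Prod.fst_add] at *
    rw [h2, h3]
  | cons x L ih =>
    intro h
    by_cases h1 : SuperLie.comp (e + vecDeg x) Φ (SuperLie.contract x Ψ) L = 0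
    · rw [SuperLie.comp, h1, zero_add] at h
      have := ih (hΦ.contract x) hΨ (hl.contract x) (right_ne_zero_of_smul h)
      rw [← this]
      simp only [List.length_cons, Nat.cast_add, Nat.cast_one, Prod.fst_add, vecDeg]
      ring
    · have := ih hΦ (hΨ.contract x) hl h1
      rw [← this]
      simp only [List.length_cons, Nat.cast_add, Nat.cast_one, Prod.fst_add, vecDeg]
      ring

/-- The degree is enforced by `homVec`, which projects the value of `Ψ` to the prescribed degree
before `Φ` receives it. -/
theorem comp_mem {Φ Ψ : List (HomVec 𝒱) → V} {b : ZMod 2} {e : ZMod 2 × ZMod 2}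
    (hΦ : ∀ L, Φ L ∈ 𝒱 (b + (L.map Sigma.fst).sum)) (L : List (HomVec 𝒱)) :
    comp e Φ Ψ L ∈ 𝒱 (b + e.2 + (L.map Sigma.fst).sum) := by
  induction L generalizing b e Φ Ψ with
  | nil => simpa [comp, homVec] using hΦ [homVec e.2 (Ψ [])]
  | cons x L ih =>
    rw [List.map_cons, List.sum_cons]
    refine Submodule.add_mem _ ?_ (Submodule.smul_of_tower_mem _ _ ?_)
    · have := ih (e := e + vecDeg x) (Ψ := contract x Ψ) hΦ
      convert! this using 2
      simp only [Prod.snd_add, vecDeg]; ring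
    · have := ih (e := e) (Ψ := Ψ) (b := b + x.1) (Φ := contract x Φ) fun L => by
        have := hΦ (x :: L)
        rwa [List.map_cons, List.sum_cons, ← add_assoc] at this
      convert! this using 2
      ring

theorem IsListCochain.comp {d e : ZMod 2 × ZMod 2} {Φ Ψ : List (HomVec 𝒱) → V}
    (hΦ : IsListCochain d Φ) (hΨ : IsListCochain e Ψ) : IsListCochain (d + e) (comp e Φ Ψ) :=
  ⟨hΦ.linear.comp hΨ.linear e, hΦ.skew.comp hΨ.skew hΦ.linear e,
    hΦ.parity.comp hΨ.parity hΦ.linear, comp_mem hΦ.hom⟩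

omit [DirectSum.Decomposition 𝒱] in
theorem IsListCochain.sub_zsmul {d : ZMod 2 × ZMod 2} {Φ Ψ : List (HomVec 𝒱) → V}
    (hΦ : IsListCochain d Φ) (hΨ : IsListCochain d Ψ) (c : ℤ) : IsListCochain d (Φ - c • Ψ) where
  linear := ⟨fun A a v w B => by
      simp only [Pi.sub_apply, Pi.smul_apply, hΦ.linear.map_add, hΨ.linear.map_add]; module,
    fun A a k v B => by
      simp only [Pi.sub_apply, Pi.smul_apply, hΦ.linear.map_smul, hΨ.linear.map_smul, smul_sub,
        smul_comm c]⟩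
  skew A x y B := by
    simp only [Pi.sub_apply, Pi.smul_apply, hΦ.skew A x y, hΨ.skew A x y, smul_sub, smul_comm c]
  parity L h := by
    by_cases h1 : Φ L = 0
    · refine hΨ.parity L fun h2 => h ?_
      simp [h1, h2]
    · exact hΦ.parity L h1
  hom L := Submodule.sub_mem _ (hΦ.hom L) (Submodule.smul_of_tower_mem _ c (hΨ.hom L))

/-! ### The graded Lie bracket on functions of lists -/

/-- The bracket of `Φ` and `Ψ` of degrees `d` and `e`, up to the sign `(-1)^{p q}`. -/
def listBracket (d e : ZMod 2 × ZMod 2) (Φ Ψ : List (HomVec 𝒱) → V) : List (HomVec 𝒱) → V :=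
  comp e Φ Ψ - dsign d e • comp d Ψ Φ

theorem IsListCochain.listBracket {d e : ZMod 2 × ZMod 2} {Φ Ψ : List (HomVec 𝒱) → V}
    (hΦ : IsListCochain d Φ) (hΨ : IsListCochain e Ψ) :
    IsListCochain (d + e) (listBracket d e Φ Ψ) :=
  (hΦ.comp hΨ).sub_zsmul (add_comm e d ▸ hΨ.comp hΦ) _

/-- Contraction is a derivation of the bracket as well; this is how the vanishing of brackets on
arguments from `𝔥` is tested later. -/
theorem contract_listBracket (x : HomVec 𝒱) (d e : ZMod 2 × ZMod 2)
    (Φ Ψ : List (HomVec 𝒱) → V) : contract x (listBracket d e Φ Ψ) =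
      listBracket d (e + vecDeg x) Φ (contract x Ψ) +
        dsign e (vecDeg x) • listBracket (d + vecDeg x) e (contract x Φ) Ψ := by
  have h : contract x (listBracket d e Φ Ψ) =
    contract x (comp e Φ Ψ) - dsign d e • contract x (comp d Ψ Φ) := rfl
  rw [h, contract_comp, contract_comp, listBracket, listBracket, dsign_add_right, dsign_add_left,
    dsign_comm (vecDeg x) e]
  rcases dsign_eq_one_or e (vecDeg x) with ha | ha <;>
  simp only [ha, one_smul, mul_one, neg_smul, mul_neg, smul_add, smul_sub, smul_smul, mul_one, one_mul] <;> module

theorem listBracket_skew (d e : ZMod 2 × ZMod 2) (Φ Ψ : List (HomVec 𝒱) → V) :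
    listBracket d e Φ Ψ = -(dsign d e • listBracket e d Ψ Φ) := by
  rw [listBracket, listBracket, dsign_comm e d, smul_sub, smul_smul, dsign_mul_self, one_smul,
    neg_sub]

/-- The twelve double compositions group according to the outermost map; each group is one instance
of the pre-Lie identity. -/
theorem listBracket_jacobi {d e f : ZMod 2 × ZMod 2} {Φ Ψ Θ : List (HomVec 𝒱) → V}
    (hΦ : IsListCochain d Φ) (hΨ : IsListCochain e Ψ) (hΘ : IsListCochain f Θ) :
    listBracket d (e + f) Φ (listBracket e f Ψ Θ) =
      listBracket (d + e) f (listBracket d e Φ Ψ) Θ +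
        dsign d e • listBracket e (d + f) Ψ (listBracket d f Φ Θ) := by
  funext L
  have h1 := comp_preLie hΦ.linear hΦ.skew hΨ.linear hΘ.linear hΨ.parity hΘ.parity L
  have h2 := comp_preLie hΨ.linear hΨ.skew hΦ.linear hΘ.linear hΦ.parity hΘ.parity L
  have h3 := comp_preLie hΘ.linear hΘ.skew hΦ.linear hΨ.linear hΦ.parity hΨ.parity L
  have hn (Φ Ψ : List (HomVec 𝒱) → V) (c : ℤ) : Φ - c • Ψ = Φ + (-c) • Ψ := by module
  simp only [listBracket, hn, comp_add_left, comp_zsmul_left, comp_add_right hΦ.linear,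
    comp_zsmul_right hΦ.linear, comp_add_right hΨ.linear, comp_zsmul_right hΨ.linear,
    comp_add_right hΘ.linear, comp_zsmul_right hΘ.linear, Pi.add_apply, Pi.smul_apply,
    dsign_add_left, dsign_add_right, dsign_comm e d] at h1 h2 h3 ⊢
  rcases dsign_eq_one_or d e with ha | ha <;>
  rcases dsign_eq_one_or d f with hb | hb <;>
  rcases dsign_eq_one_or e f with hc | hc <;>
  simp only [ha, hb, hc, one_smul, neg_smul, mul_one, mul_neg, neg_neg] at h1 h2 h3 ⊢
  · linear_combination (norm := module) -h1 + h2 - h3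
  · linear_combination (norm := module) -h1 + h2 + h3
  · linear_combination (norm := module) -h1 + h2 + h3
  · linear_combination (norm := module) -h1 + h2 - h3
  · linear_combination (norm := module) -h1 - h2 - h3
  · linear_combination (norm := module) -h1 - h2 + h3
  · linear_combination (norm := module) -h1 - h2 + h3
  · linear_combination (norm := module) -h1 - h2 - h3

end ListModel

section Shuffles

variable {K : Type*} [Field K] {V : Type*} [AddCommGroup V] [Module K V]
  {𝒱 : ZMod 2 → Submodule K V}

/-! ### Sums over shuffles -/

/-- `σ` is increasing on the first `p` letters and on the others. -/
def IsShuffle {n : ℕ} (p : ℕ) (σ : Equiv.Perm (Fin n)) : Prop :=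
  ∀ i j : Fin n, i < j → (j.val < p ∨ p ≤ i.val) → σ i < σ j

instance {n p : ℕ} (σ : Equiv.Perm (Fin n)) : Decidable (IsShuffle p σ) := by
  unfold IsShuffle
  infer_instance

/-- The smallest letter has to open one of the two increasing blocks. -/
theorem IsShuffle.eq_zero_or_eq {n p : ℕ} {k : Fin (n + 1)} {σ : Equiv.Perm (Fin n)}
    (h : IsShuffle p (insertPerm k σ)) : k = 0 ∨ k.val = p := by
  rcases lt_trichotomy k.val p with hk | hk | hk
  · left
    by_contra h0
    have := h 0 k (Fin.pos_of_ne_zero h0) (Or.inl hk)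
    rw [insertPerm_self] at this
    exact Fin.not_lt_zero _ this
  · exact Or.inr hk
  · have := h ⟨p, hk.trans k.2⟩ k hk (Or.inr le_rfl)
    rw [insertPerm_self] at this
    exact absurd this (Fin.not_lt_zero _)

/-- At the head of its block the smallest letter cannot violate monotonicity; `h` says that deleting
position `k` turns a first block of length `q` into one of length `p`. -/
theorem isShuffle_insertPerm_iff {n p q : ℕ} {k : Fin (n + 1)} {σ : Equiv.Perm (Fin n)}
    (hk : k = 0 ∨ k.val = q)
    (h : ∀ i : Fin n, (k.succAbove i).val < q ↔ i.val < p) :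
    IsShuffle q (insertPerm k σ) ↔ IsShuffle p σ := by
  constructor
  · intro hs i j hij hp
    have := hs (k.succAbove i) (k.succAbove j) (Fin.succAbove_lt_succAbove_iff.2 hij)
      (hp.imp (h j).2 fun h' => not_lt.1 fun h'' => absurd ((h i).1 h'') (not_lt.2 h'))
    rwa [insertPerm_succAbove, insertPerm_succAbove, Fin.succ_lt_succ_iff] at this
  · intro hs i j hij hp
    rcases Fin.eq_self_or_eq_succAbove k i with rfl | ⟨i, rfl⟩
    · rcases Fin.eq_self_or_eq_succAbove i j with rfl | ⟨j, rfl⟩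
      · exact absurd hij (lt_irrefl _)
      · rw [insertPerm_self, insertPerm_succAbove]
        exact Fin.succ_pos _
    · rcases Fin.eq_self_or_eq_succAbove k j with rfl | ⟨j, rfl⟩
      · rcases hk with hk | hk
        · rw [hk] at hij
          exact absurd hij (Fin.not_lt_zero _)
        · rw [Fin.lt_def] at hij
          omega
      · rw [insertPerm_succAbove, insertPerm_succAbove, Fin.succ_lt_succ_iff]
        exact hs i j (Fin.succAbove_lt_succAbove_iff.1 hij)
          (hp.imp (h j).1 fun h' => not_lt.1 fun h'' => absurd ((h i).2 h'') (not_lt.2 h'))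

theorem List.insertIdx_eq_take_append_drop {α : Type*} (x : α) :
    ∀ (p : ℕ) (L : List α), p ≤ L.length → L.insertIdx p x = L.take p ++ x :: L.drop p
  | 0, L, _ => by simp
  | p + 1, [], h => by simp at h
  | p + 1, y :: L, h => by
    rw [List.insertIdx_succ_cons, List.take_succ_cons, List.drop_succ_cons, List.cons_append,
      List.insertIdx_eq_take_append_drop x p L (by simpa using h)]

theorem ofFn_insertPerm {α : Type*} {n : ℕ} (X : Fin (n + 1) → α) (k : Fin (n + 1))
    (σ : Equiv.Perm (Fin n)) : List.ofFn (fun i => X (insertPerm k σ i)) =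
      (List.ofFn fun i => X (σ i).succ).insertIdx k (X 0) := by
  have hl : ((List.ofFn fun i => X (σ i).succ).insertIdx k (X 0)).length = n + 1 := by
    rw [List.length_insertIdx_of_le_length (by simpa using Nat.lt_succ_iff.1 k.2)]
    simp
  refine List.ext_getElem (by rw [hl, List.length_ofFn]) fun i h1 h2 => ?_
  rw [List.length_ofFn] at h1
  rw [List.getElem_ofFn, List.getElem_insertIdx]
  rcases Fin.eq_self_or_eq_succAbove k ⟨i, h1⟩ with h | ⟨j, h⟩
  · have hi : i = k := congrArg Fin.val h
    rw [h, insertPerm_self]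
    simp [hi]
  · rw [h, insertPerm_succAbove]
    have hi : i = (k.succAbove j).val := congrArg Fin.val h
    rcases lt_or_ge j.castSucc k with hj | hj
    · rw [Fin.succAbove_of_castSucc_lt _ _ hj] at hi
      subst hi
      rw [dif_pos (by exact hj)]
      simp
    · rw [Fin.succAbove_of_le_castSucc _ _ hj] at hi
      subst hi
      have hj' : k.val ≤ j.val := hj
      rw [dif_neg (by simp; omega), dif_neg (by simp; omega)]
      simp

theorem prod_ite_eq_prod_take {α M : Type*} [CommMonoid M] (f : α → M) :
    ∀ (n p : ℕ) (Y : Fin n → α),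
      (∏ i : Fin n, if i.val < p then f (Y i) else 1) = (((List.ofFn Y).take p).map f).prod
  | 0, p, Y => by simp
  | n + 1, 0, Y => by simp
  | n + 1, p + 1, Y => by
    rw [Fin.prod_univ_succ, List.ofFn_succ, List.take_succ_cons, List.map_cons, List.prod_cons,
      ← prod_ite_eq_prod_take f n p fun i => Y i.succ]
    simp

/-- The sign of the passage of `x` over the vectors of the list `A`. -/
def passSign (x : HomVec 𝒱) (A : List (HomVec 𝒱)) : ℤ :=
  (A.map fun y => dsign (vecDeg x) (vecDeg y)).prod

theorem passSign_eq (x : HomVec 𝒱) (A : List (HomVec 𝒱)) :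
    passSign x A = ssign A.length * ssign (x.1 * (A.map Sigma.fst).sum) := by
  induction A with
  | nil => simp [passSign, ssign_zero]
  | cons y A ih =>
    have h : passSign x (y :: A) = dsign (vecDeg x) (vecDeg y) * passSign x A := by
      simp [passSign]
    rw [h, ih, dsign, vecDeg, vecDeg, List.length_cons, Nat.cast_succ, List.map_cons,
      List.sum_cons, mul_add]
    simp only [ssign_add, mul_one]
    ring

theorem koszulSign_insertPerm_homVec {n : ℕ} (k : Fin (n + 1)) (σ : Equiv.Perm (Fin n))
    (X : Fin (n + 1) → HomVec 𝒱) :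
    koszulSign (insertPerm k σ) (fun i => (X i).1) =
      passSign (X 0) ((List.ofFn fun i => X (σ i).succ).take k) *
        koszulSign σ fun i => (X i.succ).1 := by
  rw [koszulSign_insertPerm, passSign, ← prod_ite_eq_prod_take]
  congr 1
  refine Finset.prod_congr rfl fun i _ => ?_
  have h : i.castSucc < k ↔ i.val < k.val := Iff.rfl
  simp only [h, dsign, vecDeg, mul_one]
  rw [add_comm 1, ssign_add_one]

/-- The signed sum of `W (X_{σ 1}, …, X_{σ p}) (X_{σ (p + 1)}, …, X_{σ n})` over the shuffles. -/
def shuffleSum {n : ℕ} (p : ℕ) (X : Fin n → HomVec 𝒱)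
    (W : List (HomVec 𝒱) → List (HomVec 𝒱) → V) : V :=
  ∑ σ : Equiv.Perm (Fin n), if IsShuffle p σ then koszulSign σ (fun i => (X i).1) •
    W ((List.ofFn fun i => X (σ i)).take p) ((List.ofFn fun i => X (σ i)).drop p) else 0

theorem shuffleSum_congr {n p : ℕ} (hp : p ≤ n) (X : Fin n → HomVec 𝒱)
    {W W' : List (HomVec 𝒱) → List (HomVec 𝒱) → V} (h : ∀ A B, A.length = p → W A B = W' A B) :
    shuffleSum p X W = shuffleSum p X W' := by
  refine Finset.sum_congr rfl fun σ _ => ?_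
  rw [h _ _ (by simpa using hp)]

theorem shuffleSum_zsmul {n p : ℕ} (X : Fin n → HomVec 𝒱) (c : ℤ)
    (W : List (HomVec 𝒱) → List (HomVec 𝒱) → V) :
    shuffleSum p X (fun A B => c • W A B) = c • shuffleSum p X W := by
  rw [shuffleSum, shuffleSum, Finset.smul_sum]
  refine Finset.sum_congr rfl fun σ _ => ?_
  split_ifs
  · rw [smul_comm]
  · rw [smul_zero]

theorem shuffleSum_zero_succ {n : ℕ} (X : Fin (n + 1) → HomVec 𝒱)
    (W : List (HomVec 𝒱) → List (HomVec 𝒱) → V) :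
    shuffleSum 0 X W = shuffleSum 0 (fun i => X i.succ) fun A B => W A (X 0 :: B) := by
  rw [shuffleSum, sum_insertPerm, Fintype.sum_eq_single 0]
  · refine Finset.sum_congr rfl fun σ _ => ?_
    rw [ofFn_insertPerm, koszulSign_insertPerm_homVec]
    have hs : IsShuffle 0 (insertPerm 0 σ) ↔ IsShuffle 0 σ :=
      isShuffle_insertPerm_iff (Or.inl rfl) (by simp)
    simp [hs, passSign]
  · intro k hk
    refine Finset.sum_eq_zero fun σ _ => if_neg fun h => hk ?_
    rcases h.eq_zero_or_eq with h | h
    · exact h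
    · exact Fin.ext h

/-- The shuffles are sorted by the block that the first argument opens. At position `p + 1` it has
passed the whole first block `A`, whence `passSign`; that position exists only if `p + 1 ≤ n`. -/
theorem shuffleSum_succ_succ {n p : ℕ} (X : Fin (n + 1) → HomVec 𝒱)
    (W : List (HomVec 𝒱) → List (HomVec 𝒱) → V) :
    shuffleSum (p + 1) X W =
      shuffleSum p (fun i => X i.succ) (fun A B => W (X 0 :: A) B) +
        if p + 1 ≤ n then shuffleSum (p + 1) (fun i => X i.succ)
          (fun A B => passSign (X 0) A • W A (X 0 :: B)) else 0 := by
  rw [shuffleSum, sum_insertPerm]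
  have h0 : (∑ σ : Equiv.Perm (Fin n), if IsShuffle (p + 1) (insertPerm 0 σ) then
      koszulSign (insertPerm 0 σ) (fun i => (X i).1) •
      W ((List.ofFn fun i => X (insertPerm 0 σ i)).take (p + 1))
        ((List.ofFn fun i => X (insertPerm 0 σ i)).drop (p + 1)) else 0) =
      shuffleSum p (fun i => X i.succ) (fun A B => W (X 0 :: A) B) := by
    refine Finset.sum_congr rfl fun σ _ => ?_
    rw [ofFn_insertPerm, koszulSign_insertPerm_homVec]
    have hs : IsShuffle (p + 1) (insertPerm 0 σ) ↔ IsShuffle p σ :=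
      isShuffle_insertPerm_iff (Or.inl rfl) (by simp)
    simp [hs, passSign]
  split_ifs with hp
  · have hne : (0 : Fin (n + 1)) ≠ ⟨p + 1, by omega⟩ := fun h => by
      simpa using congrArg Fin.val h
    rw [Fintype.sum_eq_add 0 ⟨p + 1, by omega⟩ hne, h0]
    · congr 1
      refine Finset.sum_congr rfl fun σ _ => ?_
      rw [ofFn_insertPerm, koszulSign_insertPerm_homVec]
      have hl : p + 1 ≤ (List.ofFn fun i => X (σ i).succ).length := by simpa using hp
      have hs : IsShuffle (p + 1) (insertPerm ⟨p + 1, by omega⟩ σ) ↔ IsShuffle (p + 1) σ := by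
        refine isShuffle_insertPerm_iff (Or.inr rfl) fun i => ?_
        rcases lt_or_ge i.val (p + 1) with hi | hi
        · rw [Fin.succAbove_of_castSucc_lt _ _ (by exact hi)]
          simp
        · rw [Fin.succAbove_of_le_castSucc _ _ (by exact hi)]
          simp; omega
      rw [List.insertIdx_eq_take_append_drop _ _ _ hl]
      have hl' : ((List.ofFn fun i => X (σ i).succ).take (p + 1)).length = p + 1 := by
        rw [List.length_take, min_eq_left hl]
      simp only [hs, List.take_left' hl', List.drop_left' hl', smul_smul, mul_comm (passSign _ _)]
    · rintro k ⟨hk, hk'⟩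
      refine Finset.sum_eq_zero fun σ _ => if_neg fun h => ?_
      rcases h.eq_zero_or_eq with h | h
      · exact hk h
      · exact hk' (Fin.ext h)
  · rw [Fintype.sum_eq_single 0, h0, add_zero]
    intro k hk
    refine Finset.sum_eq_zero fun σ _ => if_neg fun h => hk ?_
    rcases h.eq_zero_or_eq with h | h
    · exact h
    · omega

/-! ### The recursive composition as a sum over shuffles -/

variable [DirectSum.Decomposition 𝒱]

/-- In every term of a composition `Φ` has at least one argument, namely the value of `Ψ`. -/
theorem comp_eq_zero_of_left {d : ZMod 2 × ZMod 2} {Φ : List (HomVec 𝒱) → V}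
    (h : ∀ x L, Φ (x :: L) = 0) (Ψ : List (HomVec 𝒱) → V) (L : List (HomVec 𝒱)) :
    comp d Φ Ψ L = 0 := by
  induction L generalizing d Φ Ψ with
  | nil => exact h _ _
  | cons x L ih =>
    rw [comp, ih h, ih (Φ := contract x Φ) (fun y L => h x (y :: L)), smul_zero, add_zero]

theorem comp_zero_right {d : ZMod 2 × ZMod 2} {Φ : List (HomVec 𝒱) → V} (h : IsListLinear Φ) :
    comp d Φ 0 = 0 := by
  simpa using comp_smul_right h d 0 0

/-- `Φ` vanishes on the lists of length different from `n`. -/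
def HasArity (n : ℕ) (Φ : List (HomVec 𝒱) → V) : Prop :=
  ∀ L, L.length ≠ n → Φ L = 0

omit [DirectSum.Decomposition 𝒱] in
theorem HasArity.contract {n : ℕ} {Φ : List (HomVec 𝒱) → V} (h : HasArity (n + 1) Φ)
    (x : HomVec 𝒱) : HasArity n (contract x Φ) := fun L hL => h _ (by simpa using hL)

/-- The summand of `Φ ∘ Ψ` for the splitting of the arguments into `A` and `B`. -/
def splitTerm (b : ZMod 2) (Φ Ψ : List (HomVec 𝒱) → V) (A B : List (HomVec 𝒱)) : V :=
  ssign (b * (A.map Sigma.fst).sum) • Φ (A ++ [homVec (b + (B.map Sigma.fst).sum) (Ψ B)])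

theorem splitTerm_cons_left (b : ZMod 2) (Φ Ψ : List (HomVec 𝒱) → V) (x : HomVec 𝒱)
    (A B : List (HomVec 𝒱)) : splitTerm b Φ Ψ (x :: A) B =
      ssign (b * x.1) • splitTerm b (contract x Φ) Ψ A B := by
  simp only [splitTerm, List.map_cons, List.sum_cons, mul_add, ssign_add, mul_smul]
  rfl

/-- The parity part of the passing sign is absorbed by the degree of `Ψ` changing from `b` to `b +
x.1`. What remains is the sign of the length of `A`, the source of the factor `(-1)^{pq}`. -/
theorem splitTerm_cons_right (b : ZMod 2) (Φ Ψ : List (HomVec 𝒱) → V) (x : HomVec 𝒱)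
    (A B : List (HomVec 𝒱)) : passSign x A • splitTerm b Φ Ψ A (x :: B) =
      ssign A.length • splitTerm (b + x.1) Φ (contract x Ψ) A B := by
  simp only [splitTerm, List.map_cons, List.sum_cons, passSign_eq, smul_smul, add_mul, ssign_add,
    ← add_assoc, mul_assoc]
  rw [mul_comm (ssign (x.1 * _))]
  rfl

/-- The recursive composition computes the sum over the shuffles. -/
theorem shuffleSum_splitTerm {n p m : ℕ} {d : ZMod 2 × ZMod 2} (X : Fin n → HomVec 𝒱)
    {Φ Ψ : List (HomVec 𝒱) → V} (hΦ : HasArity (p + 1) Φ) (hΨ : HasArity m Ψ) (hn : p + m = n)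
    (hl : IsListLinear Φ) (hd : d.1 = m + 1) :
    shuffleSum p X (splitTerm d.2 Φ Ψ) = ssign (p * d.1) • comp d Φ Ψ (List.ofFn X) := by
  -- Contraction lowers the arity of `Φ` or of `Ψ`, so the induction must allow `Ψ` to be `0`-ary;
  -- this is why `m` replaces `q + 1`, with `d.1 = m + 1` congruent to `q`.
  induction n generalizing p m d Φ Ψ with
  | zero =>
    obtain ⟨rfl, rfl⟩ : p = 0 ∧ m = 0 := by omega
    have h : ∀ σ : Equiv.Perm (Fin 0), IsShuffle 0 σ := fun σ i => i.elim0
    simp [shuffleSum, h, splitTerm, comp, ssign_zero, koszulSign]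
  | succ n ih =>
    rw [List.ofFn_succ, comp]
    rcases p with _ | p
    · obtain rfl : m = n + 1 := by omega
      -- For `p = 0` the only argument of `Φ` is reserved for the value of `Ψ`.
      have hz : comp d (contract (X 0) Φ) Ψ (List.ofFn fun i => X i.succ) = 0 :=
        comp_eq_zero_of_left (fun x L => hΦ (X 0 :: x :: L) (by simp)) _ _
      have h := ih (p := 0) (m := n) (d := d + vecDeg (X 0)) (fun i => X i.succ) hΦ
        (hΨ.contract (X 0)) (by omega) hl (by simp [hd, vecDeg]; ring_nf; reduce_mod_char)
      rw [shuffleSum_zero_succ, hz, smul_zero, add_zero]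
      simp only [Nat.cast_zero, zero_mul, ssign_zero, one_smul] at h ⊢
      rw [← h]
      refine shuffleSum_congr (Nat.zero_le _) _ fun A B hA => ?_
      have := splitTerm_cons_right d.2 Φ Ψ (X 0) A B
      rw [List.length_eq_zero_iff] at hA
      subst hA
      simpa [passSign, ssign_zero, vecDeg] using this
    · have h1 := ih (p := p) (m := m) (d := d) (fun i => X i.succ) (hΦ.contract (X 0)) hΨ
        (by omega) (hl.contract (X 0)) hd
      have e1 : ssign (d.2 * (X 0).1) * ssign (p * d.1) =
          ssign ((p + 1 : ℕ) * d.1) * dsign d (vecDeg (X 0)) := by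
        simp only [dsign, vecDeg, ← ssign_add]
        congr 1
        push_cast
        ring_nf
        reduce_mod_char
      rw [shuffleSum_succ_succ]
      simp only [splitTerm_cons_left, shuffleSum_zsmul]
      rw [h1, smul_smul, e1, smul_add, smul_smul, add_comm]
      congr 1
      rcases m with _ | m
      · have hz : contract (X 0) Ψ = 0 := funext fun L => hΨ _ (by simp)
        rw [if_neg (by omega), hz, comp_zero_right hl, Pi.zero_apply, smul_zero]
      · have h2 := ih (p := p + 1) (m := m) (d := d + vecDeg (X 0)) (fun i => X i.succ) hΦ
          (hΨ.contract (X 0)) (by omega) hl (by simp [hd, vecDeg]; ring_nf; reduce_mod_char)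
        have e2 : ssign ((p + 1 : ℕ) * d.1) =
            ssign (p + 1 : ℕ) * ssign ((p + 1 : ℕ) * (d + vecDeg (X 0)).1) := by
          simp only [vecDeg, Prod.fst_add, ← ssign_add]
          congr 1
          push_cast
          ring_nf
          reduce_mod_char
        rw [if_pos (by omega), e2, mul_smul, ← h2, ← shuffleSum_zsmul]
        refine shuffleSum_congr (by omega) _ fun A B hA => ?_
        rw [splitTerm_cons_right, hA]
        rfl

end Shuffles

section Evaluation

variable {K : Type*} [Field K] {V : Type*} [AddCommGroup V] [Module K V]
  {W : Type*} [AddCommGroup W] [Module K W]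
  {𝒱 : ZMod 2 → Submodule K V} [DirectSum.Decomposition 𝒱] {𝒲 : ZMod 2 → Submodule K W}

/-! ### Values on homogeneous vectors -/

theorem proj_homVec (x : HomVec 𝒱) : proj 𝒱 x.1 x.2 = x.2 := by
  rw [proj_of_mem 𝒱 x.2.2, if_pos rfl]

theorem proj_homVec_of_ne (x : HomVec 𝒱) {a : ZMod 2} (h : a ≠ x.1) :
    proj 𝒱 a x.2 = 0 := by
  rw [proj_of_mem 𝒱 x.2.2, if_neg h.symm]

omit [DirectSum.Decomposition 𝒱] in
theorem sum_degrees {M : Type*} [AddCommMonoid M] {n : ℕ} (X : Fin n → HomVec 𝒱)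
    (f : (Fin n → ZMod 2) → M) (h : ∀ a i, a i ≠ (X i).1 → f a = 0) :
    ∑ a, f a = f fun i => (X i).1 :=
  Fintype.sum_eq_single _ fun a ha => by
    obtain ⟨i, hi⟩ := Function.ne_iff.1 ha
    exact h a i hi

/-- Each argument is the sum of its homogeneous components; multilinearity expands the product of
these sums. -/
theorem sum_compLinearMap_proj {n : ℕ} (F : Multi K n V W) :
    ∑ a : Fin n → ZMod 2, (F.compLinearMap fun i => proj 𝒱 (a i)) = F := by
  ext X
  rw [sum_apply]
  simp only [MultilinearMap.compLinearMap_apply]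
  rw [← MultilinearMap.map_sum (f := F) fun i a => proj 𝒱 a (X i)]
  simp only [sum_proj]

/-- A multilinear map is determined by its values on homogeneous vectors. -/
theorem multi_ext {n : ℕ} {F F' : Multi K n V W}
    (h : ∀ X : Fin n → HomVec 𝒱, F (fun i => (X i).2) = F' fun i => (X i).2) : F = F' := by
  rw [← sum_compLinearMap_proj (𝒱 := 𝒱) F, ← sum_compLinearMap_proj (𝒱 := 𝒱) F']
  refine Finset.sum_congr rfl fun a _ => MultilinearMap.ext fun X => ?_
  exact h fun i => ⟨a i, proj 𝒱 (a i) (X i), proj_mem 𝒱 _ _⟩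

theorem permAct_apply_homVec {n : ℕ} (σ : Equiv.Perm (Fin n)) (F : Multi K n V W)
    (X : Fin n → HomVec 𝒱) : permAct 𝒱 σ F (fun i => (X i).2) =
      koszulSign σ (fun i => (X i).1) • F fun i => (X (σ i)).2 := by
  simp only [permAct, LinearMap.coe_mk, AddHom.coe_mk, sum_apply]
  rw [sum_degrees X]
  · simp [proj_homVec]
  · intro a i hi
    rw [smul_apply, MultilinearMap.domDomCongr_apply,
      MultilinearMap.compLinearMap_apply, F.map_coord_zero (σ.symm i), smul_zero]
    rw [Equiv.apply_symm_apply]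
    exact proj_homVec_of_ne (X i) hi

theorem mem_superAlternating_iff {n : ℕ} {F : Multi K n V W} :
    F ∈ superAlternating 𝒱 n W ↔ ∀ (σ : Equiv.Perm (Fin n)) (X : Fin n → HomVec 𝒱),
      koszulSign σ (fun i => (X i).1) • F (fun i => (X (σ i)).2) = F fun i => (X i).2 := by
  simp only [superAlternating, Submodule.mem_iInf, LinearMap.mem_ker, LinearMap.sub_apply,
    LinearMap.id_apply, sub_eq_zero, ← permAct_apply_homVec]
  exact forall_congr' fun σ => ⟨fun h X => by rw [h], fun h => multi_ext h⟩

omit [DirectSum.Decomposition 𝒱] in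
theorem mem_homogeneous_iff {n : ℕ} {F : Multi K n V W} {b : ZMod 2} :
    F ∈ homogeneous 𝒱 𝒲 n b ↔ ∀ X : Fin n → HomVec 𝒱,
      F (fun i => (X i).2) ∈ 𝒲 (b + ∑ i, (X i).1) :=
  ⟨fun h X => h _ _ fun i => (X i).2.2, fun h a X hX => h fun i => ⟨a i, X i, hX i⟩⟩

theorem degPart_apply_homVec [DirectSum.Decomposition 𝒲] {n : ℕ} (b : ZMod 2) (F : Multi K n V W)
    (X : Fin n → HomVec 𝒱) : degPart 𝒱 𝒲 b F (fun i => (X i).2) =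
      proj 𝒲 (b + ∑ i, (X i).1) (F fun i => (X i).2) := by
  simp only [degPart, LinearMap.coe_mk, AddHom.coe_mk, sum_apply]
  rw [sum_degrees X]
  · simp [proj_homVec]
  · intro a i hi
    rw [LinearMap.compMultilinearMap_apply, MultilinearMap.compLinearMap_apply,
      F.map_coord_zero i (proj_homVec_of_ne (X i) hi), map_zero]

theorem degPart_of_mem [DirectSum.Decomposition 𝒲] {n : ℕ} {b : ZMod 2} {F : Multi K n V W}
    (h : F ∈ homogeneous 𝒱 𝒲 n b) (c : ZMod 2) :
    degPart 𝒱 𝒲 c F = if b = c then F else 0 := by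
  refine multi_ext (𝒱 := 𝒱) fun X => ?_
  rw [degPart_apply_homVec, proj_of_mem 𝒲 (mem_homogeneous_iff.1 h X)]
  simp only [add_left_inj]
  split_ifs <;> rfl

theorem star_apply_homVec {p q : ℕ} (b : ZMod 2) (F : Multi K (p + 1) V V)
    (F' : Multi K (q + 1) V V) (X : Fin (p + (q + 1)) → HomVec 𝒱) :
    star 𝒱 b F F' (fun i => (X i).2) =
      ssign (b * ∑ i : Fin p, (X (Fin.castAdd (q + 1) i)).1) •
        insertLast F F' fun i => (X i).2 := by
  simp only [star, sum_apply]
  rw [sum_degrees (n := p + q + 1) X]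
  · simp [proj_homVec]
  · intro a i hi
    rw [smul_apply, MultilinearMap.compLinearMap_apply,
      (insertLast F F').map_coord_zero i (proj_homVec_of_ne (X i) hi), smul_zero]

/-! ### Evaluation on lists -/

variable (𝒱) in
/-- The values of the elements of `NR K V` on the lists of homogeneous vectors. -/
def listEval : NR K V →ₗ[K] (List (HomVec 𝒱) → V) where
  toFun F L := match L with
    -- Elements of `NR K V` have arity at least one.
    | [] => 0
    | x :: L => F L.length fun i => ((x :: L).get i).2
  map_add' F G := by
    funext L
    cases L <;> simp
  map_smul' c F := by
    funext L
    cases L <;> simp [DirectSum.smul_apply]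

omit [DirectSum.Decomposition 𝒱] in
theorem listEval_ofFn (F : NR K V) {p : ℕ} (X : Fin (p + 1) → HomVec 𝒱) :
    listEval 𝒱 F (List.ofFn X) = F p fun i => (X i).2 := by
  have h (L : List (HomVec 𝒱)) (hL : L.length = p + 1) :
      listEval 𝒱 F L = F p fun i => (L.get (i.cast hL.symm)).2 := by
    cases L with
    | nil => simp at hL
    | cons x L =>
      obtain rfl : L.length = p := by simpa using hL
      rfl
  rw [h _ (by simp)]
  congr 1
  funext i
  rw [List.get_eq_getElem, List.getElem_ofFn]
  rfl

omit [DirectSum.Decomposition 𝒱] in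
theorem listEval_ofMulti_ofFn {p : ℕ} (F : Multi K (p + 1) V V) (X : Fin (p + 1) → HomVec 𝒱) :
    listEval 𝒱 (ofMulti p F) (List.ofFn X) = F fun i => (X i).2 := by
  rw [listEval_ofFn, DirectSum.lof_apply]

theorem exists_ofFn_eq {α : Type*} {n : ℕ} {L : List α} (h : L.length = n) :
    ∃ X : Fin n → α, L = List.ofFn X := by
  subst h
  exact ⟨L.get, (List.ofFn_get L).symm⟩

theorem listEval_injective : Function.Injective (listEval (K := K) 𝒱) := by
  intro F G h
  refine DFinsupp.ext fun p => multi_ext (𝒱 := 𝒱) fun X => ?_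
  have := congrFun h (List.ofFn X)
  rwa [listEval_ofFn, listEval_ofFn] at this

omit [DirectSum.Decomposition 𝒱] in
theorem hasArity_listEval {p : ℕ} (F : Multi K (p + 1) V V) :
    HasArity (p + 1) (listEval 𝒱 (ofMulti p F)) := by
  intro L hL
  cases L with
  | nil => rfl
  | cons x L =>
    have hp : p ≠ L.length := fun h => hL (by simp [h])
    have h : (ofMulti p F : NR K V) L.length = 0 := DFinsupp.single_eq_of_ne hp.symm
    change (ofMulti p F : NR K V) L.length _ = 0
    rw [h]; rfl

omit [DirectSum.Decomposition 𝒱] in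
theorem isListLinear_listEval (F : NR K V) : IsListLinear (listEval 𝒱 F) := by
  have key (A B : List (HomVec 𝒱)) : ∃ f : V →ₗ[K] V, ∀ a (v : 𝒱 a),
      listEval 𝒱 F (A ++ ⟨a, v⟩ :: B) = f v := by
    classical
    let z : HomVec 𝒱 := ⟨0, 0⟩
    have hl (x : HomVec 𝒱) : (A ++ x :: B).length = (A.length + B.length) + 1 := by
      simp; omega
    obtain ⟨X, hX⟩ := exists_ofFn_eq (hl z)
    let k : Fin ((A.length + B.length) + 1) := ⟨A.length, by omega⟩
    refine ⟨(F (A.length + B.length)).toLinearMap (fun i => (X i).2) k, fun a v => ?_⟩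
    have h : A ++ ⟨a, v⟩ :: B = List.ofFn (Function.update X k ⟨a, v⟩) := by
      have h1 : A ++ ⟨a, v⟩ :: B = (A ++ z :: B).set A.length ⟨a, v⟩ := by simp
      rw [h1, hX]
      refine List.ext_getElem (by simp) fun i h1 h2 => ?_
      rw [List.getElem_set, List.getElem_ofFn, List.getElem_ofFn, Function.update_apply]
      simp only [Fin.ext_iff, k, eq_comm]
    rw [h, listEval_ofFn, MultilinearMap.toLinearMap_apply]
    congr 1
    funext i
    by_cases hi : i = k
    · subst hi
      rw [Function.update_self, Function.update_self]
    · rw [Function.update_of_ne hi, Function.update_of_ne hi]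
  constructor
  · intro A a v w B
    obtain ⟨f, hf⟩ := key A B
    rw [hf, hf, hf, Submodule.coe_add, map_add]
  · intro A a c v B
    obtain ⟨f, hf⟩ := key A B
    rw [hf, hf, Submodule.coe_smul, map_smul]

/-! ### Super-alternating maps as skew-symmetric functions of lists -/

omit [DirectSum.Decomposition 𝒱] in
-- The vector `x` travels to the front by exchanges with its left neighbours.
theorem IsListSkew.insertIdx {Φ : List (HomVec 𝒱) → V} (h : IsListSkew Φ) (x : HomVec 𝒱) :
    ∀ (k : ℕ) (L : List (HomVec 𝒱)), k ≤ L.length →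
      passSign x (L.take k) • Φ (L.insertIdx k x) = Φ (x :: L)
  | 0, L, _ => by simp [passSign]
  | k + 1, [], hk => by simp at hk
  | k + 1, y :: L, hk => by
    have ih := (h.contract y).insertIdx x k L (by simpa using hk)
    have h1 := h [] x y L
    have h2 : passSign x (y :: L.take k) = dsign (vecDeg x) (vecDeg y) * passSign x (L.take k) := by
      simp [passSign]
    rw [List.nil_append, List.nil_append] at h1
    rw [List.insertIdx_succ_cons, List.take_succ_cons, h2, mul_smul, h1]
    exact congrArg _ ih

omit [DirectSum.Decomposition 𝒱] in
-- Induction along `insertPerm`: `X 0` is brought to the front, and the remaining letters are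
-- permuted inside the contraction with `X 0`.
theorem IsListSkew.koszulSign_smul {n : ℕ} {Φ : List (HomVec 𝒱) → V} (h : IsListSkew Φ)
    (σ : Equiv.Perm (Fin n)) (X : Fin n → HomVec 𝒱) :
    koszulSign σ (fun i => (X i).1) • Φ (List.ofFn fun i => X (σ i)) = Φ (List.ofFn X) := by
  induction n generalizing Φ with
  | zero => simp [koszulSign_eq_prod]
  | succ n ih =>
    obtain ⟨⟨k, σ⟩, rfl⟩ := (insertPerm_bijective n).2 σ
    have h1 := ih (h.contract (X 0)) σ fun i => X i.succ
    dsimp only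
    rw [koszulSign_insertPerm_homVec, ofFn_insertPerm, mul_comm, mul_smul,
      h.insertIdx _ _ _ (by simpa using Nat.lt_succ_iff.1 k.2), List.ofFn_succ]
    exact h1

theorem koszulSign_one {n : ℕ} (a : Fin n → ZMod 2) : koszulSign 1 a = 1 := by
  have h : ∀ i j : Fin n, ¬ (i < j ∧ j < i) := fun i j h => lt_asymm h.1 h.2
  simp [koszulSign_eq_prod, h]

omit [DirectSum.Decomposition 𝒱] in
/-- Invariance under all permutations implies skew-symmetry. -/
theorem isListSkew_of_koszulSign {Φ : List (HomVec 𝒱) → V}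
    (h : ∀ n (σ : Equiv.Perm (Fin n)) (X : Fin n → HomVec 𝒱),
      koszulSign σ (fun i => (X i).1) • Φ (List.ofFn fun i => X (σ i)) = Φ (List.ofFn X)) :
    IsListSkew Φ := by
  intro A
  induction A generalizing Φ with
  | nil =>
    intro x y B
    obtain ⟨X, hX⟩ := exists_ofFn_eq (n := B.length + 1 + 1) (L := x :: y :: B) rfl
    have hX' := hX
    rw [List.ofFn_succ] at hX'
    obtain ⟨hx, hY⟩ := List.cons.inj hX'
    -- This permutation exchanges the first two letters.
    have h1 := h _ (insertPerm 1 1) X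
    rw [koszulSign_insertPerm_homVec, ofFn_insertPerm, koszulSign_one, ← hX] at h1
    simp only [Equiv.Perm.coe_one, id_eq, ← hY, ← hx, mul_one] at h1
    rw [List.nil_append, List.nil_append, ← h1]
    simp [passSign]
  | cons z A ih =>
    refine ih (Φ := contract z Φ) fun n σ X => ?_
    -- Permutations fixing the first letter show that the contraction with `z` is invariant too.
    have h1 := h (n + 1) (insertPerm 0 σ) (Fin.cons z X)
    rw [koszulSign_insertPerm_homVec, ofFn_insertPerm, List.ofFn_succ] at h1
    simpa [passSign, contract] using h1

end Evaluation

section NijenhuisRichardson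

variable {K : Type*} [Field K] {V : Type*} [AddCommGroup V] [Module K V]
  {𝒱 : ZMod 2 → Submodule K V}

/-! ### The Nijenhuis–Richardson algebra of homogeneous super-alternating maps -/

/-- The degree modulo `2`. -/
def degMod (i : ℕ × ZMod 2) : ZMod 2 × ZMod 2 := (i.1, i.2)

theorem degMod_add (i j : ℕ × ZMod 2) : degMod (i + j) = degMod i + degMod j := by
  simp [degMod]

theorem commSign_eq_dsign (i j : ℕ × ZMod 2) : commSign i j = dsign (degMod i) (degMod j) := by
  rw [commSign, dsign, neg_one_pow_eq_ssign, ssign_add, Nat.cast_mul]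
  rfl

theorem mem_shuffles_iff {p q : ℕ} {σ : Equiv.Perm (Fin (p + q))} :
    σ ∈ shuffles p q ↔ IsShuffle p σ := by
  rw [shuffles, Finset.mem_filter]
  constructor
  · rintro ⟨-, h1, h2⟩ i j hij h
    induction i using Fin.addCases with
    | left i =>
      induction j using Fin.addCases with
      | left j => exact h1 (show i < j from hij)
      | right j =>
        rcases h with h | h
        · simp at h
        · simp at h; omega
    | right i =>
      induction j using Fin.addCases with
      | left j =>
        have h3 : p + i.val < j.val := hij
        omega
      | right j => exact h2 (show i < j from Nat.lt_of_add_lt_add_left hij)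
  · intro h
    refine ⟨Finset.mem_univ _, fun i j hij => h _ _ hij (Or.inl ?_),
      fun i j hij => h _ _ (Nat.add_lt_add_left (Fin.lt_def.1 hij) p) (Or.inr ?_)⟩
    · simp
    · simp

theorem IsListCochain.zsmul {d : ZMod 2 × ZMod 2} {Φ : List (HomVec 𝒱) → V}
    (h : IsListCochain d Φ) (c : ℤ) : IsListCochain d (c • Φ) := by
  have := h.sub_zsmul h (1 - c)
  rwa [sub_smul, one_smul, sub_sub_cancel] at this

/-- The two compositions in a bracket lie in the summands `p + q` and `q + p`; this brings them into
one. -/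
theorem exists_ofMulti_eq {m n : ℕ} (h : m = n) (F : Multi K (m + 1) V V) :
    ∃ F', ofMulti n F' = ofMulti m F := by
  subst h
  exact ⟨F, rfl⟩

theorem dsign_degMod_degMod (i j : ℕ × ZMod 2) :
    dsign (degMod i) (degMod j) = (-1) ^ (i.1 * j.1) * ssign (i.2 * j.2) :=
  (commSign_eq_dsign i j).symm

variable [DirectSum.Decomposition 𝒱]

theorem circ_of_mem {p q : ℕ} (F : Multi K (p + 1) V V) {F' : Multi K (q + 1) V V} {b : ZMod 2}
    (hF' : F' ∈ homogeneous 𝒱 𝒱 (q + 1) b) :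
    circ 𝒱 p q F F' = ∑ σ ∈ shuffles p (q + 1), permAct 𝒱 σ (star 𝒱 b F F') := by
  rw [circ, LinearMap.mk₂_apply, Fintype.sum_eq_single b, degPart_of_mem hF', if_pos rfl]
  intro c hc
  rw [degPart_of_mem hF', if_neg hc.symm]
  have : star 𝒱 c F (0 : Multi K (q + 1) V V) = 0 := by
    simpa using star_smul_right 𝒱 c (0 : K) F (0 : Multi K (q + 1) V V)
  simp [this]

theorem ofFn_snoc {α : Type*} {n : ℕ} (f : Fin n → α) (x : α) :
    List.ofFn (Fin.snoc (α := fun _ => α) f x : Fin (n + 1) → α) = List.ofFn f ++ [x] := by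
  rw [List.ofFn_succ', List.concat_eq_append]
  congr 2
  · funext i
    exact Fin.snoc_castSucc (α := fun _ => α) x f i
  · exact Fin.snoc_last (α := fun _ => α) x f

/-- For homogeneous `F'` the projection inside `homVec` does not change the value of `F'`. -/
theorem splitTerm_listEval {p q : ℕ} (F : Multi K (p + 1) V V) {F' : Multi K (q + 1) V V}
    {b : ZMod 2} (hF' : F' ∈ homogeneous 𝒱 𝒱 (q + 1) b) (Y : Fin (p + (q + 1)) → HomVec 𝒱) :
    splitTerm b (listEval 𝒱 (ofMulti p F)) (listEval 𝒱 (ofMulti q F'))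
      ((List.ofFn Y).take p) ((List.ofFn Y).drop p) = star 𝒱 b F F' fun i => (Y i).2 := by
  have h : List.ofFn Y = (List.ofFn fun i : Fin p => Y (Fin.castAdd (q + 1) i)) ++
      List.ofFn fun j : Fin (q + 1) => Y (Fin.natAdd p j) := by
    rw [← List.ofFn_fin_append, Fin.append_castAdd_natAdd]
  rw [h, List.take_left' (by simp), List.drop_left' (by simp), splitTerm, star_apply_homVec,
    listEval_ofMulti_ofFn, insertLast_apply]
  rw [← ofFn_snoc, listEval_ofMulti_ofFn, List.map_ofFn, List.map_ofFn, List.sum_ofFn,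
    List.sum_ofFn]
  congr 2
  funext i
  induction i using Fin.lastCases with
  | last =>
    refine (congrArg (fun y : HomVec 𝒱 => (y.2 : V))
      (Fin.snoc_last (α := fun _ => HomVec 𝒱) _ _)).trans ?_
    refine Eq.trans ?_ (Fin.snoc_last (α := fun _ => V) _ _).symm
    exact proj_of_mem 𝒱 (mem_homogeneous_iff.1 hF' _) _ |>.trans (if_pos rfl)
  | cast i =>
    refine (congrArg (fun y : HomVec 𝒱 => (y.2 : V))
      (Fin.snoc_castSucc (α := fun _ => HomVec 𝒱) _ _ i)).trans ?_
    exact (Fin.snoc_castSucc (α := fun _ => V) _ (fun i => ((Y (Fin.castAdd (q + 1) i)).2 : V)) i).symm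

theorem HasArity.comp {p m : ℕ} {d : ZMod 2 × ZMod 2} {Φ Ψ : List (HomVec 𝒱) → V}
    (hΦ : HasArity (p + 1) Φ) (hΨ : HasArity m Ψ) (hl : IsListLinear Φ) :
    HasArity (p + m) (comp d Φ Ψ) := by
  intro L hL
  induction L generalizing p m d Φ Ψ with
  | nil =>
    rw [SuperLie.comp]
    by_cases hm : m = 0
    · exact hΦ _ (by simp at hL ⊢; omega)
    · rw [hΨ [] (by simpa using Ne.symm hm), hl.homVec_zero₀]
  | cons x L ih =>
    rw [SuperLie.comp]
    have h1 : SuperLie.comp (d + vecDeg x) Φ (SuperLie.contract x Ψ) L = 0 := by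
      rcases m with _ | m
      · have hz : SuperLie.contract x Ψ = 0 := funext fun L => hΨ _ (by simp)
        rw [hz, comp_zero_right hl, Pi.zero_apply]
      · exact ih hΦ (hΨ.contract x) hl (by simp at hL; omega)
    have h2 : SuperLie.comp d (SuperLie.contract x Φ) Ψ L = 0 := by
      rcases p with _ | p
      · exact comp_eq_zero_of_left (fun y L => hΦ (x :: y :: L) (by simp)) _ _
      · exact ih (hΦ.contract x) hΨ (hl.contract x) (by simp at hL; omega)
    rw [h1, h2, smul_zero, add_zero]

/-- This carries the composition of multilinear maps over to the list model, at the cost of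
`(-1)^{pq}`. -/
theorem listEval_circ {p q : ℕ} (F : Multi K (p + 1) V V) {F' : Multi K (q + 1) V V}
    {b : ZMod 2} (hF' : F' ∈ homogeneous 𝒱 𝒱 (q + 1) b) :
    listEval 𝒱 (ofMulti (p + q) (circ 𝒱 p q F F')) =
      ssign (p * q : ℕ) • comp (degMod (q, b)) (listEval 𝒱 (ofMulti p F))
        (listEval 𝒱 (ofMulti q F')) := by
  funext L
  by_cases hL : L.length = p + q + 1
  · obtain ⟨X, rfl⟩ := exists_ofFn_eq hL
    have h := shuffleSum_splitTerm (d := degMod (q, b)) (p := p) (m := q + 1)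
      (n := p + (q + 1)) X (hasArity_listEval F) (hasArity_listEval F') rfl
      (isListLinear_listEval _) (by simp only [degMod]; push_cast; ring_nf; reduce_mod_char)
    rw [Pi.smul_apply, listEval_ofMulti_ofFn, circ_of_mem F hF', sum_apply, Nat.cast_mul]
    refine Eq.trans ?_ h
    rw [shuffleSum, ← Finset.sum_filter]
    refine Finset.sum_congr (by ext σ; simp [mem_shuffles_iff]) fun σ _ => ?_
    refine (permAct_apply_homVec (n := p + (q + 1)) σ (star 𝒱 b F F') X).trans ?_
    exact congrArg _ (splitTerm_listEval F hF' fun i => X (σ i)).symm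
  · rw [hasArity_listEval _ L hL, Pi.smul_apply,
      (hasArity_listEval F).comp (hasArity_listEval F') (isListLinear_listEval _) L hL, smul_zero]

variable (𝒱) in
/-- The super-alternating maps of degree `i`, as elements of `NR K V`. -/
def altPart (i : ℕ × ZMod 2) : Submodule K (NR K V) :=
  (superAlternating 𝒱 (i.1 + 1) V ⊓ homogeneous 𝒱 𝒱 (i.1 + 1) i.2).map (ofMulti i.1)

theorem isListCochain_listEval {i : ℕ × ZMod 2} {x : NR K V} (hx : x ∈ altPart 𝒱 i) :
    IsListCochain (degMod i) (listEval 𝒱 x) := by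
  obtain ⟨F, ⟨h1, h2⟩, rfl⟩ := hx
  have ha := hasArity_listEval (𝒱 := 𝒱) F
  refine ⟨isListLinear_listEval _, isListSkew_of_koszulSign fun n σ X => ?_, fun L hL => ?_,
    fun L => ?_⟩
  · by_cases hn : n = i.1 + 1
    · subst hn
      rw [listEval_ofMulti_ofFn, listEval_ofMulti_ofFn]
      exact mem_superAlternating_iff.1 h1 σ X
    · rw [ha _ (by simpa using hn), ha _ (by simpa using hn), smul_zero]
  · have h : L.length = i.1 + 1 := by_contra fun h => hL (ha L h)
    rw [h, degMod]
    push_cast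
    ring_nf
    reduce_mod_char
  · by_cases h : L.length = i.1 + 1
    · obtain ⟨X, rfl⟩ := exists_ofFn_eq h
      rw [listEval_ofMulti_ofFn, List.map_ofFn, List.sum_ofFn]
      exact mem_homogeneous_iff.1 h2 X
    · rw [ha L h]
      exact Submodule.zero_mem _

theorem ofMulti_mem_altPart {p : ℕ} {f : ZMod 2} {F : Multi K (p + 1) V V}
    (h : IsListCochain (degMod (p, f)) (listEval 𝒱 (ofMulti p F))) :
    ofMulti p F ∈ altPart 𝒱 (p, f) := by
  refine ⟨F, ⟨mem_superAlternating_iff.2 fun σ X => ?_, mem_homogeneous_iff.2 fun X => ?_⟩, rfl⟩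
  · have := h.skew.koszulSign_smul σ X
    rwa [listEval_ofMulti_ofFn, listEval_ofMulti_ofFn] at this
  · have := h.hom (List.ofFn X)
    rwa [listEval_ofMulti_ofFn, List.map_ofFn, List.sum_ofFn] at this

theorem nrBracket_ofMulti {p q : ℕ} {f f' : ZMod 2} {F : Multi K (p + 1) V V}
    {F' : Multi K (q + 1) V V} (hF : F ∈ homogeneous 𝒱 𝒱 (p + 1) f)
    (hF' : F' ∈ homogeneous 𝒱 𝒱 (q + 1) f') :
    nrBracket 𝒱 (ofMulti p F) (ofMulti q F') = ofMulti (p + q) (circ 𝒱 p q F F') -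
      ((-1) ^ (p * q) * ssign (f * f')) • ofMulti (q + p) (circ 𝒱 q p F' F) := by
  rw [nrBracket, DirectSum.toModule_lof, LinearMap.flip_apply, DirectSum.toModule_lof,
    LinearMap.flip_apply, LinearMap.mk₂_apply, Fintype.sum_eq_single f, Fintype.sum_eq_single f']
  · rw [degPart_of_mem hF, degPart_of_mem hF', if_pos rfl, if_pos rfl]
  · intro b hb
    rw [degPart_of_mem hF', if_neg hb.symm]
    simp
  · intro b hb
    refine Finset.sum_eq_zero fun c _ => ?_
    rw [degPart_of_mem hF, if_neg hb.symm]
    simp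

theorem listEval_nrBracket {i j : ℕ × ZMod 2} {x y : NR K V} (hx : x ∈ altPart 𝒱 i)
    (hy : y ∈ altPart 𝒱 j) : listEval 𝒱 (nrBracket 𝒱 x y) =
      ssign (i.1 * j.1 : ℕ) • listBracket (degMod i) (degMod j) (listEval 𝒱 x) (listEval 𝒱 y) := by
  obtain ⟨F, ⟨-, hF⟩, rfl⟩ := hx
  obtain ⟨F', ⟨-, hF'⟩, rfl⟩ := hy
  rw [nrBracket_ofMulti hF hF', map_sub, map_zsmul, listEval_circ F hF', listEval_circ F' hF,
    listBracket, dsign_degMod_degMod, mul_comm j.1 i.1, smul_sub, smul_comm (ssign _)]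

theorem nrBracket_mem {i j : ℕ × ZMod 2} {x y : NR K V} (hx : x ∈ altPart 𝒱 i)
    (hy : y ∈ altPart 𝒱 j) : nrBracket 𝒱 x y ∈ altPart 𝒱 (i + j) := by
  have h : IsListCochain (degMod (i + j)) (listEval 𝒱 (nrBracket 𝒱 x y)) := by
    rw [listEval_nrBracket hx hy, degMod_add]
    exact ((isListCochain_listEval hx).listBracket (isListCochain_listEval hy)).zsmul _
  obtain ⟨F, ⟨-, hF⟩, rfl⟩ := hx
  obtain ⟨F', ⟨-, hF'⟩, rfl⟩ := hy
  rw [nrBracket_ofMulti hF hF'] at h ⊢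
  obtain ⟨Z, hZ⟩ := exists_ofMulti_eq (add_comm j.1 i.1) (circ 𝒱 j.1 i.1 F' F)
  rw [← hZ, ← map_zsmul, ← map_sub] at h ⊢
  exact ofMulti_mem_altPart h

theorem nrBracket_skew {i j : ℕ × ZMod 2} {x y : NR K V} (hx : x ∈ altPart 𝒱 i)
    (hy : y ∈ altPart 𝒱 j) : nrBracket 𝒱 x y = -(commSign i j • nrBracket 𝒱 y x) := by
  apply listEval_injective (𝒱 := 𝒱)
  rw [map_neg, map_zsmul, listEval_nrBracket hx hy, listEval_nrBracket hy hx, listBracket_skew,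
    commSign_eq_dsign, mul_comm j.1, smul_neg, smul_comm (ssign _)]

/-- On lists, all three double brackets carry the common factor `(-1)^{pq+pr+qr}`, which leaves
`listBracket_jacobi`. -/
theorem nrBracket_jacobi {i j k : ℕ × ZMod 2} {x y z : NR K V} (hx : x ∈ altPart 𝒱 i)
    (hy : y ∈ altPart 𝒱 j) (hz : z ∈ altPart 𝒱 k) :
    nrBracket 𝒱 x (nrBracket 𝒱 y z) = nrBracket 𝒱 (nrBracket 𝒱 x y) z +
      commSign i j • nrBracket 𝒱 y (nrBracket 𝒱 x z) := by
  apply listEval_injective (𝒱 := 𝒱)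
  have hl (d e : ZMod 2 × ZMod 2) {Φ : List (HomVec 𝒱) → V} (h : IsListLinear Φ) (c : ℤ)
      (Ψ : List (HomVec 𝒱) → V) : listBracket d e Φ (c • Ψ) = c • listBracket d e Φ Ψ := by
    rw [listBracket, listBracket, comp_zsmul_right h, comp_zsmul_left, smul_sub, smul_comm c]
  have hr (d e : ZMod 2 × ZMod 2) {Ψ : List (HomVec 𝒱) → V} (h : IsListLinear Ψ) (c : ℤ)
      (Φ : List (HomVec 𝒱) → V) : listBracket d e (c • Φ) Ψ = c • listBracket d e Φ Ψ := by
    rw [listBracket, listBracket, comp_zsmul_right h, comp_zsmul_left, smul_sub, smul_comm c]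
  have hx' := isListCochain_listEval hx
  have hy' := isListCochain_listEval hy
  have hz' := isListCochain_listEval hz
  rw [map_add, map_zsmul, listEval_nrBracket hx (nrBracket_mem hy hz),
    listEval_nrBracket hy (nrBracket_mem hx hz), listEval_nrBracket (nrBracket_mem hx hy) hz,
    listEval_nrBracket hx hy, listEval_nrBracket hx hz, listEval_nrBracket hy hz,
    hl _ _ hx'.linear, hl _ _ hy'.linear, hr _ _ hz'.linear, degMod_add, degMod_add, degMod_add,
    listBracket_jacobi hx' hy' hz', commSign_eq_dsign]
  have e (a b c : ℕ) : ssign ((a * (b + c) : ℕ)) * ssign (b * c : ℕ) =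
      ssign (a * b : ℕ) * ssign (a * c : ℕ) * ssign (b * c : ℕ) := by
    simp only [← ssign_add]; congr 1; push_cast; ring
  have e' (a b c : ℕ) : ssign (((a + b) * c : ℕ)) * ssign (a * b : ℕ) =
      ssign (a * b : ℕ) * ssign (a * c : ℕ) * ssign (b * c : ℕ) := by
    simp only [← ssign_add]; congr 1; push_cast; ring
  simp only [smul_add, smul_smul, Prod.fst_add]
  rw [e, e']
  congr 2
  rw [← mul_assoc, e, e, mul_comm j.1 i.1]
  ring

/-! ### Lie superalgebras as elements of degree `(1, 0)` -/

/-- The bracket of a Lie superalgebra as an element of `NR K V`. -/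
def LieSuperalgebra.toNR (β : LieSuperalgebra 𝒱) : NR K V :=
  ofMulti 1 (bilin LinearMap.id LinearMap.id β.bracket)

omit [DirectSum.Decomposition 𝒱] in
theorem LieSuperalgebra.listEval_toNR (β : LieSuperalgebra 𝒱) (x y : HomVec 𝒱) :
    listEval 𝒱 β.toNR [x, y] = β.bracket x.2 y.2 := by
  have : [x, y] = List.ofFn ![x, y] := by simp
  rw [this, toNR, listEval_ofMulti_ofFn]
  rfl

theorem LieSuperalgebra.toNR_mem (β : LieSuperalgebra 𝒱) : β.toNR ∈ altPart 𝒱 (1, 0) := by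
  have ha := hasArity_listEval (𝒱 := 𝒱) (bilin LinearMap.id LinearMap.id β.bracket)
  refine ofMulti_mem_altPart ⟨isListLinear_listEval _, ?_, fun L hL => ?_, fun L => ?_⟩
  · intro A x y B
    by_cases h : A.length = 0 ∧ B.length = 0
    · obtain ⟨h1, h2⟩ := h
      rw [List.length_eq_zero_iff] at h1 h2
      subst h1 h2
      change listEval 𝒱 β.toNR [x, y] = _ • listEval 𝒱 β.toNR [y, x]
      rw [β.listEval_toNR, β.listEval_toNR, β.skew _ _ _ x.2.2 _ y.2.2, dsign, vecDeg, vecDeg,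
        mul_one, add_comm 1, ssign_add_one, neg_smul]
    · rw [ha _ (by simp; omega), ha _ (by simp; omega), smul_zero]
  · have h : L.length = 2 := by_contra fun h => hL (ha L h)
    rw [h]
    decide
  · by_cases h : L.length = 2
    · obtain ⟨x, y, rfl⟩ := List.length_eq_two.1 h
      change listEval 𝒱 β.toNR [x, y] ∈ _
      rw [β.listEval_toNR]
      simpa [degMod] using β.bracket_mem _ _ _ x.2.2 _ y.2.2
    · rw [ha L h]
      exact Submodule.zero_mem _

/-- On three vectors the composition is a signed sum of `[z,[x,y]]`, `[y,[x,z]]` and `[x,[y,z]]`,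
zero by the Jacobi identity; other lengths are excluded by arity. -/
theorem LieSuperalgebra.comp_self (β : LieSuperalgebra 𝒱) :
    comp (1, 0) (listEval 𝒱 β.toNR) (listEval 𝒱 β.toNR) = 0 := by
  funext L
  have ha : HasArity 2 (listEval 𝒱 β.toNR) := hasArity_listEval _
  have hl : IsListLinear (listEval 𝒱 β.toNR) := isListLinear_listEval _
  by_cases h : L.length = 3
  · obtain ⟨x, y, z, rfl⟩ := List.length_eq_three.1 h
    have h0 : listEval 𝒱 β.toNR [] = 0 := rfl
    have h1 (x) : listEval 𝒱 β.toNR [x] = 0 := ha _ (by simp)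
    have h3 (x y z) : listEval 𝒱 β.toNR [x, y, z] = 0 := ha _ (by simp)
    have h4 (x y z w) : listEval 𝒱 β.toNR [x, y, z, w] = 0 := ha _ (by simp)
    have hb (u v : HomVec 𝒱) (c : ZMod 2) (hc : c = u.1 + v.1) :
        ((homVec (𝒱 := 𝒱) c (β.bracket u.2 v.2)).2 : V) = β.bracket u.2 v.2 :=
      (proj_of_mem 𝒱 (β.bracket_mem _ _ _ u.2.2 _ v.2.2) c).trans (if_pos hc.symm)
    simp only [comp, contract, h1, h3, h4, smul_zero, add_zero, zero_add,
      β.listEval_toNR, Pi.zero_apply]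
    rw [hb _ _ _ (by simp [vecDeg]), hb _ _ _ (by simp [vecDeg]), hb _ _ _ (by simp [vecDeg])]
    rw [β.skew _ _ _ z.2.2 _ (β.bracket_mem _ _ _ x.2.2 _ y.2.2),
      β.jacobi _ _ _ x.2.2 _ y.2.2]
    have s1 (a b c : ZMod 2) : ssign ((1 + 1 + 1) * 1 + (0 + a + b) * c) =
        -ssign (c * (a + b)) := by revert a b c; decide
    have s2 (a b : ZMod 2) : ssign ((1 + 1) * 1 + (0 + a) * b) = ssign (a * b) := by
      revert a b; decide
    have s3 (a : ZMod 2) : ssign (1 * 1 + 0 * a) = -1 := by revert a; decide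
    simp only [dsign, vecDeg, Prod.fst_add, Prod.snd_add, s1, s2, s3, smul_neg, neg_smul,
      smul_smul, neg_mul, ssign_mul_self]
    module
  · exact (ha.comp (p := 1) ha hl) L h

/-- The relation `2[β,[β,x]] = [[β,β],x]` is useless in characteristic two. Instead, `(x ∘ β) ∘ β`
vanishes by `comp_comp_self` and `β ∘ β = 0`, and the other three terms cancel by the pre-Lie
identity for `β, x, β`. -/
theorem LieSuperalgebra.nrBracket_nrBracket (β : LieSuperalgebra 𝒱) {i : ℕ × ZMod 2} {x : NR K V}
    (hx : x ∈ altPart 𝒱 i) : nrBracket 𝒱 β.toNR (nrBracket 𝒱 β.toNR x) = 0 := by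
  apply listEval_injective (𝒱 := 𝒱)
  have hβ := β.toNR_mem
  have hβ' := isListCochain_listEval hβ
  have hx' := isListCochain_listEval hx
  have e1 : degMod (1, 0) = (1, 0) := by simp [degMod]
  rw [listEval_nrBracket hβ (nrBracket_mem hβ hx), listEval_nrBracket hβ hx, degMod_add, e1,
    map_zero]
  rw [e1] at hβ'
  have h0 := β.comp_self
  funext L
  have h1 := comp_preLie hβ'.linear hβ'.skew hx'.linear hβ'.linear hx'.parity hβ'.parity L
  have h2 := comp_comp_self hx'.linear hx'.skew hβ'.linear hβ'.parity rfl L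
  have e2 : dsign (1, 0) ((1, 0) + degMod i) = -dsign (1, 0) (degMod i) := by
    rw [dsign_add_right]
    exact neg_one_mul _
  have hn (Φ Ψ : List (HomVec 𝒱) → V) (c : ℤ) : Φ - c • Ψ = Φ + (-c) • Ψ := by module
  have hz (d : ZMod 2 × ZMod 2) : comp d (0 : List (HomVec 𝒱) → V) (listEval 𝒱 x) = 0 := by
    simpa using comp_zsmul_left d 0 (0 : List (HomVec 𝒱) → V) (listEval 𝒱 x)
  rw [h0, comp_zero_right hx'.linear] at h2
  rw [h0, hz] at h1
  simp only [listBracket, hn, comp_add_left, comp_zsmul_left, comp_add_right hβ'.linear,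
    comp_zsmul_right hβ'.linear, Pi.add_apply, Pi.smul_apply, e2,
    Pi.zero_apply, h2, dsign_comm (degMod i) (1, 0)] at h1 ⊢
  rw [add_comm (degMod i)] at h1
  generalize ssign _ = c, ssign _ = c'
  rcases dsign_eq_one_or (1, 0) (degMod i) with ha | ha <;>
  simp only [ha, one_smul, neg_smul, neg_neg] at h1 ⊢
  · linear_combination (norm := module) (c * c') • h1
  · linear_combination (norm := module) -(c * c') • h1

end NijenhuisRichardson

section Semidirect

variable {K : Type*} [Field K] {G : Type*} [AddCommGroup G] [Module K G]
  {H : Type*} [AddCommGroup H] [Module K H]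
  {𝒢 : ZMod 2 → Submodule K G} {ℋ : ZMod 2 → Submodule K H}

/-! ### Semidirect products -/

/-- The trivial bracket. -/
def LieSuperalgebra.trivial (𝒢 : ZMod 2 → Submodule K G) : LieSuperalgebra 𝒢 where
  bracket := 0
  bracket_mem _ _ _ _ _ _ := Submodule.zero_mem _
  skew := by simp
  jacobi := by simp

theorem linearMap_ext_homogeneous [DirectSum.Decomposition 𝒢] {S T : G →ₗ[K] H}
    (h : ∀ a, ∀ x ∈ 𝒢 a, S x = T x) : S = T := by
  ext x
  rw [← sum_proj 𝒢 x, map_sum, map_sum]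
  exact Finset.sum_congr rfl fun a _ => h a _ (proj_mem 𝒢 a x)

variable [DirectSum.Decomposition 𝒢] [DirectSum.Decomposition ℋ]

theorem proj_prodGrading (a : ZMod 2) (x : G × H) :
    proj (prodGrading 𝒢 ℋ) a x = (proj 𝒢 a x.1, proj ℋ a x.2) := by
  have h : x = ∑ b, (proj 𝒢 b x.1, proj ℋ b x.2) := by
    ext <;> simp [Prod.fst_sum, Prod.snd_sum, sum_proj]
  conv_lhs => rw [h]
  rw [map_sum, Finset.sum_eq_single a]
  · exact (proj_of_mem (prodGrading 𝒢 ℋ) ⟨proj_mem 𝒢 a _, proj_mem ℋ a _⟩ a).trans (if_pos rfl)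
  · intro b _ hb
    exact (proj_of_mem (prodGrading 𝒢 ℋ) ⟨proj_mem 𝒢 b _, proj_mem ℋ b _⟩ a).trans (if_neg hb)
  · simp

variable {π : LieSuperalgebra 𝒢} {μ : LieSuperalgebra ℋ}

/-- The right action `(u, y) ↦ (-1)^{a b} ρ(y) u` for `u` and `y` of degrees `a` and `b`. -/
def Action.twist (ρ : Action π μ) : H →ₗ[K] G →ₗ[K] H :=
  ∑ a, ∑ b, ssign (a * b) • ρ.toLin.flip.compl₁₂ (proj ℋ a) (proj 𝒢 b)

theorem Action.twist_apply (ρ : Action π μ) {a b : ZMod 2} {u : H} {y : G} (hu : u ∈ ℋ a)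
    (hy : y ∈ 𝒢 b) : ρ.twist u y = ssign (a * b) • ρ.toLin y u := by
  rw [twist, LinearMap.sum_apply, LinearMap.sum_apply, Fintype.sum_eq_single a,
    LinearMap.sum_apply, LinearMap.sum_apply, Fintype.sum_eq_single b]
  · simp [LinearMap.compl₁₂_apply, proj_of_mem ℋ hu, proj_of_mem 𝒢 hy]
  · intro c hc
    simp [LinearMap.compl₁₂_apply, proj_of_mem 𝒢 hy, hc.symm]
  · intro c hc
    simp [LinearMap.compl₁₂_apply, proj_of_mem ℋ hu, hc.symm]

/-- The bracket `[(x, u), (y, v)] = ([x, y], ρ(x) v - (-1)^{a b} ρ(y) u + [u, v])`. -/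
def Action.semidirectBracket (ρ : Action π μ) : G × H →ₗ[K] G × H →ₗ[K] G × H :=
  (π.bracket.compl₁₂ (LinearMap.fst K G H) (LinearMap.fst K G H)).compr₂ (LinearMap.inl K G H) +
  (ρ.toLin.compl₁₂ (LinearMap.fst K G H) (LinearMap.snd K G H) -
    ρ.twist.compl₁₂ (LinearMap.snd K G H) (LinearMap.fst K G H) +
    μ.bracket.compl₁₂ (LinearMap.snd K G H) (LinearMap.snd K G H)).compr₂ (LinearMap.inr K G H)

theorem Action.semidirectBracket_apply (ρ : Action π μ) {a b : ZMod 2} {x y : G × H}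
    (hx : x ∈ prodGrading 𝒢 ℋ a) (hy : y ∈ prodGrading 𝒢 ℋ b) :
    ρ.semidirectBracket x y = (π.bracket x.1 y.1, ρ.toLin x.1 y.2 -
      ssign (a * b) • ρ.toLin y.1 x.2 + μ.bracket x.2 y.2) := by
  have h := ρ.twist_apply hx.2 hy.1
  simp [semidirectBracket, LinearMap.compl₁₂_apply, h]

/-- The semidirect product of Lie superalgebras. -/
def Action.semidirect (ρ : Action π μ) : LieSuperalgebra (prodGrading 𝒢 ℋ) where
  bracket := ρ.semidirectBracket
  bracket_mem a b x hx y hy := by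
    rw [ρ.semidirectBracket_apply hx hy]
    refine ⟨π.bracket_mem _ _ _ hx.1 _ hy.1, Submodule.add_mem _ (Submodule.sub_mem _
      ((ρ.isDerivation _ _ hx.1).map_mem _ _ hy.2) (Submodule.smul_of_tower_mem _ _ ?_))
      (μ.bracket_mem _ _ _ hx.2 _ hy.2)⟩
    rw [add_comm]
    exact (ρ.isDerivation _ _ hy.1).map_mem _ _ hx.2
  skew a b x hx y hy := by
    rw [ρ.semidirectBracket_apply hx hy, ρ.semidirectBracket_apply hy hx]
    refine Prod.ext (π.skew _ _ _ hx.1 _ hy.1) ?_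
    have h := μ.skew _ _ _ hx.2 _ hy.2
    simp only [Prod.snd_neg, Prod.smul_snd]
    rw [h, mul_comm b a, smul_add, smul_sub, smul_smul, ssign_mul_self, one_smul]
    abel
  jacobi a b x hx y hy := by
    suffices h : ρ.semidirectBracket x ∘ₗ ρ.semidirectBracket y =
        ρ.semidirectBracket (ρ.semidirectBracket x y) +
          ssign (a * b) • ρ.semidirectBracket y ∘ₗ ρ.semidirectBracket x by
      exact fun z => LinearMap.congr_fun h z
    refine linearMap_ext_homogeneous (𝒢 := prodGrading 𝒢 ℋ) fun c z hz => ?_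
    have hm {a b : ZMod 2} {x y : G × H} (hx : x ∈ prodGrading 𝒢 ℋ a)
        (hy : y ∈ prodGrading 𝒢 ℋ b) : (π.bracket x.1 y.1, ρ.toLin x.1 y.2 -
      ssign (a * b) • ρ.toLin y.1 x.2 + μ.bracket x.2 y.2) ∈ prodGrading 𝒢 ℋ (a + b) := by
      refine ⟨π.bracket_mem _ _ _ hx.1 _ hy.1, Submodule.add_mem _ (Submodule.sub_mem _
        ((ρ.isDerivation _ _ hx.1).map_mem _ _ hy.2) (Submodule.smul_of_tower_mem _ _ ?_))
        (μ.bracket_mem _ _ _ hx.2 _ hy.2)⟩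
      rw [add_comm]
      exact (ρ.isDerivation _ _ hy.1).map_mem _ _ hx.2
    simp only [LinearMap.comp_apply, LinearMap.add_apply, LinearMap.smul_apply]
    rw [ρ.semidirectBracket_apply hx hy, ρ.semidirectBracket_apply hx hz,
      ρ.semidirectBracket_apply hy hz, ρ.semidirectBracket_apply hx (hm hy hz),
      ρ.semidirectBracket_apply hy (hm hx hz), ρ.semidirectBracket_apply (hm hx hy) hz]
    refine Prod.ext (π.jacobi _ _ _ hx.1 _ hy.1 _) ?_
    -- In the `𝔥`-component, terms with two entries from `𝔤` cancel because `ρ` is a morphism, those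
    -- with one because it acts by derivations, those with none by the Jacobi identity of `μ`.
    have d1 := (ρ.isDerivation _ _ hx.1).leibniz _ _ hy.2 z.2
    have d2 := (ρ.isDerivation _ _ hy.1).leibniz _ _ hx.2 z.2
    have d3 := (ρ.isDerivation _ _ hz.1).leibniz _ _ hx.2 y.2
    have j := μ.jacobi _ _ _ hx.2 _ hy.2 z.2
    have k := μ.skew _ _ _ hy.2 _ ((ρ.isDerivation _ _ hz.1).map_mem _ _ hx.2)
    simp only [Prod.snd_add, Prod.smul_snd, map_add, map_sub, map_zsmul, LinearMap.add_apply,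
      LinearMap.sub_apply, LinearMap.smul_apply, ρ.map_bracket _ _ _ hx.1 _ hy.1,
      ρ.map_bracket _ _ _ hx.1 _ hz.1, ρ.map_bracket _ _ _ hy.1 _ hz.1, LinearMap.comp_apply,
      d1, d2, d3, j, k, mul_add, add_mul, ssign_add, mul_comm b a, mul_comm c a]
    rcases ssign_eq_one_or (a * b) with h1 | h1 <;>
    rcases ssign_eq_one_or (a * c) with h2 | h2 <;>
    rcases ssign_eq_one_or (b * c) with h3 | h3 <;>
    simp only [h1, h2, h3, one_smul, neg_smul, mul_one, mul_neg, neg_neg] <;>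
    abel

/-! ### The elements `π`, `μ` and `ρ` of the Nijenhuis–Richardson algebra -/

omit [DirectSum.Decomposition 𝒢] [DirectSum.Decomposition ℋ] in
theorem listEval_piHat (π : LieSuperalgebra 𝒢) (x y : HomVec (prodGrading 𝒢 ℋ)) :
    listEval (prodGrading 𝒢 ℋ) (piHat H π) [x, y] = (π.bracket x.2.1.1 y.2.1.1, 0) := by
  have : [x, y] = List.ofFn ![x, y] := by simp
  rw [this, piHat, listEval_ofMulti_ofFn]
  rfl

omit [DirectSum.Decomposition 𝒢] [DirectSum.Decomposition ℋ] in
theorem listEval_muHat (μ : LieSuperalgebra ℋ) (x y : HomVec (prodGrading 𝒢 ℋ)) :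
    listEval (prodGrading 𝒢 ℋ) (muHat G μ) [x, y] = (0, μ.bracket x.2.1.2 y.2.1.2) := by
  have : [x, y] = List.ofFn ![x, y] := by simp
  rw [this, muHat, listEval_ofMulti_ofFn]
  rfl

theorem shuffles_one_one : shuffles 1 1 = {1, Equiv.swap 0 1} := by
  ext σ
  rw [mem_shuffles_iff]
  revert σ
  decide

theorem listEval_rhoHat (ρ : Action π μ) (x y : HomVec (prodGrading 𝒢 ℋ)) :
    listEval (prodGrading 𝒢 ℋ) (rhoHat ρ) [x, y] =
      (0, ρ.toLin x.2.1.1 y.2.1.2 - ssign (x.1 * y.1) • ρ.toLin y.2.1.1 x.2.1.2) := by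
  have h : [x, y] = List.ofFn ![x, y] := by simp
  have hs (a : Fin 2 → ZMod 2) : koszulSign (Equiv.swap 0 1) a = -ssign (a 1 * a 0) := by
    simp [koszulSign_eq_prod, Fin.prod_univ_two]
  rw [h, rhoHat, listEval_ofMulti_ofFn, shuffles_one_one, Finset.sum_pair (by decide),
    add_apply]
  erw [permAct_apply_homVec, permAct_apply_homVec]
  rw [koszulSign_one, hs]
  simp [bilin, sub_eq_add_neg, mul_comm y.1]
  rfl

theorem Action.semidirect_toNR (ρ : Action π μ) :
    ρ.semidirect.toNR = piHat H π + rhoHat ρ + muHat G μ := by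
  apply listEval_injective (𝒱 := prodGrading 𝒢 ℋ)
  funext L
  by_cases h : L.length = 2
  · obtain ⟨x, y, rfl⟩ := List.length_eq_two.1 h
    rw [LieSuperalgebra.listEval_toNR, map_add, map_add, Pi.add_apply, Pi.add_apply,
      listEval_piHat, listEval_rhoHat, listEval_muHat]
    refine (ρ.semidirectBracket_apply x.2.2 y.2.2).trans ?_
    simp
  · rw [map_add, map_add, Pi.add_apply, Pi.add_apply, LieSuperalgebra.toNR, piHat, rhoHat, muHat,
      hasArity_listEval _ L h, hasArity_listEval _ L h, hasArity_listEval _ L h,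
      hasArity_listEval _ L h, add_zero, add_zero]

omit [DirectSum.Decomposition 𝒢] in
theorem piHat_trivial : piHat H (LieSuperalgebra.trivial 𝒢) = 0 := by
  have : bilin (LinearMap.fst K G H) (LinearMap.fst K G H) (0 : G →ₗ[K] G →ₗ[K] G) = 0 := rfl
  rw [piHat, LieSuperalgebra.trivial, this]
  simp

omit [DirectSum.Decomposition ℋ] in
theorem muHat_trivial : muHat G (LieSuperalgebra.trivial ℋ) = 0 := by
  have : bilin (LinearMap.snd K G H) (LinearMap.snd K G H) (0 : H →ₗ[K] H →ₗ[K] H) = 0 := rfl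
  rw [muHat, LieSuperalgebra.trivial, this]
  simp

/-- The action on the vector space `H` with the trivial bracket. -/
def Action.forget (ρ : Action π μ) : Action π (LieSuperalgebra.trivial ℋ) where
  toLin := ρ.toLin
  isDerivation a x hx := ⟨(ρ.isDerivation a x hx).map_mem, by simp [LieSuperalgebra.trivial]⟩
  map_bracket := ρ.map_bracket

/-- The zero action of a vector space with the trivial bracket. -/
def Action.zero (𝒢 : ZMod 2 → Submodule K G) (μ : LieSuperalgebra ℋ) :
    Action (LieSuperalgebra.trivial 𝒢) μ where
  toLin := 0
  isDerivation _ _ _ := ⟨fun _ _ _ => Submodule.zero_mem _, by simp⟩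
  map_bracket := by simp

theorem Action.forget_semidirect_toNR (ρ : Action π μ) :
    ρ.forget.semidirect.toNR = piHat H π + rhoHat ρ := by
  rw [semidirect_toNR, muHat_trivial, add_zero]
  rfl

theorem Action.zero_semidirect_toNR (μ : LieSuperalgebra ℋ) :
    (Action.zero 𝒢 μ).semidirect.toNR = muHat G μ := by
  have h0 : bilin (LinearMap.fst K G H) (LinearMap.snd K G H) (0 : G →ₗ[K] H →ₗ[K] H) = 0 := rfl
  have h : rhoHat (Action.zero 𝒢 μ) = 0 := by
    rw [rhoHat, Action.zero, h0]
    simp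
  rw [semidirect_toNR, piHat_trivial, h, zero_add, zero_add]

theorem muHat_mem (μ : LieSuperalgebra ℋ) : muHat G μ ∈ altPart (prodGrading 𝒢 ℋ) (1, 0) := by
  rw [← Action.zero_semidirect_toNR (𝒢 := 𝒢) μ]
  exact LieSuperalgebra.toNR_mem _

theorem piHat_add_rhoHat_mem (ρ : Action π μ) :
    piHat H π + rhoHat ρ ∈ altPart (prodGrading 𝒢 ℋ) (1, 0) := by
  rw [← ρ.forget_semidirect_toNR]
  exact LieSuperalgebra.toNR_mem _

variable {i : ℕ × ZMod 2} {x : NR K (G × H)}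

theorem nrBracket_muHat_muHat (μ : LieSuperalgebra ℋ)
    (hx : x ∈ altPart (prodGrading 𝒢 ℋ) i) : nrBracket (prodGrading 𝒢 ℋ) (muHat G μ)
      (nrBracket (prodGrading 𝒢 ℋ) (muHat G μ) x) = 0 := by
  rw [← Action.zero_semidirect_toNR (𝒢 := 𝒢) μ]
  exact LieSuperalgebra.nrBracket_nrBracket _ hx

theorem partialPiRho_partialPiRho (ρ : Action π μ) (hx : x ∈ altPart (prodGrading 𝒢 ℋ) i) :
    partialPiRho ρ (partialPiRho ρ x) = 0 := by
  rw [partialPiRho, ← ρ.forget_semidirect_toNR]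
  exact LieSuperalgebra.nrBracket_nrBracket _ hx

/-- Bracketing twice with `π + ρ + μ` gives zero, and so does bracketing twice with either part;
hence the two mixed terms cancel. -/
theorem partialPiRho_nrBracket_muHat (ρ : Action π μ) (hx : x ∈ altPart (prodGrading 𝒢 ℋ) i) :
    partialPiRho ρ (nrBracket (prodGrading 𝒢 ℋ) (muHat G μ) x) =
      -nrBracket (prodGrading 𝒢 ℋ) (muHat G μ) (partialPiRho ρ x) := by
  have h := ρ.semidirect.nrBracket_nrBracket hx
  have h1 := partialPiRho_partialPiRho ρ hx
  have h2 := nrBracket_muHat_muHat μ hx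
  rw [partialPiRho] at *
  rw [ρ.semidirect_toNR, map_add _ (piHat H π + rhoHat ρ)] at h
  simp only [LinearMap.add_apply, map_add _ _ (nrBracket _ _ x), h1, h2] at h
  rw [zero_add, add_zero] at h
  rw [eq_neg_iff_add_eq_zero, ← h]
  abel

end Semidirect

section Cochains

variable {K : Type*} [Field K] {G : Type*} [AddCommGroup G] [Module K G]
  {H : Type*} [AddCommGroup H] [Module K H]
  {𝒢 : ZMod 2 → Submodule K G} {ℋ : ZMod 2 → Submodule K H}

/-! ### Cochains as functions of lists -/

/-- `Φ` takes values in `H` and vanishes if one of its arguments is in `H`. -/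
structure IsHorizontal (Φ : List (HomVec (prodGrading 𝒢 ℋ)) → G × H) : Prop where
  fst_eq : ∀ L, (Φ L).1 = 0
  eq_zero : ∀ A (u : HomVec (prodGrading 𝒢 ℋ)) B, u.2.1.1 = 0 → Φ (A ++ u :: B) = 0

/-- Skew-symmetry moves the argument from `𝔥` to the front, so only that place has to be checked. -/
theorem eq_zero_of_skew {Φ : List (HomVec (prodGrading 𝒢 ℋ)) → G × H} (hs : IsListSkew Φ)
    (h : ∀ (u : HomVec (prodGrading 𝒢 ℋ)) B, u.2.1.1 = 0 → Φ (u :: B) = 0)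
    (A : List (HomVec (prodGrading 𝒢 ℋ))) (u : HomVec (prodGrading 𝒢 ℋ))
    (B : List (HomVec (prodGrading 𝒢 ℋ))) (hu : u.2.1.1 = 0) : Φ (A ++ u :: B) = 0 := by
  induction A generalizing Φ with
  | nil => exact h u B hu
  | cons y A ih =>
    refine ih (Φ := SuperLie.contract y Φ) (hs.contract y) fun u B hu => ?_
    have := hs [] y u B
    rw [List.nil_append, List.nil_append, h u _ hu, smul_zero] at this
    exact this

variable [DirectSum.Decomposition 𝒢] [DirectSum.Decomposition ℋ]

theorem homVec_fst {v : G × H} (h : v.1 = 0) (c : ZMod 2) :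
    (homVec (𝒱 := prodGrading 𝒢 ℋ) c v).2.1.1 = 0 := by
  rw [homVec, coe_homPart, proj_prodGrading, h, map_zero]

theorem fst_comp {Φ Ψ : List (HomVec (prodGrading 𝒢 ℋ)) → G × H} (h : ∀ L, (Φ L).1 = 0)
    (d : ZMod 2 × ZMod 2) (L : List (HomVec (prodGrading 𝒢 ℋ))) : (comp d Φ Ψ L).1 = 0 := by
  induction L generalizing d Φ Ψ with
  | nil => exact h _
  | cons x L ih =>
    rw [comp, Prod.fst_add, Prod.smul_fst, ih h, ih (Φ := contract x Φ) fun L => h (x :: L),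
      smul_zero, add_zero]

theorem fst_comp_of_right {Φ Ψ : List (HomVec (prodGrading 𝒢 ℋ)) → G × H}
    (h : ∀ A (u : HomVec (prodGrading 𝒢 ℋ)) B, u.2.1.1 = 0 → (Φ (A ++ u :: B)).1 = 0)
    (hΨ : ∀ L, (Ψ L).1 = 0) (d : ZMod 2 × ZMod 2) (L : List (HomVec (prodGrading 𝒢 ℋ))) :
    (comp d Φ Ψ L).1 = 0 := by
  induction L generalizing d Φ Ψ with
  | nil => exact h [] _ [] (homVec_fst (hΨ _) _)
  | cons x L ih =>
    rw [comp, Prod.fst_add, Prod.smul_fst, ih (Ψ := contract x Ψ) h fun L => hΨ (x :: L),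
      ih (Φ := contract x Φ) (fun A => h (x :: A)) hΨ, smul_zero, add_zero]

/-- Every term inserts a value of `Ψ`, which lies in `𝔥`, into `Φ`. Hence horizontal maps commute.
-/
theorem comp_eq_zero_of_horizontal {Φ Ψ : List (HomVec (prodGrading 𝒢 ℋ)) → G × H}
    (h : ∀ A (u : HomVec (prodGrading 𝒢 ℋ)) B, u.2.1.1 = 0 → Φ (A ++ u :: B) = 0)
    (hΨ : ∀ L, (Ψ L).1 = 0) (d : ZMod 2 × ZMod 2) : comp d Φ Ψ = 0 := by
  funext L
  induction L generalizing d Φ Ψ with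
  | nil => exact h [] _ [] (homVec_fst (hΨ _) _)
  | cons x L ih =>
    rw [comp, ih (Ψ := contract x Ψ) h fun L => hΨ (x :: L),
      ih (Φ := contract x Φ) (fun A => h (x :: A)) hΨ]
    simp

theorem IsHorizontal.listBracket_eq_zero {Φ Ψ : List (HomVec (prodGrading 𝒢 ℋ)) → G × H}
    (hΦ : IsHorizontal Φ) (hΨ : IsHorizontal Ψ) (d e : ZMod 2 × ZMod 2) :
    listBracket d e Φ Ψ = 0 := by
  rw [listBracket, comp_eq_zero_of_horizontal hΦ.eq_zero hΨ.fst_eq,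
    comp_eq_zero_of_horizontal hΨ.eq_zero hΦ.fst_eq, smul_zero, sub_zero]

omit [DirectSum.Decomposition 𝒢] [DirectSum.Decomposition ℋ] in
theorem IsHorizontal.contract_eq_zero {Φ : List (HomVec (prodGrading 𝒢 ℋ)) → G × H}
    (hΦ : IsHorizontal Φ) {u : HomVec (prodGrading 𝒢 ℋ)} (hu : u.2.1.1 = 0) :
    SuperLie.contract u Φ = 0 :=
  funext fun L => hΦ.eq_zero [] u L hu

/-- The composition with a map of one variable. -/
theorem comp_of_hasArity_one {V : Type*} [AddCommGroup V] [Module K V]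
    {𝒱 : ZMod 2 → Submodule K V} [DirectSum.Decomposition 𝒱] {Φ : List (HomVec 𝒱) → V}
    (h : HasArity 1 Φ) (d : ZMod 2 × ZMod 2) (Ψ : List (HomVec 𝒱) → V) (L : List (HomVec 𝒱)) :
    comp d Φ Ψ L = Φ [homVec (d.2 + (L.map Sigma.fst).sum) (Ψ L)] := by
  induction L generalizing d Ψ with
  | nil => simp [comp]
  | cons x L ih =>
    rw [comp, ih, comp_eq_zero_of_left fun y L => h (x :: y :: L) (by simp), smul_zero, add_zero,
      List.map_cons, List.sum_cons, Prod.snd_add, add_assoc]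
    rfl

omit [DirectSum.Decomposition 𝒢] [DirectSum.Decomposition ℋ] in
theorem hat_apply {n : ℕ} (f : Multi K n G H) (X : Fin n → G × H) :
    hat f X = (0, f fun i => (X i).1) := rfl

theorem hat_mem {n : ℕ} {α : ZMod 2} {f : Multi K n G H}
    (hf : f ∈ superAlternating 𝒢 n H ⊓ homogeneous 𝒢 ℋ n α) :
    hat f ∈ superAlternating (prodGrading 𝒢 ℋ) n (G × H) ⊓
      homogeneous (prodGrading 𝒢 ℋ) (prodGrading 𝒢 ℋ) n α := by
  refine ⟨mem_superAlternating_iff.2 fun σ X => ?_, fun a X hX => ?_⟩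
  · have := mem_superAlternating_iff.1 hf.1 σ fun i => ⟨(X i).1, (X i).2.1.1, (X i).2.2.1⟩
    rw [hat_apply, hat_apply, Prod.smul_mk, smul_zero]
    exact congrArg (Prod.mk 0) this
  · exact ⟨Submodule.zero_mem _, hf.2 a _ fun i => (hX i).1⟩

theorem mem_of_hat_mem {n : ℕ} {α : ZMod 2} {f : Multi K n G H}
    (hf : hat f ∈ superAlternating (prodGrading 𝒢 ℋ) n (G × H) ⊓
      homogeneous (prodGrading 𝒢 ℋ) (prodGrading 𝒢 ℋ) n α) :
    f ∈ superAlternating 𝒢 n H ⊓ homogeneous 𝒢 ℋ n α := by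
  refine ⟨mem_superAlternating_iff.2 fun σ X => ?_, fun a X hX => ?_⟩
  · have := mem_superAlternating_iff.1 hf.1 σ fun i =>
      ⟨(X i).1, ((X i).2.1, 0), (X i).2.2, Submodule.zero_mem _⟩
    exact congrArg Prod.snd this
  · exact (hf.2 a (fun i => (X i, 0)) fun i => ⟨hX i, Submodule.zero_mem _⟩).2

theorem gradedCochains_le_altPart (p : ℕ) (α : ZMod 2) :
    gradedCochains 𝒢 ℋ (p + 1, α) ≤ altPart (prodGrading 𝒢 ℋ) (p, α) := by
  rintro _ ⟨f, hf, rfl⟩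
  exact ⟨hat f, hat_mem hf, rfl⟩

omit [DirectSum.Decomposition ℋ] in
theorem isHorizontal_of_mem {p : ℕ} {α : ZMod 2} {x : NR K (G × H)}
    (hx : x ∈ gradedCochains 𝒢 ℋ (p + 1, α)) :
    IsHorizontal (listEval (prodGrading 𝒢 ℋ) x) := by
  obtain ⟨f, -, rfl⟩ := hx
  have ha := hasArity_listEval (𝒱 := prodGrading 𝒢 ℋ) (hat f)
  constructor
  · intro L
    by_cases h : L.length = p + 1
    · obtain ⟨X, rfl⟩ := exists_ofFn_eq h
      rw [LinearMap.comp_apply, listEval_ofMulti_ofFn]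
      rfl
    · rw [LinearMap.comp_apply, ha L h]
      rfl
  · intro A u B hu
    by_cases h : (A ++ u :: B).length = p + 1
    · obtain ⟨X, hX⟩ := exists_ofFn_eq h
      have hA : A.length < p + 1 := by simp at h; omega
      have hu' : X ⟨A.length, hA⟩ = u := by
        have h1 : (A ++ u :: B)[A.length]? = some u := by simp
        rw [hX, List.getElem?_ofFn, dif_pos hA] at h1
        exact Option.some_injective _ h1
      rw [LinearMap.comp_apply, hX, listEval_ofMulti_ofFn, hat_apply,
        f.map_coord_zero ⟨A.length, hA⟩ (by rw [hu', hu])]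
      rfl
    · rw [LinearMap.comp_apply, ha _ h]

/-- Splitting each argument into its `𝔤`- and `𝔥`-components, multilinearity leaves only the term
with all components in `𝔤`, so the map is determined by its restriction to `𝔤`. -/
theorem mem_gradedCochains {p : ℕ} {α : ZMod 2} {x : NR K (G × H)}
    (hx : x ∈ altPart (prodGrading 𝒢 ℋ) (p, α))
    (hh : IsHorizontal (listEval (prodGrading 𝒢 ℋ) x)) : x ∈ gradedCochains 𝒢 ℋ (p + 1, α) := by
  obtain ⟨F, hF, rfl⟩ := hx
  dsimp only at F hF hh
  let f : Multi K (p + 1) G H :=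
    (LinearMap.snd K G H).compMultilinearMap (F.compLinearMap fun _ => LinearMap.inl K G H)
  have hf : hat f = F := by
    refine multi_ext (𝒱 := prodGrading 𝒢 ℋ) fun X => ?_
    classical
    have h1 : ∀ s : Finset (Fin (p + 1)), s ≠ Finset.univ →
        F (s.piecewise (fun i => ((X i).2.1.1, 0)) fun i => (0, (X i).2.1.2)) = 0 := by
      intro s hs
      obtain ⟨k, hk⟩ : ∃ k, k ∉ s := by
        by_contra! h
        exact hs (Finset.eq_univ_iff_forall.2 h)
      -- The components keep the degree of the vector, so the mixed arguments again form a list of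
      -- homogeneous vectors.
      let Y : Fin (p + 1) → HomVec (prodGrading 𝒢 ℋ) := fun i =>
        if i ∈ s then ⟨(X i).1, ((X i).2.1.1, 0), (X i).2.2.1, Submodule.zero_mem _⟩
        else ⟨(X i).1, (0, (X i).2.1.2), Submodule.zero_mem _, (X i).2.2.2⟩
      have hY : (s.piecewise (fun i => ((X i).2.1.1, 0)) fun i => (0, (X i).2.1.2)) =
          fun i => (Y i).2.1 := by
        funext i
        by_cases hi : i ∈ s
        · rw [Finset.piecewise_eq_of_mem _ _ _ hi, show Y i = _ from if_pos hi]
        · rw [Finset.piecewise_eq_of_notMem _ _ _ hi, show Y i = _ from if_neg hi]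
      have hk' : (Y k).2.1.1 = 0 := by rw [show Y k = _ from if_neg hk]
      rw [hY, ← listEval_ofMulti_ofFn]
      have hl : k.val < (List.ofFn Y).length := by
        rw [List.length_ofFn]
        exact k.2
      have := hh.eq_zero ((List.ofFn Y).take k) (Y k) ((List.ofFn Y).drop (k + 1)) hk'
      rw [← this]
      conv_lhs => rw [← List.take_append_drop k.val (List.ofFn Y), List.drop_eq_getElem_cons hl,
        List.getElem_ofFn]
    have h2 := F.map_add_univ (fun i => ((X i).2.1.1, 0)) fun i => (0, (X i).2.1.2)
    rw [Finset.sum_eq_single Finset.univ (fun s _ hs => h1 s hs) (by simp),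
      Finset.piecewise_univ] at h2
    have h3 : ((fun i => ((X i).2.1.1, 0)) + fun i => (0, (X i).2.1.2)) =
        fun i => ((X i).2.1 : G × H) := by
      funext i
      simp
    rw [h3] at h2
    have h4 := hh.fst_eq (List.ofFn X)
    rw [listEval_ofMulti_ofFn] at h4
    refine Prod.ext h4.symm ?_
    rw [h2]
    rfl
  rw [← hf] at hF ⊢
  exact ⟨f, mem_of_hat_mem hF, rfl⟩

theorem listEval_nrBracket_cons {V : Type*} [AddCommGroup V] [Module K V]
    {𝒱 : ZMod 2 → Submodule K V} [DirectSum.Decomposition 𝒱] {i j : ℕ × ZMod 2} {x y : NR K V}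
    (hx : x ∈ altPart 𝒱 i) (hy : y ∈ altPart 𝒱 j) (u : HomVec 𝒱) (B : List (HomVec 𝒱)) :
    listEval 𝒱 (nrBracket 𝒱 x y) (u :: B) = ssign (i.1 * j.1 : ℕ) •
      (listBracket (degMod i) (degMod j + vecDeg u) (listEval 𝒱 x)
        (contract u (listEval 𝒱 y)) B + dsign (degMod j) (vecDeg u) •
        listBracket (degMod i + vecDeg u) (degMod j) (contract u (listEval 𝒱 x))
          (listEval 𝒱 y) B) := by
  rw [listEval_nrBracket hx hy, Pi.smul_apply]
  exact congrArg _ (congrFun (contract_listBracket u _ _ _ _) B)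

theorem comp_zero_left {V : Type*} [AddCommGroup V] [Module K V]
    {𝒱 : ZMod 2 → Submodule K V} [DirectSum.Decomposition 𝒱] (d : ZMod 2 × ZMod 2)
    (Ψ : List (HomVec 𝒱) → V) : comp d 0 Ψ = 0 :=
  funext fun _ => comp_eq_zero_of_left (fun _ _ => rfl) _ _

theorem listBracket_zero_right {V : Type*} [AddCommGroup V] [Module K V]
    {𝒱 : ZMod 2 → Submodule K V} [DirectSum.Decomposition 𝒱] (d e : ZMod 2 × ZMod 2)
    {Φ : List (HomVec 𝒱) → V} (hΦ : IsListLinear Φ) : listBracket d e Φ 0 = 0 := by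
  rw [listBracket, comp_zero_right hΦ, comp_zero_left, smul_zero, sub_zero]

theorem nrBracket_eq_zero {p q : ℕ} {α β : ZMod 2} {x y : NR K (G × H)}
    (hx : x ∈ gradedCochains 𝒢 ℋ (p + 1, α)) (hy : y ∈ gradedCochains 𝒢 ℋ (q + 1, β)) :
    nrBracket (prodGrading 𝒢 ℋ) x y = 0 := by
  apply listEval_injective (𝒱 := prodGrading 𝒢 ℋ)
  rw [listEval_nrBracket (gradedCochains_le_altPart p α hx) (gradedCochains_le_altPart q β hy),
    (isHorizontal_of_mem hx).listBracket_eq_zero (isHorizontal_of_mem hy), smul_zero, map_zero]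

/-! ### Closure of the cochains under the differential and the derived bracket -/

variable {π : LieSuperalgebra 𝒢} {μ : LieSuperalgebra ℋ}

omit [DirectSum.Decomposition 𝒢] [DirectSum.Decomposition ℋ] in
theorem fst_listEval_muHat (μ : LieSuperalgebra ℋ) (L : List (HomVec (prodGrading 𝒢 ℋ))) :
    (listEval (prodGrading 𝒢 ℋ) (muHat G μ) L).1 = 0 := by
  by_cases h : L.length = 2
  · obtain ⟨x, y, rfl⟩ := List.length_eq_two.1 h
    rw [listEval_muHat]
  · rw [muHat, hasArity_listEval _ L h]
    rfl

theorem hasArity_piHat_add_rhoHat (ρ : Action π μ) :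
    HasArity 2 (listEval (prodGrading 𝒢 ℋ) (piHat H π + rhoHat ρ)) := by
  rw [piHat, rhoHat, ← map_add]
  exact hasArity_listEval _

/-- With one argument in `𝔥` the term `π` disappears, and `ρ` takes values in `𝔥` and needs its
other argument from `𝔤`. -/
theorem isHorizontal_contract_piHat_add_rhoHat (ρ : Action π μ)
    {u : HomVec (prodGrading 𝒢 ℋ)} (hu : u.2.1.1 = 0) :
    IsHorizontal (contract u (listEval (prodGrading 𝒢 ℋ) (piHat H π + rhoHat ρ))) := by
  have ha := hasArity_piHat_add_rhoHat (ℋ := ℋ) ρ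
  constructor
  · intro L
    by_cases h : L.length = 1
    · obtain ⟨y, rfl⟩ := List.length_eq_one_iff.1 h
      rw [contract, map_add, Pi.add_apply, listEval_piHat, listEval_rhoHat, hu]
      simp
    · rw [contract, ha _ (by simpa using h)]
      rfl
  · intro A v B hv
    by_cases h : A.length = 0 ∧ B.length = 0
    · obtain ⟨h1, h2⟩ := h
      rw [List.length_eq_zero_iff] at h1 h2
      subst h1 h2
      rw [List.nil_append, contract, map_add, Pi.add_apply, listEval_piHat, listEval_rhoHat, hu, hv]
      simp
    · exact ha _ (by simp; omega)

theorem fst_piHat_add_rhoHat (ρ : Action π μ) (A : List (HomVec (prodGrading 𝒢 ℋ)))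
    (u : HomVec (prodGrading 𝒢 ℋ)) (B : List (HomVec (prodGrading 𝒢 ℋ))) (hu : u.2.1.1 = 0) :
    (listEval (prodGrading 𝒢 ℋ) (piHat H π + rhoHat ρ) (A ++ u :: B)).1 = 0 := by
  by_cases h : (A ++ u :: B).length = 2
  · obtain ⟨x, y, hxy⟩ := List.length_eq_two.1 h
    have hm : u ∈ [x, y] := hxy ▸ (by simp)
    have h0 : x.2.1.1 = 0 ∨ y.2.1.1 = 0 := by
      rcases List.mem_pair.1 hm with rfl | rfl
      · exact Or.inl hu
      · exact Or.inr hu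
    rw [hxy, map_add, Pi.add_apply, listEval_piHat, listEval_rhoHat]
    rcases h0 with h0 | h0 <;> simp [h0]
  · rw [hasArity_piHat_add_rhoHat ρ _ h]
    rfl

/-- Contracting `[π + ρ, x]` with `u ∈ 𝔥` leaves, up to sign, only the bracket of `x` with the
contraction of `π + ρ`, since `x` itself contracts to zero; both entries are horizontal, so they
commute. -/
theorem partialPiRho_mem (ρ : Action π μ) {p : ℕ} {α : ZMod 2} {x : NR K (G × H)}
    (hx : x ∈ gradedCochains 𝒢 ℋ (p + 1, α)) :
    partialPiRho ρ x ∈ gradedCochains 𝒢 ℋ (p + 1 + 1, α) := by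
  have hx1 := gradedCochains_le_altPart p α hx
  have hx2 := isHorizontal_of_mem hx
  have hP := piHat_add_rhoHat_mem ρ
  have hm := nrBracket_mem hP hx1
  have hc := (isListCochain_listEval hm).skew
  rw [show ((1, 0) : ℕ × ZMod 2) + (p, α) = (p + 1, α) by simp [add_comm]] at hm
  refine mem_gradedCochains hm ⟨fun L => ?_, eq_zero_of_skew hc fun u B hu => ?_⟩
  · rw [partialPiRho, listEval_nrBracket hP hx1, listBracket, Pi.smul_apply, Pi.sub_apply, Pi.smul_apply,
      Prod.smul_fst, Prod.fst_sub, Prod.smul_fst, fst_comp hx2.fst_eq,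
      fst_comp_of_right (fst_piHat_add_rhoHat ρ) hx2.fst_eq]
    simp
  · refine (listEval_nrBracket_cons hP hx1 u B).trans ?_
    rw [hx2.contract_eq_zero hu,
      (isHorizontal_contract_piHat_add_rhoHat ρ hu).listBracket_eq_zero hx2,
      listBracket_zero_right _ _ (isListLinear_listEval _)]
    simp

/-- Although `[μ, x]` is not horizontal in general, its contraction with any `u ∈ 𝔥` is: that is, up
to sign, the bracket of `x` with the unary map `μ(u, ·)`, which has values in `𝔥`. So it commutes
with `y`. -/
theorem nrBracket_muHat_mem (μ : LieSuperalgebra ℋ) {p q : ℕ} {α β : ZMod 2}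
    {x y : NR K (G × H)} (hx : x ∈ gradedCochains 𝒢 ℋ (p + 1, α))
    (hy : y ∈ gradedCochains 𝒢 ℋ (q + 1, β)) :
    nrBracket (prodGrading 𝒢 ℋ) (nrBracket (prodGrading 𝒢 ℋ) (muHat G μ) x) y ∈
      gradedCochains 𝒢 ℋ (p + 1 + (q + 1), α + β) := by
  have hx1 := gradedCochains_le_altPart p α hx
  have hy1 := gradedCochains_le_altPart q β hy
  have hx2 := isHorizontal_of_mem hx
  have hy2 := isHorizontal_of_mem hy
  have hμ := muHat_mem (𝒢 := 𝒢) μ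
  have hX := nrBracket_mem hμ hx1
  have hm := nrBracket_mem hX hy1
  have hc := (isListCochain_listEval hm).skew
  rw [show ((1, 0) : ℕ × ZMod 2) + (p, α) + (q, β) = (p + 1 + q, α + β) by
    simp [add_comm]] at hm
  have hX1 (L) : (listEval (prodGrading 𝒢 ℋ)
      (nrBracket (prodGrading 𝒢 ℋ) (muHat G μ) x) L).1 = 0 := by
    rw [listEval_nrBracket hμ hx1, listBracket, Pi.smul_apply, Pi.sub_apply, Pi.smul_apply,
      Prod.smul_fst, Prod.fst_sub, Prod.smul_fst, fst_comp hx2.fst_eq,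
      fst_comp (fst_listEval_muHat μ)]
    simp
  refine mem_gradedCochains hm ⟨fun L => ?_, eq_zero_of_skew hc fun u B hu => ?_⟩
  · rw [listEval_nrBracket hX hy1, listBracket, Pi.smul_apply, Pi.sub_apply, Pi.smul_apply,
      Prod.smul_fst, Prod.fst_sub, Prod.smul_fst, fst_comp hy2.fst_eq, fst_comp hX1]
    simp
  · have hu' : IsHorizontal (contract u (listEval (prodGrading 𝒢 ℋ)
        (nrBracket (prodGrading 𝒢 ℋ) (muHat G μ) x))) := by
      refine ⟨fun L => hX1 _, fun A v B hv => ?_⟩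
      have hN : HasArity 1 (contract u (listEval (prodGrading 𝒢 ℋ) (muHat G μ))) :=
        (hasArity_listEval _ : HasArity 2 _).contract u
      have hNl : IsListLinear (contract u (listEval (prodGrading 𝒢 ℋ) (muHat G μ))) :=
        (isListLinear_listEval _).contract u
      have hNf (L) : (contract u (listEval (prodGrading 𝒢 ℋ) (muHat G μ)) L).1 = 0 :=
        fst_listEval_muHat μ (u :: L)
      refine (listEval_nrBracket_cons hμ hx1 u _).trans ?_
      rw [hx2.contract_eq_zero hu, listBracket_zero_right _ _ (isListLinear_listEval _),
        Pi.zero_apply, zero_add, listBracket, Pi.sub_apply, comp_of_hasArity_one hN,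
        hx2.eq_zero A v B hv, hNl.homVec_zero₀,
        comp_eq_zero_of_horizontal hx2.eq_zero hNf]
      simp
    refine (listEval_nrBracket_cons hX hy1 u B).trans ?_
    rw [hy2.contract_eq_zero hu, hu'.listBracket_eq_zero hy2,
      listBracket_zero_right _ _ (isListLinear_listEval _)]
    simp

end Cochains

section Crossed

variable {K : Type*} [Field K] {G : Type*} [AddCommGroup G] [Module K G]
  {H : Type*} [AddCommGroup H] [Module K H]
  {𝒢 : ZMod 2 → Submodule K G} {ℋ : ZMod 2 → Submodule K H}
  {π : LieSuperalgebra 𝒢} {μ : LieSuperalgebra ℋ}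

/-! ### The action twisted by a crossed homomorphism -/

/-- The action `x ↦ ρ(x) + [D(x), ·]`. -/
def Action.twistBy (ρ : Action π μ) {D : G →ₗ[K] H} (hD : IsCrossedHom ρ D) : Action π μ where
  toLin := ρ.toLin + μ.bracket ∘ₗ D
  isDerivation a x hx :=
    ⟨fun b v hv => Submodule.add_mem _ ((ρ.isDerivation a x hx).map_mem _ _ hv)
      (μ.bracket_mem _ _ _ (hD.map_mem _ _ hx) _ hv), fun b u hu v => by
      have h1 := (ρ.isDerivation a x hx).leibniz _ _ hu v
      have h2 := μ.jacobi _ _ _ (hD.map_mem _ _ hx) _ hu v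
      simp only [LinearMap.add_apply, LinearMap.comp_apply, h1, h2, map_add, smul_add]
      abel⟩
  map_bracket a b x hx y hy := by
    ext w
    -- In the commutator of the twisted operators, derivations and the Jacobi identity produce
    -- brackets with `ρ(x)D(y)`, `ρ(y)D(x)` and `[D(x), D(y)]`; the crossed homomorphism identity
    -- adds them up to the bracket with `D([x, y])`.
    have h1 := (ρ.isDerivation a x hx).leibniz _ _ (hD.map_mem _ _ hy) w
    have h2 := (ρ.isDerivation b y hy).leibniz _ _ (hD.map_mem _ _ hx) w
    have h3 := μ.jacobi _ _ _ (hD.map_mem _ _ hx) _ (hD.map_mem _ _ hy) w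
    simp only [LinearMap.add_apply, LinearMap.comp_apply, LinearMap.sub_apply,
      LinearMap.smul_apply, ρ.map_bracket _ _ _ hx _ hy, hD.map_bracket _ _ _ hx _ hy, map_add,
      map_sub, map_zsmul, h1, h2, h3, mul_comm b a, smul_add, smul_smul, ssign_mul_self]
    module

variable [DirectSum.Decomposition 𝒢] [DirectSum.Decomposition ℋ]

omit [DirectSum.Decomposition ℋ] in
theorem ofLinear_mem {D : G →ₗ[K] H} (hD : ∀ a, ∀ x ∈ 𝒢 a, D x ∈ ℋ a) :
    ofLinear D ∈ gradedCochains 𝒢 ℋ (0 + 1, 0) := by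
  refine ⟨MultilinearMap.ofSubsingleton K G H (0 : Fin 1) D,
    ⟨mem_superAlternating_iff.2 fun σ X => ?_, fun a X hX => ?_⟩, rfl⟩
  · rw [show σ = 1 from Equiv.ext fun _ => Subsingleton.elim (α := Fin 1) _ _, koszulSign_one, one_smul]
    rfl
  · simpa using hD _ _ (hX 0)

omit [DirectSum.Decomposition 𝒢] [DirectSum.Decomposition ℋ] in
theorem listEval_ofLinear (D : G →ₗ[K] H) (x : HomVec (prodGrading 𝒢 ℋ)) :
    listEval (prodGrading 𝒢 ℋ) (ofLinear D) [x] = (0, D x.2.1.1) := by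
  have : [x] = List.ofFn ![x] := by simp
  rw [this, ofLinear, listEval_ofMulti_ofFn]
  rfl

/-- The composition `D ∘ μ` is zero because `D` vanishes on `𝔥`, and `μ ∘ D` is the skew extension
of `(x, v) ↦ [D(x), v]`. -/
theorem rhoHat_twistBy (ρ : Action π μ) {D : G →ₗ[K] H} (hD : IsCrossedHom ρ D) :
    rhoHat (ρ.twistBy hD) =
      rhoHat ρ + nrBracket (prodGrading 𝒢 ℋ) (muHat G μ) (ofLinear D) := by
  apply listEval_injective (𝒱 := prodGrading 𝒢 ℋ)
  have hm := ofLinear_mem (𝒢 := 𝒢) (ℋ := ℋ) hD.map_mem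
  have hD' := gradedCochains_le_altPart 0 0 hm
  have hh := isHorizontal_of_mem hm
  have hμ := muHat_mem (𝒢 := 𝒢) μ
  have haD : HasArity 1 (listEval (prodGrading 𝒢 ℋ) (ofLinear D)) := hasArity_listEval _
  have haμ : HasArity 2 (listEval (prodGrading 𝒢 ℋ) (muHat G μ)) := hasArity_listEval _
  have hlμ := isListLinear_listEval (𝒱 := prodGrading 𝒢 ℋ) (muHat G μ)
  funext L
  rw [map_add, Pi.add_apply, listEval_nrBracket hμ hD', listBracket,
    comp_eq_zero_of_horizontal hh.eq_zero (fst_listEval_muHat μ), smul_zero, sub_zero,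
    Pi.smul_apply]
  by_cases h : L.length = 2
  · obtain ⟨x, y, rfl⟩ := List.length_eq_two.1 h
    have h0 : listEval (prodGrading 𝒢 ℋ) (ofLinear D) [] = 0 := rfl
    have h2 : listEval (prodGrading 𝒢 ℋ) (ofLinear D) [x, y] = 0 := haD _ (by simp)
    have h3 (x y z) : listEval (prodGrading 𝒢 ℋ) (muHat G μ) [x, y, z] = 0 := haμ _ (by simp)
    have h1 (z) : listEval (prodGrading 𝒢 ℋ) (muHat G μ) [z] = 0 := haμ _ (by simp)
    have hb (z : HomVec (prodGrading 𝒢 ℋ)) :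
        (homVec (𝒱 := prodGrading 𝒢 ℋ) z.1 (0, D z.2.1.1)).2.1.2 = D z.2.1.1 := by
      rw [homVec, coe_homPart, proj_prodGrading, proj_of_mem ℋ (hD.map_mem _ _ z.2.2.1), if_pos rfl]
    have e0 : degMod (0, 0) = 0 := by simp [degMod]
    have es (a b : ZMod 2) : ssign (1 + a * b) = -ssign (a * b) := by
      revert a b; decide
    have hs := μ.skew _ _ _ (hD.map_mem _ _ y.2.2.1) _ x.2.2.2
    have hs' := μ.skew _ _ _ (hD.map_mem _ _ x.2.2.1) _ y.2.2.2
    have hv (x : HomVec (prodGrading 𝒢 ℋ)) : (vecDeg x).2 = x.1 := rfl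
    rw [listEval_rhoHat, listEval_rhoHat, e0]
    simp only [comp, contract, h1, h2, h3, smul_zero, zero_add, add_zero, listEval_muHat,
      listEval_ofLinear, hv, hb, Action.twistBy, LinearMap.add_apply, LinearMap.comp_apply, hs]
    simp [dsign, vecDeg, ssign_zero, mul_comm y.1]
    rw [hs', es, smul_smul, ssign_mul_self]
    module
  · rw [rhoHat, hasArity_listEval _ L h, rhoHat, hasArity_listEval _ L h,
      haμ.comp (p := 1) haD hlμ L h, smul_zero, add_zero]

omit [DirectSum.Decomposition 𝒢] [DirectSum.Decomposition ℋ] in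
theorem aritySign_of_mem [DirectSum.Decomposition 𝒢] {p : ℕ} {α : ZMod 2} {x : NR K (G × H)}
    (hx : x ∈ gradedCochains 𝒢 ℋ (p + 1, α)) : aritySign (G × H) x = ((-1 : ℤ) ^ p) • x := by
  obtain ⟨f, -, rfl⟩ := hx
  rw [aritySign, LinearMap.comp_apply, DirectSum.toModule_lof, LinearMap.smul_apply]

theorem derivedBracket_of_mem {p : ℕ} {α : ZMod 2} {x : NR K (G × H)}
    (hx : x ∈ gradedCochains 𝒢 ℋ (p + 1, α)) (y : NR K (G × H)) :
    derivedBracket 𝒢 μ x y = ((-1 : ℤ) ^ p) •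
      nrBracket (prodGrading 𝒢 ℋ) (nrBracket (prodGrading 𝒢 ℋ) (muHat G μ) x) y := by
  rw [derivedBracket, LinearMap.comp_apply, LinearMap.comp_apply, aritySign_of_mem hx, map_zsmul,
    map_zsmul, LinearMap.smul_apply]

theorem dCrossed_eq_partialPiRho (ρ : Action π μ) {D : G →ₗ[K] H} (hD : IsCrossedHom ρ D) :
    dCrossed ρ D = partialPiRho (ρ.twistBy hD) := by
  refine LinearMap.ext fun x => ?_
  rw [dCrossed, LinearMap.add_apply, derivedBracket_of_mem (ofLinear_mem hD.map_mem), pow_zero,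
    one_smul, partialPiRho, partialPiRho, rhoHat_twistBy, ← add_assoc, map_add _ (_ + _),
    LinearMap.add_apply]

/-! ### The differential graded Lie algebra of cochains -/

variable {i j k : ℕ × ZMod 2} {x y z : NR K (G × H)}

omit [DirectSum.Decomposition ℋ] in
/-- A cochain is zero or has positive arity. -/
theorem eq_zero_or_exists (hx : x ∈ gradedCochains 𝒢 ℋ i) :
    x = 0 ∨ ∃ p α, i = (p + 1, α) := by
  obtain ⟨_ | p, α⟩ := i
  · exact Or.inl hx
  · exact Or.inr ⟨p, α, rfl⟩

theorem derivedBracket_mem (hx : x ∈ gradedCochains 𝒢 ℋ i) (hy : y ∈ gradedCochains 𝒢 ℋ j) :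
    derivedBracket 𝒢 μ x y ∈ gradedCochains 𝒢 ℋ (i + j) := by
  rcases eq_zero_or_exists hx with rfl | ⟨p, α, rfl⟩
  · rw [map_zero, LinearMap.zero_apply]
    exact Submodule.zero_mem _
  rcases eq_zero_or_exists hy with rfl | ⟨q, β, rfl⟩
  · rw [map_zero]
    exact Submodule.zero_mem _
  rw [derivedBracket_of_mem hx]
  exact Submodule.smul_of_tower_mem _ _ (nrBracket_muHat_mem μ hx hy)

/-- Applying `[μ, ·]` to `[x, y] = 0` relates `[[μ, x], y]` and `[x, [μ, y]]`. -/
theorem derivedBracket_skew (hx : x ∈ gradedCochains 𝒢 ℋ i) (hy : y ∈ gradedCochains 𝒢 ℋ j) :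
    derivedBracket 𝒢 μ x y = -(commSign i j • derivedBracket 𝒢 μ y x) := by
  rcases eq_zero_or_exists hx with rfl | ⟨p, α, rfl⟩
  · simp
  rcases eq_zero_or_exists hy with rfl | ⟨q, β, rfl⟩
  · simp
  have hx1 := gradedCochains_le_altPart p α hx
  have hy1 := gradedCochains_le_altPart q β hy
  have hμ := muHat_mem (𝒢 := 𝒢) μ
  have h1 := nrBracket_jacobi hμ hx1 hy1
  rw [nrBracket_eq_zero hx hy, map_zero, nrBracket_skew hx1 (nrBracket_mem hμ hy1)] at h1
  rw [derivedBracket_of_mem hx, derivedBracket_of_mem hy, eq_neg_of_add_eq_zero_left h1.symm]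
  simp only [smul_neg, neg_neg, smul_smul]
  rw [← neg_smul]
  congr 1
  simp only [commSign, Prod.fst_add, Prod.snd_add, zero_mul, ssign_zero, zero_add, one_mul, mul_one]
  have e : p * (1 + q) = p + p * q := by ring
  have e' : (p + 1) * (q + 1) = p + p * q + q + 1 := by ring
  rw [e, e', pow_add, pow_add, pow_add, pow_add]
  rcases neg_one_pow_eq_or ℤ p with h1 | h1 <;>
  rcases neg_one_pow_eq_or ℤ q with h2 | h2 <;>
  simp [h1, h2]

/-- As `[μ, [μ, x]] = 0`, the map `[μ, ·]` takes `[[μ, x], y]` to `±[[μ, x], [μ, y]]`; the claim is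
then the Jacobi identity for `[μ, x]`, `[μ, y]`, `z`. -/
theorem derivedBracket_jacobi (hx : x ∈ gradedCochains 𝒢 ℋ i) (hy : y ∈ gradedCochains 𝒢 ℋ j)
    (hz : z ∈ gradedCochains 𝒢 ℋ k) :
    derivedBracket 𝒢 μ x (derivedBracket 𝒢 μ y z) =
      derivedBracket 𝒢 μ (derivedBracket 𝒢 μ x y) z +
        commSign i j • derivedBracket 𝒢 μ y (derivedBracket 𝒢 μ x z) := by
  have hxy := derivedBracket_mem (μ := μ) hx hy
  rcases eq_zero_or_exists hx with rfl | ⟨p, α, rfl⟩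
  · simp
  rcases eq_zero_or_exists hy with rfl | ⟨q, β, rfl⟩
  · simp
  rcases eq_zero_or_exists hz with rfl | ⟨r, γ, rfl⟩
  · simp
  have hx1 := gradedCochains_le_altPart p α hx
  have hy1 := gradedCochains_le_altPart q β hy
  have hz1 := gradedCochains_le_altPart r γ hz
  have hμ := muHat_mem (𝒢 := 𝒢) μ
  have h1 := nrBracket_jacobi hμ (nrBracket_mem hμ hx1) hy1
  rw [nrBracket_muHat_muHat μ hx1, map_zero, LinearMap.zero_apply, zero_add] at h1
  have h2 := nrBracket_jacobi (nrBracket_mem hμ hx1) (nrBracket_mem hμ hy1) hz1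
  have e : ((p + 1, α) : ℕ × ZMod 2) + (q + 1, β) = (p + q + 1 + 1, α + β) := by
    ext
    · simp; ring
    · rfl
  rw [e] at hxy
  rw [derivedBracket_of_mem hxy]
  simp only [derivedBracket_of_mem hx, derivedBracket_of_mem hy, map_zsmul, LinearMap.smul_apply,
    h1, h2, smul_add, smul_smul]
  congr 2
  · simp only [commSign, Prod.fst_add, Prod.snd_add, zero_mul, ssign_zero, one_mul, mul_one]
    rw [pow_add, pow_add, pow_add]
    rcases neg_one_pow_eq_or ℤ p with h1 | h1 <;>
    rcases neg_one_pow_eq_or ℤ q with h2 | h2 <;>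
    simp [h1, h2]
  · simp only [commSign, Prod.fst_add, Prod.snd_add, zero_add, add_comm 1]
    ring

/-- The Jacobi identity for `π + ρ`, `[μ, x]`, `y`; the minus sign from anticommuting with `μ` is
compensated by the arity sign, as `∂x` has one more argument than `x`. -/
theorem partialPiRho_derivedBracket (ρ : Action π μ) (hx : x ∈ gradedCochains 𝒢 ℋ i)
    (hy : y ∈ gradedCochains 𝒢 ℋ j) :
    partialPiRho ρ (derivedBracket 𝒢 μ x y) = derivedBracket 𝒢 μ (partialPiRho ρ x) y +
      commSign (1, 0) i • derivedBracket 𝒢 μ x (partialPiRho ρ y) := by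
  rcases eq_zero_or_exists hx with rfl | ⟨p, α, rfl⟩
  · simp
  rcases eq_zero_or_exists hy with rfl | ⟨q, β, rfl⟩
  · simp
  have hx1 := gradedCochains_le_altPart p α hx
  have hy1 := gradedCochains_le_altPart q β hy
  have hμ := muHat_mem (𝒢 := 𝒢) μ
  have h1 := nrBracket_jacobi (piHat_add_rhoHat_mem ρ) (nrBracket_mem hμ hx1) hy1
  have h2 := partialPiRho_nrBracket_muHat ρ hx1
  rw [derivedBracket_of_mem hx, derivedBracket_of_mem hx,
    derivedBracket_of_mem (partialPiRho_mem ρ hx)]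
  rw [partialPiRho] at *
  rw [map_zsmul, h1, h2, map_neg, LinearMap.neg_apply, smul_add, smul_smul, smul_smul, smul_neg,
    ← neg_smul]
  congr 2
  · ring
  · simp only [commSign, Prod.fst_add, Prod.snd_add, zero_mul, ssign_zero, one_mul, mul_one]
    ring

theorem partialPiRho_mem_gradedCochains (ρ : Action π μ) (hx : x ∈ gradedCochains 𝒢 ℋ i) :
    partialPiRho ρ x ∈ gradedCochains 𝒢 ℋ (i + (1, 0)) := by
  rcases eq_zero_or_exists hx with rfl | ⟨p, α, rfl⟩
  · rw [map_zero]
    exact Submodule.zero_mem _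
  · rw [show ((p + 1, α) : ℕ × ZMod 2) + (1, 0) = (p + 1 + 1, α) by simp]
    exact partialPiRho_mem ρ hx

theorem partialPiRho_sq (ρ : Action π μ) (hx : x ∈ gradedCochains 𝒢 ℋ i) :
    partialPiRho ρ (partialPiRho ρ x) = 0 := by
  rcases eq_zero_or_exists hx with rfl | ⟨p, α, rfl⟩
  · rw [map_zero, map_zero]
  · exact partialPiRho_partialPiRho ρ (gradedCochains_le_altPart p α hx)

/-! ### The grading of the space of cochains -/

/-- Permuting arguments does not change their total degree, so taking a homogeneous component
commutes with permutations. -/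
theorem degPart_mem {n : ℕ} {f : Multi K n G H} (hf : f ∈ superAlternating 𝒢 n H) (b : ZMod 2) :
    degPart 𝒢 ℋ b f ∈ superAlternating 𝒢 n H ⊓ homogeneous 𝒢 ℋ n b := by
  refine ⟨mem_superAlternating_iff.2 fun σ X => ?_, mem_homogeneous_iff.2 fun X => ?_⟩
  · have h := degPart_apply_homVec (𝒲 := ℋ) b f fun i => X (σ i)
    rw [h, degPart_apply_homVec, Equiv.sum_comp σ fun i => (X i).1, ← map_zsmul]
    exact congrArg _ (mem_superAlternating_iff.1 hf σ X)
  · rw [degPart_apply_homVec]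
    exact proj_mem _ _ _

theorem sum_degPart {n : ℕ} (f : Multi K n G H) : ∑ b, degPart 𝒢 ℋ b f = f := by
  refine multi_ext (𝒱 := 𝒢) fun X => ?_
  rw [sum_apply]
  simp only [degPart_apply_homVec]
  exact (Equiv.sum_comp (Equiv.addRight (∑ i, (X i).1))
    fun b => proj ℋ b (f fun i => (X i).2)).trans (sum_proj ℋ _)

theorem cochains_eq_iSup (n : ℕ) :
    cochains 𝒢 (H := H) n = ⨆ α, gradedCochains 𝒢 ℋ (n, α) := by
  rcases n with _ | p
  · simp [cochains, gradedCochains]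
  · apply le_antisymm
    · rintro _ ⟨f, hf, rfl⟩
      rw [← sum_degPart (𝒢 := 𝒢) (ℋ := ℋ) f, map_sum]
      exact Submodule.sum_mem _ fun b _ => Submodule.mem_iSup_of_mem b ⟨_, degPart_mem hf b, rfl⟩
    · exact iSup_le fun α => Submodule.map_mono inf_le_left

theorem iSup_gradedCochains : ⨆ i, gradedCochains 𝒢 ℋ i = totalCochains 𝒢 (H := H) := by
  rw [iSup_prod, totalCochains]
  exact iSup_congr fun n => (cochains_eq_iSup n).symm

theorem iSupIndep_of_projections {ι A : Type*} [AddCommGroup A] [Module K A]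
    {L : ι → Submodule K A} (P : ι → A →ₗ[K] A) (h1 : ∀ i, ∀ x ∈ L i, P i x = x)
    (h2 : ∀ i j, j ≠ i → ∀ x ∈ L j, P i x = 0) : iSupIndep L := by
  intro i
  rw [Submodule.disjoint_def]
  intro x hx hx'
  have h : ⨆ j, ⨆ (_ : j ≠ i), L j ≤ LinearMap.ker (P i) :=
    iSup₂_le fun j hj x hx => LinearMap.mem_ker.2 (h2 i j hj x hx)
  rw [← h1 i x hx]
  exact h hx'

theorem iSupIndep_gradedCochains : iSupIndep (gradedCochains 𝒢 ℋ) := by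
  refine iSupIndep_of_projections (fun i => match i with
    | (0, _) => 0
    | (p + 1, α) => ofMulti p ∘ₗ degPart (prodGrading 𝒢 ℋ) (prodGrading 𝒢 ℋ) α ∘ₗ
      DirectSum.component K ℕ (fun p => Multi K (p + 1) (G × H) (G × H)) p) ?_ ?_
  · intro i x hx
    rcases eq_zero_or_exists hx with rfl | ⟨p, α, rfl⟩
    · simp
    · obtain ⟨f, hf, rfl⟩ := hx
      simp only [LinearMap.comp_apply]
      rw [DirectSum.component.lof_self, degPart_of_mem (hat_mem hf).2, if_pos rfl]
  · rintro ⟨_ | p, α⟩ j hj x hx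
    · rfl
    rcases eq_zero_or_exists hx with rfl | ⟨q, β, rfl⟩
    · simp
    · obtain ⟨f, hf, rfl⟩ := hx
      simp only [LinearMap.comp_apply]
      rcases eq_or_ne q p with rfl | h
      · rw [DirectSum.component.lof_self, degPart_of_mem (hat_mem hf).2,
          if_neg (fun h => hj (by rw [h])), map_zero]
      · rw [DirectSum.component.of, dif_neg h, map_zero, map_zero]

theorem totalCochains_induction {P : NR K (G × H) → Prop}
    (mem : ∀ k, ∀ z ∈ gradedCochains 𝒢 ℋ k, P z) (h_zero : P 0)
    (h_add : ∀ z w, P z → P w → P (z + w)) {z : NR K (G × H)}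
    (hz : z ∈ totalCochains 𝒢 (H := H)) : P z := by
  rw [← iSup_gradedCochains (ℋ := ℋ)] at hz
  exact Submodule.iSup_induction (motive := P) _ hz mem h_zero h_add

/-- Stated for an arbitrary action, so that it can be applied to the twisted one. Entries ranging
over all of `C^*` are reduced to homogeneous ones by linearity. -/
theorem isDifferentialGradedLieAlgebra (ρ : Action π μ) :
    IsDifferentialGradedLieAlgebra (totalCochains 𝒢 (H := H)) (gradedCochains 𝒢 ℋ)
      (derivedBracket 𝒢 μ) (partialPiRho ρ) where
  iSup_eq := iSup_gradedCochains
  independent := iSupIndep_gradedCochains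
  bracket_mem _ _ _ hx _ hy := derivedBracket_mem hx hy
  bracket_skew _ _ _ hx _ hy := derivedBracket_skew hx hy
  jacobi i j x hx y hy z hz := by
    refine totalCochains_induction (ℋ := ℋ) (P := fun z =>
      derivedBracket 𝒢 μ x (derivedBracket 𝒢 μ y z) =
        derivedBracket 𝒢 μ (derivedBracket 𝒢 μ x y) z +
          commSign i j • derivedBracket 𝒢 μ y (derivedBracket 𝒢 μ x z))
      (fun k z hz => derivedBracket_jacobi hx hy hz)
      (by simp) (fun z w hz hw => ?_) hz
    simp only [map_add, hz, hw, smul_add]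
    abel
  d_mem _ _ hx := partialPiRho_mem_gradedCochains ρ hx
  d_bracket i x hx y hy := by
    refine totalCochains_induction (ℋ := ℋ) (P := fun y =>
      partialPiRho ρ (derivedBracket 𝒢 μ x y) = derivedBracket 𝒢 μ (partialPiRho ρ x) y +
        commSign (1, 0) i • derivedBracket 𝒢 μ x (partialPiRho ρ y))
      (fun k y hy => partialPiRho_derivedBracket ρ hx hy)
      (by simp) (fun z w hz hw => ?_) hy
    simp only [map_add, hz, hw, smul_add]
    abel
  d_d x hx := by
    refine totalCochains_induction (ℋ := ℋ) (P := fun x => partialPiRho ρ (partialPiRho ρ x) = 0)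
      (fun k x hx => partialPiRho_sq ρ hx)
      (by simp) (fun z w hz hw => ?_) hx
    simp only [map_add, hz, hw, add_zero]

theorem coboundaries_le_cocycles (ρ : Action π μ) {D : G →ₗ[K] H} (hD : IsCrossedHom ρ D)
    (n : ℕ) : coboundaries ρ D n ≤ cocycles ρ D n := by
  rcases n with _ | n
  · exact bot_le
  · rw [coboundaries, cocycles, dCrossed_eq_partialPiRho ρ hD, cochains_eq_iSup (ℋ := ℋ) n,
      cochains_eq_iSup (ℋ := ℋ) (n + 1), Submodule.map_iSup]
    refine iSup_le fun α => ?_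
    rintro _ ⟨x, hx, rfl⟩
    refine ⟨Submodule.mem_iSup_of_mem α ?_, LinearMap.mem_ker.2 (partialPiRho_sq _ hx)⟩
    have := partialPiRho_mem_gradedCochains (ρ.twistBy hD) hx
    rwa [show ((n, α) : ℕ × ZMod 2) + (1, 0) = (n + 1, α) by simp] at this

end Crossed

end SuperLie

end

theorem mainTheorem3 {K : Type*} [Field K]
    {G : Type*} [AddCommGroup G] [Module K G] {H : Type*} [AddCommGroup H] [Module K H]
    (𝒢 : ZMod 2 → Submodule K G) (ℋ : ZMod 2 → Submodule K H)
    [DirectSum.Decomposition 𝒢] [DirectSum.Decomposition ℋ]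
    (π : SuperLie.LieSuperalgebra 𝒢) (μ : SuperLie.LieSuperalgebra ℋ)
    (ρ : SuperLie.Action π μ) (D : G →ₗ[K] H) (hD : SuperLie.IsCrossedHom ρ D) :
    SuperLie.IsDifferentialGradedLieAlgebra
        (SuperLie.totalCochains 𝒢 (H := H)) (SuperLie.gradedCochains 𝒢 ℋ)
        (SuperLie.derivedBracket 𝒢 μ) (SuperLie.dCrossed ρ D) ∧
      ∀ n : ℕ, SuperLie.coboundaries ρ D n ≤ SuperLie.cocycles ρ D n ∧
        Function.Surjective (SuperLie.cohomologyClass ρ D n) ∧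
        (LinearMap.ker (SuperLie.cohomologyClass ρ D n)).map (SuperLie.cocycles ρ D n).subtype =
          SuperLie.coboundaries ρ D n := by
  refine ⟨?_, fun n => ⟨SuperLie.coboundaries_le_cocycles ρ hD n, ?_, ?_⟩⟩
  -- From here on `D` enters only through the twisted action.
  · rw [SuperLie.dCrossed_eq_partialPiRho ρ hD]
    exact SuperLie.isDifferentialGradedLieAlgebra _
  · exact Submodule.mkQ_surjective _
  · have h : LinearMap.ker (SuperLie.cohomologyClass ρ D n) =
        (SuperLie.coboundaries ρ D n).submoduleOf (SuperLie.cocycles ρ D n) :=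
      Submodule.ext fun _ => Submodule.Quotient.mk_eq_zero _
    rw [h, Submodule.submoduleOf, Submodule.map_comap_subtype,
      inf_eq_right.2 (SuperLie.coboundaries_le_cocycles ρ hD n)]
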